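/- **Setting.** Let $\sigma$ be a first-order signature with equality whose function and predicate symbols of each arity are numbered by natural numbers (so $\sigma$ is countable), with countably many variables. Formulas, taken up to renaming of bound variables, are built from $s=t$, $P(t_1,\dots,t_n)$, $\neg,\wedge,\vee,\to,\forall,\exists$ and $(RTC_{x,y}\,\varphi)(s,t)$, which binds $x,y$ in $\varphi$. In the standard semantics (over non-empty structures) $M,v\models(RTC_{x,y}\,\varphi)(s,t)$ iff $v(s)=v(t)$ or there are $n>0$ and $a_0,\dots,a_n$ with $a_0=v(s)$, $a_n=v(t)$ and $M,v[x:=a_i,y:=a_{i+1}]\models\varphi$ for all $i<n$. A sequent $\Gamma\Rightarrow\Delta$ (finite sets of formulas) is valid if every $M,v$ satisfying all of $\Gamma$ satisfies some formula of $\Delta$. **The system $RTC^\omega_G$** consists of the sequent calculus $LK_=$ (axiom $\varphi\Rightarrow\varphi$, weakenings, left and right rules for the connectives and quantifiers, $\Rightarrow t=t$, from $\Gamma\Rightarrow\varphi[s/x],\Delta$ infer $\Gamma,s=t\Rightarrow\varphi[t/x],\Delta$ and from $\Gamma\Rightarrow\varphi[t/x],\Delta$ infer $\Gamma,s=t\Rightarrow\varphi[s/x],\Delta$,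 cut, substitution) together with: the axiom $\Gamma\Rightarrow\Delta,(RTC_{x,y}\varphi)(s,s)$; from $\Gamma\Rightarrow\Delta,(RTC_{x,y}\varphi)(s,r)$ and $\Gamma\Rightarrow\Delta,\varphi[r/x,t/y]$ infer $\Gamma\Rightarrow\Delta,(RTC_{x,y}\varphi)(s,t)$; and the case rule: from $\Gamma,s=t\Rightarrow\Delta$ and $\Gamma,(RTC_{x,y}\varphi)(s,z),\varphi[z/x,t/y]\Rightarrow\Delta$ with $z$ fresh infer $\Gamma,(RTC_{x,y}\varphi)(s,t)\Rightarrow\Delta$. A pre-proof is a possibly infinite derivation tree without open nodes. A trace along a path consists of $RTC$ formulas $\tau_i$ in the left-hand sides of consecutive sequents (from some point on) such that $\tau_i=\tau_{i+1}$ (for a substitution step by $\theta$: $\tau_i=\tau_{i+1}\theta$), or the step goes to the right-hand premise of a case rule, $\tau_i=(RTC_{x,y}\varphi)(s,t)$ is its principal formula and $\tau_{i+1}=(RTC_{x,y}\varphi)(s,z)$; in the last case the trace progresses at $i$. A proof is a pre-proof each of whose infinite paths from the root is followed by a trace that progresses infinitely often. **Search trees.** A schedule element is a formula $\neg\varphi$,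 $\varphi\wedge\psi$, $\varphi\vee\psi$ or $\varphi\to\psi$; a pair $\langle\forall x\varphi,t\rangle$ or $\langle\exists x\varphi,t\rangle$; a tuple $\langle(RTC_{x,y}\varphi)(s,t),r,z,\Gamma,\Delta\rangle$ with finite lists $\Gamma,\Delta$ and $z$ not free in $\Gamma$, $\Delta$ or $(RTC_{x,y}\varphi)(s,t)$; or a tuple $\langle s=t,x,\varphi,n,\Gamma,\Delta\rangle$ with $n\in\{1,2\}$. Given a sequence $E=(E_i)_{i\ge0}$ of schedule elements and a sequent $S$, let $T_0$ be the open node $S$, and let $T_{i+1}$ arise from $T_i$ by first closing every open node that is an instance, after weakening, of one of the axioms $\varphi\Rightarrow\varphi$, $\Rightarrow t=t$, $\Rightarrow(RTC_{x,y}\varphi)(s,s)$, and then applying at all remaining open nodes the left and then the right rule for the formula of $E_i$, keeping principal formulas in the premises. Here $\forall$-left and $\exists$-right use the term $t$ of the pair, $\forall$-right and $\exists$-left a fresh variable. The $RTC$-right rule uses $r$; the case rule uses $z$ and is applied only at nodes $\Gamma',(RTC_{x,y}\varphi)(s,t)\Rightarrow\Delta'$ with $\Gamma'\subseteq\Gamma$,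 $\Delta'\subseteq\Delta$. An element $\langle s=t,x,\varphi,n,\Gamma,\Delta\rangle$ acts at nodes $\Gamma',s=t\Rightarrow\Delta',\psi$ with $\Gamma'\subseteq\Gamma$, $\Delta'\subseteq\Delta$, where $\psi=\varphi[s/x]$ if $n=1$ and $\psi=\varphi[t/x]$ if $n=2$, and adds to the right-hand side $\varphi[t/x]$, respectively $\varphi[s/x]$. The search tree $T_\omega$ of $S$ is the limit of the $T_i$. The schedule $E$ is *fair* if every schedule element occurs in it infinitely often and, for every sequent $S$ and every choice of $(RTC_{x,y}\varphi)(s,t),r$ (respectively of $s=t,x,\varphi,n$), there are infinitely many $i$ such that $E_i=\langle(RTC_{x,y}\varphi)(s,t),r,z,\Gamma,\Delta\rangle$ (respectively $E_i=\langle s=t,x,\varphi,n,\Gamma,\Delta\rangle$) with $\Gamma'\subseteq\Gamma$ and $\Delta'\subseteq\Delta$ for all open nodes $\Gamma'\Rightarrow\Delta'$ of the stage $T_i$ for $S$. A limit sequent $\Gamma_\omega\Rightarrow\Delta_\omega$ of $T_\omega$ is the sequent at an open node of $T_\omega$, or the pair of unions of the left-hand and of the right-hand sides along an infinite path from the root that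 is followed by no infinitely progressing trace. Let $\sim$ be the least congruence on terms with $s\sim t$ whenever $(s=t)\in\Gamma_\omega$; let $M_\omega$ be the structure of terms modulo $\sim$ with $f([t_1],\dots,[t_k])=[f(t_1,\dots,t_k)]$ and $q$ interpreted as $\{([t_1],\dots,[t_k])\mid q(t_1,\dots,t_k)\in\Gamma_\omega\}$, and let $\rho_\omega(x)=[x]$. **Theorem (Completeness).** 1. Every sequent valid in the standard semantics has a cut-free $RTC^\omega_G$ proof, which is recursive if the signature is recursive (i.e. it is decidable which numbers are those of function, and of predicate, symbols of a given arity). 2. Fair schedules exist; if the signature is recursive, there is a recursive fair schedule. 3. Let $E$ be a fair schedule, $S=(\Gamma\Rightarrow\Delta)$ a sequent and $T_\omega$ its search tree. (a) If $S$ is valid, then $T_\omega$ is a cut-free $RTC^\omega_G$ proof of $S$, and it is recursive if $E$ is. (b) If $T_\omega$ is not an $RTC^\omega_G$ proof of $S$, then it has a limit sequent, and for every limit sequent $\Gamma_\omega\Rightarrow\Delta_\omega$ of $T_\omega$ we have $\Gamma\subseteq\Gamma_\omega$, $\Delta\subseteq\Delta_\omega$, $M_\omega,\rho_\omega\models\psi$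 for all $\psi\in\Gamma_\omega$ and $M_\omega,\rho_\omega\not\models\psi$ for all $\psi\in\Delta_\omega$; in particular $(M_\omega,\rho_\omega)$ is a counter-model of $S$. -/

import Mathlib

open FirstOrder Filter

universe u v

namespace RTC

variable {L : FirstOrder.Language.{u, v}}

/-! ### Terms and formulas

Variables are the natural numbers.  Formulas are identified up to renaming of bound variables by
using bound indices: a term or formula of depth `n` may mention the free variables `Sum.inl x` and
the bound slots `Sum.inr i` with `i : Fin n`; a binder of a formula of depth `n` binds the
slot `n` (and `rtc` binds the slots `n` and `n + 1`). -/

/-- Terms at binding depth `n`. -/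
abbrev Tm (L : FirstOrder.Language.{u, v}) (n : ℕ) : Type u := L.Term (ℕ ⊕ Fin n)

/-- The free variable `x`, as a term. -/
abbrev fvar {n : ℕ} (x : ℕ) : Tm L n := FirstOrder.Language.Term.var (Sum.inl x)

/-- Formulas of transitive closure logic at binding depth `n`. -/
inductive Fml (L : FirstOrder.Language.{u, v}) : ℕ → Type (max u v)
  | eq {n : ℕ} (s t : Tm L n) : Fml L n
  | rel {n k : ℕ} (R : L.Relations k) (ts : Fin k → Tm L n) : Fml L n
  | neg {n : ℕ} (φ : Fml L n) : Fml L n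
  | and {n : ℕ} (φ ψ : Fml L n) : Fml L n
  | or {n : ℕ} (φ ψ : Fml L n) : Fml L n
  | imp {n : ℕ} (φ ψ : Fml L n) : Fml L n
  | all {n : ℕ} (φ : Fml L (n + 1)) : Fml L n
  | ex {n : ℕ} (φ : Fml L (n + 1)) : Fml L n
  /-- `(RTC_{x,y} φ)(s, t)`, where `x` is slot `n` and `y` is slot `n + 1` of `φ`. -/
  | rtc {n : ℕ} (φ : Fml L (n + 2)) (s t : Tm L n) : Fml L n

/-- Genuine terms and formulas: no unbound slot. -/
abbrev Term₀ (L : FirstOrder.Language.{u, v}) : Type u := Tm L 0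

abbrev Formula₀ (L : FirstOrder.Language.{u, v}) : Type (max u v) := Fml L 0

/-- Weakening of the binding depth of a term by one. -/
def shift {n : ℕ} (t : Tm L n) : Tm L (n + 1) := t.relabel (Sum.map id Fin.castSucc)

/-- Extension of a substitution under one binder. -/
def lift {m n : ℕ} (τ : ℕ ⊕ Fin m → Tm L n) : ℕ ⊕ Fin (m + 1) → Tm L (n + 1) :=
  Sum.elim (fun x => shift (τ (Sum.inl x)))
    (Fin.snoc (α := fun _ => Tm L (n + 1)) (fun i => shift (τ (Sum.inr i)))
      (FirstOrder.Language.Term.var (Sum.inr (Fin.last n))))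

/-- Simultaneous capture-avoiding substitution for all free variables and all unbound slots. -/
def Fml.bind : {m n : ℕ} → Fml L m → (ℕ ⊕ Fin m → Tm L n) → Fml L n
  | _, _, .eq s t, τ => .eq (s.subst τ) (t.subst τ)
  | _, _, .rel R ts, τ => .rel R (fun i => (ts i).subst τ)
  | _, _, .neg φ, τ => .neg (φ.bind τ)
  | _, _, .and φ ψ, τ => .and (φ.bind τ) (ψ.bind τ)
  | _, _, .or φ ψ, τ => .or (φ.bind τ) (ψ.bind τ)
  | _, _, .imp φ ψ, τ => .imp (φ.bind τ) (ψ.bind τ)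
  | _, _, .all φ, τ => .all (φ.bind (lift τ))
  | _, _, .ex φ, τ => .ex (φ.bind (lift τ))
  | _, _, .rtc φ s t, τ => .rtc (φ.bind (lift (lift τ))) (s.subst τ) (t.subst τ)

/-- The body of a quantified formula with the term `t` for the bound variable. -/
def Fml.inst (φ : Fml L 1) (t : Term₀ L) : Formula₀ L :=
  φ.bind (Sum.elim fvar (fun _ => t))

/-- The body `φ` of an `RTC` formula with `r` for `x` and `t` for `y`. -/
def Fml.inst₂ (φ : Fml L 2) (r t : Term₀ L) : Formula₀ L :=
  φ.bind (Sum.elim fvar ![r, t])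

/-- Simultaneous substitution of terms for free variables. -/
def Fml.subst (φ : Formula₀ L) (σ : ℕ → Term₀ L) : Formula₀ L :=
  φ.bind (Sum.elim σ Fin.elim0)

/-- `φ[t/x]`. -/
def Fml.subst₁ (φ : Formula₀ L) (x : ℕ) (t : Term₀ L) : Formula₀ L :=
  φ.subst (Function.update fvar x t)

/-- The substitution given by a finite list of pairs `(x, t)`. -/
def listSubst : List (ℕ × Term₀ L) → ℕ → Term₀ L
  | [], y => fvar y
  | (x, t) :: θ, y => if y = x then t else listSubst θ y

/-- The free variables of a formula. -/
def Fml.fv : {n : ℕ} → Fml L n → Finset ℕ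
  | _, .eq s t => s.varFinsetLeft ∪ t.varFinsetLeft
  | _, .rel _ ts => Finset.univ.biUnion (fun i => (ts i).varFinsetLeft)
  | _, .neg φ => φ.fv
  | _, .and φ ψ => φ.fv ∪ ψ.fv
  | _, .or φ ψ => φ.fv ∪ ψ.fv
  | _, .imp φ ψ => φ.fv ∪ ψ.fv
  | _, .all φ => φ.fv
  | _, .ex φ => φ.fv
  | _, .rtc φ s t => φ.fv ∪ s.varFinsetLeft ∪ t.varFinsetLeft

/-! ### Standard semantics -/

/-- Satisfaction in a structure, under an assignment `ρ` of the free variables and an assignment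
`xs` of the unbound slots. -/
def Fml.Sat {M : Type*} [L.Structure M] : {n : ℕ} → Fml L n → (ℕ → M) → (Fin n → M) → Prop
  | _, .eq s t, ρ, xs => s.realize (Sum.elim ρ xs) = t.realize (Sum.elim ρ xs)
  | _, .rel R ts, ρ, xs =>
      FirstOrder.Language.Structure.RelMap R (fun i => (ts i).realize (Sum.elim ρ xs))
  | _, .neg φ, ρ, xs => ¬ φ.Sat ρ xs
  | _, .and φ ψ, ρ, xs => φ.Sat ρ xs ∧ ψ.Sat ρ xs
  | _, .or φ ψ, ρ, xs => φ.Sat ρ xs ∨ ψ.Sat ρ xs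
  | _, .imp φ ψ, ρ, xs => φ.Sat ρ xs → ψ.Sat ρ xs
  | _, .all φ, ρ, xs => ∀ a : M, φ.Sat ρ (Fin.snoc (α := fun _ => M) xs a)
  | _, .ex φ, ρ, xs => ∃ a : M, φ.Sat ρ (Fin.snoc (α := fun _ => M) xs a)
  | _, .rtc φ s t, ρ, xs =>
      s.realize (Sum.elim ρ xs) = t.realize (Sum.elim ρ xs) ∨
      ∃ (k : ℕ) (a : ℕ → M), 0 < k ∧
        s.realize (Sum.elim ρ xs) = a 0 ∧ t.realize (Sum.elim ρ xs) = a k ∧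
        ∀ i < k, φ.Sat ρ
          (Fin.snoc (α := fun _ => M) (Fin.snoc (α := fun _ => M) xs (a i)) (a (i + 1)))

/-- `M, ρ ⊨ φ` for a genuine formula. -/
def Fml.Holds {M : Type*} [L.Structure M] (φ : Formula₀ L) (ρ : ℕ → M) : Prop :=
  φ.Sat ρ Fin.elim0

/-! ### Gödel numbering -/

section Coding

variable [∀ n, Encodable (L.Functions n)] [∀ n, Encodable (L.Relations n)]

/-- Gödel number of a term. -/
def tmCode {n : ℕ} : Tm L n → ℕ
  | .var (Sum.inl x) => Nat.pair 0 x
  | .var (Sum.inr i) => Nat.pair 1 i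
  | .func (l := k) f ts =>
      Nat.pair 2 (Nat.pair (Nat.pair k (Encodable.encode f))
        (Encodable.encode (List.ofFn fun i => tmCode (ts i))))

/-- Gödel number of a formula. -/
def Fml.code : {n : ℕ} → Fml L n → ℕ
  | _, .eq s t => Nat.pair 0 (Nat.pair (tmCode s) (tmCode t))
  | _, .rel (k := k) R ts =>
      Nat.pair 1 (Nat.pair (Nat.pair k (Encodable.encode R))
        (Encodable.encode (List.ofFn fun i => tmCode (ts i))))
  | _, .neg φ => Nat.pair 2 φ.code
  | _, .and φ ψ => Nat.pair 3 (Nat.pair φ.code ψ.code)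
  | _, .or φ ψ => Nat.pair 4 (Nat.pair φ.code ψ.code)
  | _, .imp φ ψ => Nat.pair 5 (Nat.pair φ.code ψ.code)
  | _, .all φ => Nat.pair 6 φ.code
  | _, .ex φ => Nat.pair 7 φ.code
  | _, .rtc φ s t => Nat.pair 8 (Nat.pair φ.code (Nat.pair (tmCode s) (tmCode t)))

theorem tmCode_injective {n : ℕ} : Function.Injective (tmCode : Tm L n → ℕ) := by
  intro s
  induction s with
  | var a =>
    intro t h
    rcases a with x | i <;> rcases t with (y | j) | ⟨g, us⟩ <;>
      simp_all [tmCode, Nat.pair_eq_pair, Fin.ext_iff]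
  | @func k f ts ih =>
    intro t h
    rcases t with (y | j) | @⟨k', g, us⟩
    · simp [tmCode, Nat.pair_eq_pair] at h
    · simp [tmCode, Nat.pair_eq_pair] at h
    · simp only [tmCode, Nat.pair_eq_pair, true_and] at h
      obtain ⟨⟨rfl, hf⟩, hts⟩ := h
      have hfg := Encodable.encode_injective hf
      have hl := List.ofFn_injective (Encodable.encode_injective hts)
      have : ts = us := funext fun i => ih i (congrFun hl i)
      rw [hfg, this]

theorem Fml.code_injective {n : ℕ} : Function.Injective (Fml.code : Fml L n → ℕ) := by
  intro φ
  induction φ with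
  | eq s t =>
    intro ψ h
    cases ψ <;> simp_all [Fml.code, Nat.pair_eq_pair, tmCode_injective.eq_iff]
  | @rel n k R ts =>
    intro ψ h
    cases ψ <;> simp only [Fml.code, Nat.pair_eq_pair] at h <;> try omega
    obtain ⟨-, ⟨rfl, hR⟩, hts⟩ := h
    have hRR := Encodable.encode_injective hR
    have hl := List.ofFn_injective (Encodable.encode_injective hts)
    rw [hRR, show ts = _ from funext fun i => tmCode_injective (congrFun hl i)]
  | neg φ ih =>
    intro ψ h
    cases ψ <;> simp only [Fml.code, Nat.pair_eq_pair] at h <;> try omega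
    rw [ih h.2]
  | and φ χ ih₁ ih₂ =>
    intro ψ h
    cases ψ <;> simp only [Fml.code, Nat.pair_eq_pair] at h <;> try omega
    rw [ih₁ h.2.1, ih₂ h.2.2]
  | or φ χ ih₁ ih₂ =>
    intro ψ h
    cases ψ <;> simp only [Fml.code, Nat.pair_eq_pair] at h <;> try omega
    rw [ih₁ h.2.1, ih₂ h.2.2]
  | imp φ χ ih₁ ih₂ =>
    intro ψ h
    cases ψ <;> simp only [Fml.code, Nat.pair_eq_pair] at h <;> try omega
    rw [ih₁ h.2.1, ih₂ h.2.2]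
  | all φ ih =>
    intro ψ h
    cases ψ <;> simp only [Fml.code, Nat.pair_eq_pair] at h <;> try omega
    rw [ih h.2]
  | ex φ ih =>
    intro ψ h
    cases ψ <;> simp only [Fml.code, Nat.pair_eq_pair] at h <;> try omega
    rw [ih h.2]
  | rtc φ s t ih =>
    intro ψ h
    cases ψ <;> simp only [Fml.code, Nat.pair_eq_pair] at h <;> try omega
    rw [ih h.2.1, tmCode_injective h.2.2.1, tmCode_injective h.2.2.2]

/-- Formulas are ordered (and their equality is decided) by Gödel number. -/
instance {n : ℕ} : LinearOrder (Fml L n) := LinearOrder.lift' Fml.code Fml.code_injective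

instance {n : ℕ} : DecidableEq (Tm L n) := fun s t =>
  decidable_of_iff (tmCode s = tmCode t) tmCode_injective.eq_iff

/-! ### Sequents -/

/-- Sequents `left ⇒ right` of finite sets of formulas. -/
structure Sequent (L : FirstOrder.Language.{u, v}) where
  left : Finset (Formula₀ L)
  right : Finset (Formula₀ L)

/-- The sequent is valid in the standard semantics. -/
def Sequent.Valid (S : Sequent L) : Prop :=
  ∀ (M : Type u) [Nonempty M] [L.Structure M] (ρ : ℕ → M),
    (∀ φ ∈ S.left, φ.Holds ρ) → ∃ ψ ∈ S.right, ψ.Holds ρ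

/-- Free variables of a finite set of formulas. -/
def setFv (Γ : Finset (Formula₀ L)) : Finset ℕ := Γ.biUnion Fml.fv

/-- A variable not free in the sequent. -/
def Sequent.fresh (S : Sequent L) : ℕ := (setFv S.left ∪ setFv S.right).sup id + 1

/-! ### The infinitary system -/

/-- Instances of the inference rules, without their side conditions. -/
inductive Inference (L : FirstOrder.Language.{u, v})
  | ax (φ : Formula₀ L)
  | weakL (Γ Δ : Finset (Formula₀ L)) (φ : Formula₀ L)
  | weakR (Γ Δ : Finset (Formula₀ L)) (φ : Formula₀ L)
  | orL (Γ Δ : Finset (Formula₀ L)) (φ ψ : Formula₀ L)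
  | orR (Γ Δ : Finset (Formula₀ L)) (φ ψ : Formula₀ L)
  | andL (Γ Δ : Finset (Formula₀ L)) (φ ψ : Formula₀ L)
  | andR (Γ Δ : Finset (Formula₀ L)) (φ ψ : Formula₀ L)
  | impL (Γ Δ : Finset (Formula₀ L)) (φ ψ : Formula₀ L)
  | impR (Γ Δ : Finset (Formula₀ L)) (φ ψ : Formula₀ L)
  | negL (Γ Δ : Finset (Formula₀ L)) (φ : Formula₀ L)
  | negR (Γ Δ : Finset (Formula₀ L)) (φ : Formula₀ L)
  | exL (Γ Δ : Finset (Formula₀ L)) (φ : Fml L 1) (z : ℕ)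
  | exR (Γ Δ : Finset (Formula₀ L)) (φ : Fml L 1) (t : Term₀ L)
  | allL (Γ Δ : Finset (Formula₀ L)) (φ : Fml L 1) (t : Term₀ L)
  | allR (Γ Δ : Finset (Formula₀ L)) (φ : Fml L 1) (z : ℕ)
  | eqL₁ (Γ Δ : Finset (Formula₀ L)) (s t : Term₀ L) (x : ℕ) (φ : Formula₀ L)
  | eqL₂ (Γ Δ : Finset (Formula₀ L)) (s t : Term₀ L) (x : ℕ) (φ : Formula₀ L)
  | eqR (t : Term₀ L)
  | cut (Γ Δ Γ' Δ' : Finset (Formula₀ L)) (φ : Formula₀ L)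
  | subst (Γ Δ : Finset (Formula₀ L)) (θ : List (ℕ × Term₀ L))
  | rtcRefl (Γ Δ : Finset (Formula₀ L)) (φ : Fml L 2) (s : Term₀ L)
  | rtcTrans (Γ Δ : Finset (Formula₀ L)) (φ : Fml L 2) (s t r : Term₀ L)
  | rtcCase (Γ Δ : Finset (Formula₀ L)) (φ : Fml L 2) (s t : Term₀ L) (z : ℕ)

/-- The conclusion of a rule instance. -/
def Inference.conclusion : Inference L → Sequent L
  | .ax φ => ⟨{φ}, {φ}⟩
  | .weakL Γ Δ φ => ⟨insert φ Γ, Δ⟩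
  | .weakR Γ Δ φ => ⟨Γ, insert φ Δ⟩
  | .orL Γ Δ φ ψ => ⟨insert (.or φ ψ) Γ, Δ⟩
  | .orR Γ Δ φ ψ => ⟨Γ, insert (.or φ ψ) Δ⟩
  | .andL Γ Δ φ ψ => ⟨insert (.and φ ψ) Γ, Δ⟩
  | .andR Γ Δ φ ψ => ⟨Γ, insert (.and φ ψ) Δ⟩
  | .impL Γ Δ φ ψ => ⟨insert (.imp φ ψ) Γ, Δ⟩
  | .impR Γ Δ φ ψ => ⟨Γ, insert (.imp φ ψ) Δ⟩
  | .negL Γ Δ φ => ⟨insert (.neg φ) Γ, Δ⟩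
  | .negR Γ Δ φ => ⟨Γ, insert (.neg φ) Δ⟩
  | .exL Γ Δ φ _ => ⟨insert (.ex φ) Γ, Δ⟩
  | .exR Γ Δ φ _ => ⟨Γ, insert (.ex φ) Δ⟩
  | .allL Γ Δ φ _ => ⟨insert (.all φ) Γ, Δ⟩
  | .allR Γ Δ φ _ => ⟨Γ, insert (.all φ) Δ⟩
  | .eqL₁ Γ Δ s t x φ => ⟨insert (.eq s t) Γ, insert (φ.subst₁ x t) Δ⟩
  | .eqL₂ Γ Δ s t x φ => ⟨insert (.eq s t) Γ, insert (φ.subst₁ x s) Δ⟩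
  | .eqR t => ⟨∅, {.eq t t}⟩
  | .cut Γ Δ Γ' Δ' _ => ⟨Γ ∪ Γ', Δ ∪ Δ'⟩
  | .subst Γ Δ θ => ⟨Γ.image fun φ => φ.subst (listSubst θ), Δ.image fun φ => φ.subst (listSubst θ)⟩
  | .rtcRefl Γ Δ φ s => ⟨Γ, insert (.rtc φ s s) Δ⟩
  | .rtcTrans Γ Δ φ s t _ => ⟨Γ, insert (.rtc φ s t) Δ⟩
  | .rtcCase Γ Δ φ s t _ => ⟨insert (.rtc φ s t) Γ, Δ⟩

/-- The premises of a rule instance, from left to right. -/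
def Inference.premises : Inference L → List (Sequent L)
  | .ax _ => []
  | .weakL Γ Δ _ => [⟨Γ, Δ⟩]
  | .weakR Γ Δ _ => [⟨Γ, Δ⟩]
  | .orL Γ Δ φ ψ => [⟨insert φ Γ, Δ⟩, ⟨insert ψ Γ, Δ⟩]
  | .orR Γ Δ φ ψ => [⟨Γ, insert φ (insert ψ Δ)⟩]
  | .andL Γ Δ φ ψ => [⟨insert φ (insert ψ Γ), Δ⟩]
  | .andR Γ Δ φ ψ => [⟨Γ, insert φ Δ⟩, ⟨Γ, insert ψ Δ⟩]
  | .impL Γ Δ φ ψ => [⟨Γ, insert φ Δ⟩, ⟨insert ψ Γ, Δ⟩]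
  | .impR Γ Δ φ ψ => [⟨insert φ Γ, insert ψ Δ⟩]
  | .negL Γ Δ φ => [⟨Γ, insert φ Δ⟩]
  | .negR Γ Δ φ => [⟨insert φ Γ, Δ⟩]
  | .exL Γ Δ φ z => [⟨insert (φ.inst (fvar z)) Γ, Δ⟩]
  | .exR Γ Δ φ t => [⟨Γ, insert (φ.inst t) Δ⟩]
  | .allL Γ Δ φ t => [⟨insert (φ.inst t) Γ, Δ⟩]
  | .allR Γ Δ φ z => [⟨Γ, insert (φ.inst (fvar z)) Δ⟩]
  | .eqL₁ Γ Δ s _ x φ => [⟨Γ, insert (φ.subst₁ x s) Δ⟩]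
  | .eqL₂ Γ Δ _ t x φ => [⟨Γ, insert (φ.subst₁ x t) Δ⟩]
  | .eqR _ => []
  | .cut Γ Δ Γ' Δ' φ => [⟨Γ, insert φ Δ⟩, ⟨insert φ Γ', Δ'⟩]
  | .subst Γ Δ _ => [⟨Γ, Δ⟩]
  | .rtcRefl _ _ _ _ => []
  | .rtcTrans Γ Δ φ s t r => [⟨Γ, insert (.rtc φ s r) Δ⟩, ⟨Γ, insert (φ.inst₂ r t) Δ⟩]
  | .rtcCase Γ Δ φ s t z =>
      [⟨insert (.eq s t) Γ, Δ⟩,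
        ⟨insert (.rtc φ s (fvar z)) (insert (φ.inst₂ (fvar z) t) Γ), Δ⟩]

/-- The side condition of a rule instance: eigenvariables are fresh. -/
def Inference.SideCondition : Inference L → Prop
  | .exL Γ Δ φ z => z ∉ setFv Γ ∪ setFv Δ ∪ φ.fv
  | .allR Γ Δ φ z => z ∉ setFv Γ ∪ setFv Δ ∪ φ.fv
  | .rtcCase Γ Δ φ s t z => z ∉ setFv Γ ∪ setFv Δ ∪ (Fml.rtc φ s t).fv
  | _ => True

def Inference.IsCut : Inference L → Prop
  | .cut _ _ _ _ _ => True
  | _ => False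

/-! ### Derivation trees, pre-proofs and proofs -/

/-- A node of a possibly open derivation tree: an open node, or a rule instance. -/
inductive Label (L : FirstOrder.Language.{u, v})
  | opn (S : Sequent L)
  | inf (I : Inference L)

/-- The sequent at a node. -/
def Label.sequent : Label L → Sequent L
  | .opn S => S
  | .inf I => I.conclusion

/-- The sequents at the children of a node. -/
def Label.premises : Label L → List (Sequent L)
  | .opn _ => []
  | .inf I => I.premises

/-- Labelled trees: a partial labelling of addresses.  The empty address is the root and
`p ++ [k]` is the `k`-th child of `p`. -/
abbrev Tree (L : FirstOrder.Language.{u, v}) := List ℕ → Option (Label L)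

/-- `T` is a possibly open, possibly infinite derivation tree with root sequent `S`. -/
structure IsDerivation (T : Tree L) (S : Sequent L) : Prop where
  root : (T []).map Label.sequent = some S
  child : ∀ p k, (T (p ++ [k])).map Label.sequent = (T p).bind fun l => l.premises[k]?
  side : ∀ p I, T p = some (.inf I) → I.SideCondition

/-- A pre-proof is a derivation tree without open nodes. -/
def IsPreProof (T : Tree L) (S : Sequent L) : Prop :=
  IsDerivation T S ∧ ∀ p S', T p ≠ some (.opn S')

/-- `b` (the sequence of premises chosen) is an infinite path of `T` from the root, along which
the rule instances are `I 0, I 1, …`. -/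
def IsInfinitePath (T : Tree L) (b : ℕ → ℕ) (I : ℕ → Inference L) : Prop :=
  ∀ n, T ((List.range n).map b) = some (.inf (I n))

def Fml.IsRTC (τ : Formula₀ L) : Prop := ∃ φ s t, τ = .rtc φ s t

/-- `τ` is principal in the case rule `I` and `τ'` is its immediate ancestor in the right-hand
premise (the one numbered `1`). -/
def Progress : Inference L → ℕ → Formula₀ L → Formula₀ L → Prop
  | .rtcCase _ _ φ s t z, k, τ, τ' => k = 1 ∧ τ = .rtc φ s t ∧ τ' = .rtc φ s (fvar z)
  | _, _, _, _ => False

/-- `(τ, τ')` is a trace pair for the conclusion of `I` and its premise number `k`. -/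
def TracePair (I : Inference L) (k : ℕ) (τ τ' : Formula₀ L) : Prop :=
  τ.IsRTC ∧ τ'.IsRTC ∧ τ ∈ I.conclusion.left ∧ (∃ S', I.premises[k]? = some S' ∧ τ' ∈ S'.left) ∧
  match I with
  | .subst _ _ θ => τ = τ'.subst (listSubst θ)
  | I => Progress I k τ τ' ∨ τ = τ'

/-- The infinite path is followed by some infinitely progressing trace. -/
def Traceable (b : ℕ → ℕ) (I : ℕ → Inference L) : Prop :=
  ∃ (k : ℕ) (τ : ℕ → Formula₀ L),
    (∀ i, TracePair (I (k + i)) (b (k + i)) (τ i) (τ (i + 1))) ∧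
    ∃ᶠ i in atTop, Progress (I (k + i)) (b (k + i)) (τ i) (τ (i + 1))

/-- Proofs: pre-proofs satisfying the global trace condition. -/
def IsProof (T : Tree L) (S : Sequent L) : Prop :=
  IsPreProof T S ∧ ∀ b I, IsInfinitePath T b I → Traceable b I

def CutFree (T : Tree L) : Prop := ∀ p I, T p = some (.inf I) → ¬ I.IsCut

/-! ### Schedules -/

/-- Schedule elements. -/
inductive Elem (L : FirstOrder.Language.{u, v})
  | neg (φ : Formula₀ L)
  | and (φ ψ : Formula₀ L)
  | or (φ ψ : Formula₀ L)
  | imp (φ ψ : Formula₀ L)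
  | all (φ : Fml L 1) (t : Term₀ L)
  | ex (φ : Fml L 1) (t : Term₀ L)
  | rtc (φ : Fml L 2) (s t r : Term₀ L) (z : ℕ) (Γ Δ : List (Formula₀ L))
      (fresh : (∀ ψ ∈ Γ, z ∉ ψ.fv) ∧ (∀ ψ ∈ Δ, z ∉ ψ.fv) ∧ z ∉ (Fml.rtc φ s t).fv)
  /-- `second = false` stands for `n = 1`, and `second = true` for `n = 2`. -/
  | eq (s t : Term₀ L) (x : ℕ) (φ : Formula₀ L) (second : Bool) (Γ Δ : List (Formula₀ L))

/-! ### Search trees -/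

/-- Finite, possibly open derivation trees. -/
inductive FinTree (L : FirstOrder.Language.{u, v})
  | opn (S : Sequent L)
  | nul (I : Inference L)
  | one (I : Inference L) (t : FinTree L)
  | two (I : Inference L) (t₀ t₁ : FinTree L)

/-- Replacement of every open node. -/
def FinTree.grow : FinTree L → (Sequent L → FinTree L) → FinTree L
  | .opn S, f => f S
  | .nul I, _ => .nul I
  | .one I t, f => .one I (t.grow f)
  | .two I t₀ t₁, f => .two I (t₀.grow f) (t₁.grow f)

/-- The sequents at the open nodes. -/
def FinTree.openNodes : FinTree L → List (Sequent L)
  | .opn S => [S]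
  | .nul _ => []
  | .one _ t => t.openNodes
  | .two _ t₀ t₁ => t₀.openNodes ++ t₁.openNodes

/-- The finite tree as a labelling of addresses. -/
def FinTree.label : FinTree L → Tree L
  | .opn S, [] => some (.opn S)
  | .nul I, [] => some (.inf I)
  | .one I _, [] => some (.inf I)
  | .two I _ _, [] => some (.inf I)
  | .one _ t, 0 :: p => t.label p
  | .two _ t₀ _, 0 :: p => t₀.label p
  | .two _ _ t₁, 1 :: p => t₁.label p
  | _, _ => none

/-- A single rule application, with open premises. -/
def FinTree.rule (I : Inference L) : FinTree L :=
  match I.premises with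
  | [] => .nul I
  | [S] => .one I (.opn S)
  | S₀ :: S₁ :: _ => .two I (.opn S₀) (.opn S₁)

/-- The derivation `t` of `Γ ⇒ Δ` followed by weakenings adding the formulas of the two lists. -/
def weaken (Γ Δ : Finset (Formula₀ L)) (t : FinTree L) :
    List (Formula₀ L) → List (Formula₀ L) → FinTree L
  | [], [] => t
  | [], ψ :: ds => .one (.weakR Γ (Δ ∪ ds.toFinset) ψ) (weaken Γ Δ t [] ds)
  | φ :: gs, ds => .one (.weakL (Γ ∪ gs.toFinset) (Δ ∪ ds.toFinset) φ) (weaken Γ Δ t gs ds)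

/-- The term `t`, if the formula is `t = t`. -/
def eqReflArg : Formula₀ L → Option (Term₀ L)
  | .eq s t => if s = t then some s else none
  | _ => none

/-- The pair of `φ` and `s`, if the formula is `(RTC_{x,y} φ)(s, s)`. -/
def rtcReflArg : Formula₀ L → Option (Fml L 2 × Term₀ L)
  | .rtc φ s t => if s = t then some (φ, s) else none
  | _ => none

/-- The closed derivation of an instance of an axiom (after weakenings), if the sequent is one. -/
def close (S : Sequent L) : Option (FinTree L) :=
  match (S.left ∩ S.right).sort.head? with
  | some φ =>
      some (weaken {φ} {φ} (.nul (.ax φ)) (S.left.erase φ).sort (S.right.erase φ).sort)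
  | none =>
    match S.right.sort.findSome? eqReflArg with
    | some t =>
        some (weaken ∅ {.eq t t} (.nul (.eqR t)) S.left.sort (S.right.erase (.eq t t)).sort)
    | none =>
      match S.right.sort.findSome? rtcReflArg with
      | some (φ, s) => some (.nul (.rtcRefl S.left S.right φ s))
      | none => none

/-- The rule instance to which the schedule element leads at an open node, by a left rule (for
`eq`: by an equality rule).  Principal formulas are kept in the premises. -/
def leftRule (S : Sequent L) : Elem L → Option (Inference L)
  | .neg φ => if .neg φ ∈ S.left then some (.negL S.left S.right φ) else none
  | .and φ ψ => if .and φ ψ ∈ S.left then some (.andL S.left S.right φ ψ) else none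
  | .or φ ψ => if .or φ ψ ∈ S.left then some (.orL S.left S.right φ ψ) else none
  | .imp φ ψ => if .imp φ ψ ∈ S.left then some (.impL S.left S.right φ ψ) else none
  | .all φ t => if .all φ ∈ S.left then some (.allL S.left S.right φ t) else none
  | .ex φ _ => if .ex φ ∈ S.left then some (.exL S.left S.right φ S.fresh) else none
  | .rtc φ s t _ z Γ Δ _ =>
      if .rtc φ s t ∈ S.left ∧ S.left ⊆ insert (.rtc φ s t) Γ.toFinset ∧ S.right ⊆ Δ.toFinset
      then some (.rtcCase S.left S.right φ s t z) else none
  | .eq s t x φ false Γ Δ =>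
      if .eq s t ∈ S.left ∧ S.left ⊆ insert (.eq s t) Γ.toFinset ∧
        φ.subst₁ x s ∈ S.right ∧ S.right ⊆ insert (φ.subst₁ x s) Δ.toFinset
      then some (.eqL₂ S.left S.right s t x φ) else none
  | .eq s t x φ true Γ Δ =>
      if .eq s t ∈ S.left ∧ S.left ⊆ insert (.eq s t) Γ.toFinset ∧
        φ.subst₁ x t ∈ S.right ∧ S.right ⊆ insert (φ.subst₁ x t) Δ.toFinset
      then some (.eqL₁ S.left S.right s t x φ) else none

/-- The same for right rules. -/
def rightRule (S : Sequent L) : Elem L → Option (Inference L)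
  | .neg φ => if .neg φ ∈ S.right then some (.negR S.left S.right φ) else none
  | .and φ ψ => if .and φ ψ ∈ S.right then some (.andR S.left S.right φ ψ) else none
  | .or φ ψ => if .or φ ψ ∈ S.right then some (.orR S.left S.right φ ψ) else none
  | .imp φ ψ => if .imp φ ψ ∈ S.right then some (.impR S.left S.right φ ψ) else none
  | .all φ _ => if .all φ ∈ S.right then some (.allR S.left S.right φ S.fresh) else none
  | .ex φ t => if .ex φ ∈ S.right then some (.exR S.left S.right φ t) else none
  | .rtc φ s t r _ _ _ _ =>
      if .rtc φ s t ∈ S.right then some (.rtcTrans S.left S.right φ s t r) else none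
  | .eq _ _ _ _ _ _ _ => none

/-- Application of the rule instance, if there is one, to an open node. -/
def applyRule (S : Sequent L) : Option (Inference L) → FinTree L
  | none => .opn S
  | some I => .rule I

/-- The development of an open node at the stage of the schedule element `e`: it is closed if it is
an instance of an axiom, and otherwise treated by the left and then by the right rule. -/
def develop (e : Elem L) (S : Sequent L) : FinTree L :=
  match close S with
  | some t => t
  | none => (applyRule S (leftRule S e)).grow fun S' => applyRule S' (rightRule S' e)

/-- The finite stages of the search for a proof of `S`. -/
def stage (E : ℕ → Elem L) (S : Sequent L) : ℕ → FinTree L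
  | 0 => .opn S
  | i + 1 => (stage E S i).grow (develop (E i))

open Classical in
/-- The search tree: the limit of the stages (the label at each address is eventually constant). -/
noncomputable def searchTree (E : ℕ → Elem L) (S : Sequent L) : Tree L := fun p =>
  if h : ∃ l, ∀ᶠ i in atTop, (stage E S i).label p = l then h.choose else none

/-- All sequents at open nodes of the finite tree lie within the contexts `Γ` and `Δ`. -/
def FinTree.Within (t : FinTree L) (Γ Δ : List (Formula₀ L)) : Prop :=
  ∀ S' ∈ t.openNodes, S'.left ⊆ Γ.toFinset ∧ S'.right ⊆ Δ.toFinset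

/-- Fair schedules: every schedule element occurs infinitely often and, for the two kinds of
elements which act only on open nodes within their contexts, each occurs infinitely often with
contexts that contain all the nodes which are open at that stage of the search for `S`. -/
structure IsFair (E : ℕ → Elem L) : Prop where
  recurs : ∀ e, ∃ᶠ i in atTop, E i = e
  rtc : ∀ (S : Sequent L) φ s t r, ∃ᶠ i in atTop, ∃ z Γ Δ h,
    E i = .rtc φ s t r z Γ Δ h ∧ (stage E S i).Within Γ Δ
  eq : ∀ (S : Sequent L) s t x φ n, ∃ᶠ i in atTop, ∃ Γ Δ,
    E i = .eq s t x φ n Γ Δ ∧ (stage E S i).Within Γ Δ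

/-! ### Recursive schedules and recursive trees -/

/-- Code of a finite list of formulas. -/
def listCode (l : List (Formula₀ L)) : ℕ := Encodable.encode (l.map Fml.code)

/-- Code of a finite set of formulas: its list in increasing order. -/
def setCode (Γ : Finset (Formula₀ L)) : ℕ := listCode Γ.sort

def Sequent.code (S : Sequent L) : ℕ := Nat.pair (setCode S.left) (setCode S.right)

def Inference.code : Inference L → ℕ
  | .ax φ => Encodable.encode [0, φ.code]
  | .weakL Γ Δ φ => Encodable.encode [1, setCode Γ, setCode Δ, φ.code]
  | .weakR Γ Δ φ => Encodable.encode [2, setCode Γ, setCode Δ, φ.code]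
  | .orL Γ Δ φ ψ => Encodable.encode [3, setCode Γ, setCode Δ, φ.code, ψ.code]
  | .orR Γ Δ φ ψ => Encodable.encode [4, setCode Γ, setCode Δ, φ.code, ψ.code]
  | .andL Γ Δ φ ψ => Encodable.encode [5, setCode Γ, setCode Δ, φ.code, ψ.code]
  | .andR Γ Δ φ ψ => Encodable.encode [6, setCode Γ, setCode Δ, φ.code, ψ.code]
  | .impL Γ Δ φ ψ => Encodable.encode [7, setCode Γ, setCode Δ, φ.code, ψ.code]
  | .impR Γ Δ φ ψ => Encodable.encode [8, setCode Γ, setCode Δ, φ.code, ψ.code]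
  | .negL Γ Δ φ => Encodable.encode [9, setCode Γ, setCode Δ, φ.code]
  | .negR Γ Δ φ => Encodable.encode [10, setCode Γ, setCode Δ, φ.code]
  | .exL Γ Δ φ z => Encodable.encode [11, setCode Γ, setCode Δ, φ.code, z]
  | .exR Γ Δ φ t => Encodable.encode [12, setCode Γ, setCode Δ, φ.code, tmCode t]
  | .allL Γ Δ φ t => Encodable.encode [13, setCode Γ, setCode Δ, φ.code, tmCode t]
  | .allR Γ Δ φ z => Encodable.encode [14, setCode Γ, setCode Δ, φ.code, z]
  | .eqL₁ Γ Δ s t x φ =>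
      Encodable.encode [15, setCode Γ, setCode Δ, tmCode s, tmCode t, x, φ.code]
  | .eqL₂ Γ Δ s t x φ =>
      Encodable.encode [16, setCode Γ, setCode Δ, tmCode s, tmCode t, x, φ.code]
  | .eqR t => Encodable.encode [17, tmCode t]
  | .cut Γ Δ Γ' Δ' φ =>
      Encodable.encode [18, setCode Γ, setCode Δ, setCode Γ', setCode Δ', φ.code]
  | .subst Γ Δ θ =>
      Encodable.encode
        [19, setCode Γ, setCode Δ, Encodable.encode (θ.map fun c => Nat.pair c.1 (tmCode c.2))]
  | .rtcRefl Γ Δ φ s => Encodable.encode [20, setCode Γ, setCode Δ, φ.code, tmCode s]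
  | .rtcTrans Γ Δ φ s t r =>
      Encodable.encode [21, setCode Γ, setCode Δ, φ.code, tmCode s, tmCode t, tmCode r]
  | .rtcCase Γ Δ φ s t z =>
      Encodable.encode [22, setCode Γ, setCode Δ, φ.code, tmCode s, tmCode t, z]

def Label.code : Label L → ℕ
  | .opn S => Nat.pair 0 S.code
  | .inf I => Nat.pair 1 I.code

def Elem.code : Elem L → ℕ
  | .neg φ => Encodable.encode [0, φ.code]
  | .and φ ψ => Encodable.encode [1, φ.code, ψ.code]
  | .or φ ψ => Encodable.encode [2, φ.code, ψ.code]
  | .imp φ ψ => Encodable.encode [3, φ.code, ψ.code]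
  | .all φ t => Encodable.encode [4, φ.code, tmCode t]
  | .ex φ t => Encodable.encode [5, φ.code, tmCode t]
  | .rtc φ s t r z Γ Δ _ =>
      Encodable.encode
        [6, φ.code, tmCode s, tmCode t, tmCode r, z, listCode Γ, listCode Δ]
  | .eq s t x φ n Γ Δ =>
      Encodable.encode
        [7, tmCode s, tmCode t, x, φ.code, Encodable.encode n, listCode Γ, listCode Δ]

/-- The schedule is a recursive enumeration. -/
def RecursiveSchedule (E : ℕ → Elem L) : Prop := Computable fun i => (E i).code

/-- The labelled tree is recursive. -/
def RecursiveTree (T : Tree L) : Prop :=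
  Computable fun p : List ℕ => (T p).map Label.code

/-- The numbering makes the signature recursive: it is decidable which numbers are those of function
symbols, and of predicate symbols, of a given arity. -/
def RecursiveSignature (L : FirstOrder.Language.{u, v})
    [∀ n, Encodable (L.Functions n)] [∀ n, Encodable (L.Relations n)] : Prop :=
  ComputablePred (fun c : ℕ × ℕ => ∃ f : L.Functions c.1, Encodable.encode f = c.2) ∧
  ComputablePred (fun c : ℕ × ℕ => ∃ R : L.Relations c.1, Encodable.encode R = c.2)

/-! ### Limit sequents and counter-interpretations -/

/-- `G ⇒ D` is a limit sequent of `T`: the sequent at an open node, or the union of the sequents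
along an infinite path from the root that no infinitely progressing trace follows. -/
def IsLimitSequent (T : Tree L) (G D : Set (Formula₀ L)) : Prop :=
  (∃ p S', T p = some (.opn S') ∧ G = S'.left ∧ D = S'.right) ∨
  (∃ b I, IsInfinitePath T b I ∧ ¬ Traceable b I ∧
    G = {φ | ∃ n, φ ∈ (I n).conclusion.left} ∧ D = {φ | ∃ n, φ ∈ (I n).conclusion.right})

end Coding

/-- The smallest congruence on terms containing the equations in `G`. -/
inductive Congr (G : Set (Formula₀ L)) : Term₀ L → Term₀ L → Prop
  | base {s t : Term₀ L} : Fml.eq s t ∈ G → Congr G s t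
  | refl (t : Term₀ L) : Congr G t t
  | symm {s t : Term₀ L} : Congr G s t → Congr G t s
  | trans {s t r : Term₀ L} : Congr G s t → Congr G t r → Congr G s r
  | func {k : ℕ} (f : L.Functions k) {ts us : Fin k → Term₀ L} :
      (∀ i, Congr G (ts i) (us i)) → Congr G (.func f ts) (.func f us)

def termSetoid (G : Set (Formula₀ L)) : Setoid (Term₀ L) :=
  ⟨Congr G, Congr.refl, Congr.symm, Congr.trans⟩

/-- The domain of the counter-interpretation: terms modulo the congruence. -/
def Herbrand (G : Set (Formula₀ L)) : Type u := Quotient (termSetoid G)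

/-- The class `[t]`. -/
def Herbrand.mk (G : Set (Formula₀ L)) (t : Term₀ L) : Herbrand G := Quotient.mk (termSetoid G) t

noncomputable instance (G : Set (Formula₀ L)) : L.Structure (Herbrand G) where
  funMap f xs := Herbrand.mk G (.func f fun i => Quotient.out (xs i))
  RelMap R xs := ∃ ts, (∀ i, xs i = Herbrand.mk G (ts i)) ∧ Fml.rel R ts ∈ G

/-- Function symbols act on classes through representatives. -/
theorem Herbrand.funMap_mk (G : Set (Formula₀ L)) {k : ℕ} (f : L.Functions k)
    (ts : Fin k → Term₀ L) :
    FirstOrder.Language.Structure.funMap f (fun i => Herbrand.mk G (ts i)) =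
      Herbrand.mk G (.func f ts) :=
  Quotient.sound (s := termSetoid G)
    (Congr.func f fun _ => Quotient.exact (s := termSetoid G) (Quotient.out_eq _))

/-- The valuation `x ↦ [x]`. -/
def Herbrand.val (G : Set (Formula₀ L)) : ℕ → Herbrand G := fun x => Herbrand.mk G (fvar x)

end RTC

/-!
The proof is a fair proof search whose failures yield countermodels.

Let `E` be fair and suppose that the search tree of `S` is not a proof.  By the definition of a
proof it has an open node or an untraceable infinite path, hence a limit sequent `G ⇒ D`.  Fairness
makes `G` and `D` a Hintikka pair (`isLimitSequent_hintikka`): every rule that the search can apply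
has been applied, because an infinite path leaves each finite stage through an open node, so that a
recurring schedule element acts arbitrarily late on the path (`IsInfinitePath.fire`).  The delicate
clause is that of an `RTC` formula on the left.  The case rule alone would allow it to be unfolded
forever, but the trace which moves on to the new `RTC` formula whenever the path enters the
right-hand premise of a case rule would then progress infinitely often.  On an untraceable path
this trace comes to rest, the last case rule applied to its formula puts an equation on the left,
and the formula unfolds along a finite chain of variables (`IsInfinitePath.rtcChain`).

In the term structure of a Hintikka pair all formulas of `G` are true and all formulas of `D` are
false (`Hintikka.truth`).  For equations, atomic formulas and `RTC` formulas in `D` this needs that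
`D` is closed under replacing terms by congruent ones.  The equality rules give closure under the
equations of `G`, and that suffices, since interchangeability inside the formulas of `D` is itself a
congruence (`Hintikka.subst_congr`).  So a search tree that is
not a proof yields a countermodel of `S`, and the search tree of a valid sequent is a proof
(`isProof_of_valid`).  It is cut-free by construction.

For recursiveness, the finite stages of the search are represented as lists of addresses with codes
of labels, on which the steps of the search act as primitive recursive functions
(`developTable_code`, `stage_succ_table`).  A label can still change only while there is an open
node on the way to it from the root.  In a proof each address is therefore settled at some stage,
and its label is found by running the search until then (`searchTree_recursive`).

A fair schedule is defined by recursion on its own history: the contexts of its `i`-th element are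
read off the open nodes of the `i`-th stage for a sequent named by the task at `i`
(`fairSchedule_isFair`).  It is recursive if the signature is, as the only decision it takes that is
not primitive recursive is whether a number is the code of a schedule element, and this amounts to
finitely many facts about the numbers of symbols (`factsHold_elemFacts`, `exists_computable_check`,
`fairSchedule_recursive`).
-/

namespace RTC
variable {L : FirstOrder.Language.{u, v}}

/-! ### Substitution -/

theorem subst_var {n : ℕ} (t : Tm L n) : t.subst (fun a => .var a) = t := by
  induction t with
  | var a => rfl
  | func f ts ih => simp [FirstOrder.Language.Term.subst, ih]

theorem subst_subst {α β γ : Type*} (t : L.Term α) (τ : α → L.Term β) (τ' : β → L.Term γ) :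
    (t.subst τ).subst τ' = t.subst fun a => (τ a).subst τ' := by
  induction t with
  | var a => rfl
  | func f ts ih => simp [FirstOrder.Language.Term.subst, ih]

theorem shift_eq_subst {n : ℕ} (t : Tm L n) :
    shift t = t.subst fun a => .var (Sum.map id Fin.castSucc a) := by
  induction t with
  | var a => rfl
  | func f ts ih =>
    simp only [shift, FirstOrder.Language.Term.relabel, FirstOrder.Language.Term.subst] at ih ⊢
    exact congrArg _ (funext ih)

/-- Two substitutions that agree on the free variables of a term and on all slots agree on it. -/
theorem subst_congr {n : ℕ} {β : Type*} {t : Tm L n} {τ τ' : ℕ ⊕ Fin n → L.Term β}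
    (h : ∀ x ∈ t.varFinsetLeft, τ (.inl x) = τ' (.inl x)) (h' : ∀ i, τ (.inr i) = τ' (.inr i)) :
    t.subst τ = t.subst τ' := by
  induction t with
  | var a =>
    rcases a with x | i
    · exact h x (by simp [FirstOrder.Language.Term.varFinsetLeft])
    · exact h' i
  | func f ts ih =>
    simp only [FirstOrder.Language.Term.subst]
    congr 1
    funext i
    refine ih i fun x hx => h x ?_
    simp only [FirstOrder.Language.Term.varFinsetLeft, Finset.mem_biUnion, Finset.mem_univ,
      true_and]
    exact ⟨i, hx⟩

@[simp] theorem lift_inl {m n : ℕ} (τ : ℕ ⊕ Fin m → Tm L n) (x : ℕ) :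
    lift τ (.inl x) = shift (τ (.inl x)) := rfl

@[simp] theorem lift_castSucc {m n : ℕ} (τ : ℕ ⊕ Fin m → Tm L n) (i : Fin m) :
    lift τ (.inr i.castSucc) = shift (τ (.inr i)) := by
  simp [lift]

@[simp] theorem lift_last {m n : ℕ} (τ : ℕ ⊕ Fin m → Tm L n) :
    lift τ (.inr (Fin.last m)) = .var (.inr (Fin.last n)) := by
  simp [lift]

theorem lift_var {n : ℕ} : lift (fun a => .var a : ℕ ⊕ Fin n → Tm L n) = fun a => .var a := by
  funext a
  rcases a with x | i
  · rfl
  · induction i using Fin.lastCases with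
    | last => simp
    | cast i => simp [shift]

theorem lift_comp {l m n : ℕ} (τ : ℕ ⊕ Fin l → Tm L m) (τ' : ℕ ⊕ Fin m → Tm L n) :
    (fun a => (lift τ a).subst (lift τ')) = lift fun a => (τ a).subst τ' := by
  have key : ∀ t : Tm L m, (shift t).subst (lift τ') = shift (t.subst τ') := by
    intro t
    rw [shift_eq_subst, shift_eq_subst, subst_subst, subst_subst]
    congr 1
    funext a
    rcases a with x | i
    · simp [FirstOrder.Language.Term.subst, shift_eq_subst]
    · simp [FirstOrder.Language.Term.subst, shift_eq_subst]
  funext a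
  rcases a with x | i
  · simp [key]
  · induction i using Fin.lastCases with
    | last => simp [FirstOrder.Language.Term.subst]
    | cast i => simp [key]

theorem bind_var {n : ℕ} (φ : Fml L n) : φ.bind (fun a => .var a) = φ := by
  induction φ <;> simp_all [Fml.bind, subst_var, lift_var]

theorem bind_bind {l m n : ℕ} (φ : Fml L l) (τ : ℕ ⊕ Fin l → Tm L m) (τ' : ℕ ⊕ Fin m → Tm L n) :
    (φ.bind τ).bind τ' = φ.bind fun a => (τ a).subst τ' := by
  induction φ generalizing m n <;>
    simp_all [Fml.bind, subst_subst, lift_comp]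

theorem lift_congr {m n : ℕ} {s : Finset ℕ} {τ τ' : ℕ ⊕ Fin m → Tm L n}
    (h : ∀ x ∈ s, τ (.inl x) = τ' (.inl x)) (h' : ∀ i, τ (.inr i) = τ' (.inr i)) :
    (∀ x ∈ s, lift τ (.inl x) = lift τ' (.inl x)) ∧
      ∀ i, lift τ (.inr i) = lift τ' (.inr i) := by
  refine ⟨fun x hx => by simp [h x hx], fun i => ?_⟩
  induction i using Fin.lastCases with
  | last => simp
  | cast i => simp [h' i]

theorem bind_congr {m n : ℕ} {φ : Fml L m} {τ τ' : ℕ ⊕ Fin m → Tm L n}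
    (h : ∀ x ∈ φ.fv, τ (.inl x) = τ' (.inl x)) (h' : ∀ i, τ (.inr i) = τ' (.inr i)) :
    φ.bind τ = φ.bind τ' := by
  induction φ generalizing n with
  | eq s t =>
    simp only [Fml.fv, Finset.mem_union] at h
    simp only [Fml.bind]
    rw [subst_congr (fun x hx => h x (.inl hx)) h', subst_congr (fun x hx => h x (.inr hx)) h']
  | rel R ts =>
    simp only [Fml.bind]
    congr 1
    funext i
    refine subst_congr (fun x hx => h x ?_) h'
    simp only [Fml.fv, Finset.mem_biUnion, Finset.mem_univ, true_and]
    exact ⟨i, hx⟩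
  | neg φ ih => exact congrArg Fml.neg (ih h h')
  | and φ ψ ih₁ ih₂ | or φ ψ ih₁ ih₂ | imp φ ψ ih₁ ih₂ =>
    simp only [Fml.fv, Finset.mem_union] at h
    simp only [Fml.bind]
    rw [ih₁ (fun x hx => h x (.inl hx)) h', ih₂ (fun x hx => h x (.inr hx)) h']
  | all φ ih | ex φ ih =>
    obtain ⟨k, k'⟩ := lift_congr h h'
    simp only [Fml.bind]
    rw [ih k k']
  | rtc φ s t ih =>
    simp only [Fml.fv, Finset.mem_union] at h
    obtain ⟨k, k'⟩ := lift_congr (s := φ.fv) (fun x hx => h x (.inl (.inl hx))) h'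
    obtain ⟨k, k'⟩ := lift_congr k k'
    simp only [Fml.bind]
    rw [ih k k', subst_congr (fun x hx => h x (.inl (.inr hx))) h',
      subst_congr (fun x hx => h x (.inr hx)) h']

/-- The substitution `[t/x]`, as a substitution at an arbitrary depth. -/
def single {n : ℕ} (x : ℕ) (t : Tm L n) : ℕ ⊕ Fin n → Tm L n :=
  Sum.elim (Function.update fvar x t) fun i => .var (.inr i)

@[simp] theorem single_self {n : ℕ} (x : ℕ) (t : Tm L n) : single x t (.inl x) = t := by
  simp only [single, Sum.elim_inl, Function.update_self]

@[simp] theorem single_inr {n : ℕ} (x : ℕ) (t : Tm L n) (i : Fin n) :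
    single x t (.inr i) = .var (.inr i) := rfl

theorem single_of_ne {n : ℕ} {x y : ℕ} (t : Tm L n) (h : y ≠ x) :
    single x t (.inl y) = fvar y := by
  simp only [single, Sum.elim_inl, Function.update_of_ne h]

theorem lift_single {n : ℕ} (x : ℕ) (t : Tm L n) : lift (single x t) = single x (shift t) := by
  funext a
  rcases a with y | i
  · by_cases h : y = x
    · subst h; simp
    · rw [lift_inl, single_of_ne _ h, single_of_ne _ h]; rfl
  · induction i using Fin.lastCases with
    | last => simp
    | cast i => rw [lift_castSucc]; rfl

theorem subst₁_eq (φ : Formula₀ L) (x : ℕ) (t : Term₀ L) : φ.subst₁ x t = φ.bind (single x t) :=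
  congrArg φ.bind (funext fun a => by rcases a with y | i; exacts [rfl, i.elim0])

theorem bind_single_of_notMem {n : ℕ} {φ : Fml L n} {x : ℕ} (h : x ∉ φ.fv) (t : Tm L n) :
    φ.bind (single x t) = φ := by
  conv_rhs => rw [← bind_var φ]
  exact bind_congr (fun y hy => single_of_ne t (by rintro rfl; exact h hy)) fun _ => rfl

theorem subst_single_of_notMem {n : ℕ} {s : Tm L n} {x : ℕ} (h : x ∉ s.varFinsetLeft)
    (t : Tm L n) : s.subst (single x t) = s := by
  conv_rhs => rw [← subst_var s]
  exact subst_congr (fun y hy => single_of_ne t (by rintro rfl; exact h hy)) fun _ => rfl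

theorem eq_subst₁ {s : Term₀ L} {x : ℕ} (h : x ∉ s.varFinsetLeft) (u : Term₀ L) :
    (Fml.eq (fvar x) s).subst₁ x u = .eq u s := by
  simp [subst₁_eq, Fml.bind, subst_single_of_notMem h]

theorem rtc_subst₁ {φ : Fml L 2} {s : Term₀ L} {x : ℕ} (h : x ∉ φ.fv) (h' : x ∉ s.varFinsetLeft)
    (u : Term₀ L) : (Fml.rtc φ s (fvar x)).subst₁ x u = .rtc φ s u := by
  simp [subst₁_eq, Fml.bind, subst_single_of_notMem h', lift_single, bind_single_of_notMem h]

theorem update_subst_single {n k : ℕ} {ts : Fin k → Tm L n} {x : ℕ}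
    (h : ∀ i, x ∉ (ts i).varFinsetLeft) (i : Fin k) (u : Tm L n) :
    (fun j => (Function.update ts i (fvar x) j).subst (single x u)) = Function.update ts i u := by
  funext j
  by_cases hj : j = i
  · subst hj; simp
  · simp [hj, subst_single_of_notMem (h j)]

theorem rel_subst₁ {k : ℕ} {R : L.Relations k} {ts : Fin k → Term₀ L} {x : ℕ}
    (h : ∀ i, x ∉ (ts i).varFinsetLeft) (i : Fin k) (u : Term₀ L) :
    (Fml.rel R (Function.update ts i (fvar x))).subst₁ x u =
      .rel R (Function.update ts i u) := by
  simp only [subst₁_eq, Fml.bind]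
  rw [update_subst_single h]

/-- Replacing one argument inside a substituted term is itself a substitution. -/
theorem subst₁_func {φ : Formula₀ L} {x y k : ℕ} {f : L.Functions k} {ts : Fin k → Term₀ L}
    (hφ : y ∉ φ.fv) (h : ∀ i, y ∉ (ts i).varFinsetLeft) (i : Fin k) (u : Term₀ L) :
    (φ.subst₁ x (.func f (Function.update ts i (fvar y)))).subst₁ y u =
      φ.subst₁ x (.func f (Function.update ts i u)) := by
  simp only [subst₁_eq, bind_bind]
  refine bind_congr (fun z hz => ?_) fun i => i.elim0
  by_cases hzx : z = x
  · subst hzx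
    rw [single_self, single_self, ← update_subst_single h i u]
    rfl
  · rw [single_of_ne _ hzx, single_of_ne _ hzx]
    change single y u (.inl z) = _
    rw [single_of_ne]
    rintro rfl
    exact hφ hz

/-- The number of connectives, quantifiers and `RTC` operators. -/
def Fml.size : {n : ℕ} → Fml L n → ℕ
  | _, .eq _ _ => 0
  | _, .rel _ _ => 0
  | _, .neg φ => φ.size + 1
  | _, .and φ ψ => φ.size + ψ.size + 1
  | _, .or φ ψ => φ.size + ψ.size + 1
  | _, .imp φ ψ => φ.size + ψ.size + 1
  | _, .all φ => φ.size + 1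
  | _, .ex φ => φ.size + 1
  | _, .rtc φ _ _ => φ.size + 1

theorem size_bind {m n : ℕ} (φ : Fml L m) (τ : ℕ ⊕ Fin m → Tm L n) :
    (φ.bind τ).size = φ.size := by
  induction φ generalizing n <;> simp_all [Fml.bind, Fml.size]

/-! ### Substitution and satisfaction -/

section Semantics

variable {M : Type*} [L.Structure M]

theorem realize_shift {n : ℕ} (t : Tm L n) (ρ : ℕ → M) (xs : Fin n → M) (a : M) :
    (shift t).realize (Sum.elim ρ (Fin.snoc (α := fun _ => M) xs a)) =
      t.realize (Sum.elim ρ xs) := by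
  rw [shift, FirstOrder.Language.Term.realize_relabel]
  congr 1
  funext b
  rcases b with x | i <;> simp

theorem realize_lift {m n : ℕ} (τ : ℕ ⊕ Fin m → Tm L n) (ρ : ℕ → M) (xs : Fin n → M) (a : M) :
    (fun x => (lift τ (.inl x)).realize (Sum.elim ρ (Fin.snoc (α := fun _ => M) xs a))) =
        (fun x => (τ (.inl x)).realize (Sum.elim ρ xs)) ∧
    (fun i => (lift τ (.inr i)).realize (Sum.elim ρ (Fin.snoc (α := fun _ => M) xs a))) =
        Fin.snoc (α := fun _ => M) (fun i => (τ (.inr i)).realize (Sum.elim ρ xs)) a := by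
  refine ⟨funext fun x => by simp [realize_shift], funext fun i => ?_⟩
  induction i using Fin.lastCases with
  | last => simp
  | cast i => simp [realize_shift]

theorem realize_subst_elim {m n : ℕ} (t : Tm L m) (τ : ℕ ⊕ Fin m → Tm L n) (ρ : ℕ → M)
    (xs : Fin n → M) :
    (t.subst τ).realize (Sum.elim ρ xs) =
      t.realize (Sum.elim (fun x => (τ (.inl x)).realize (Sum.elim ρ xs))
        fun i => (τ (.inr i)).realize (Sum.elim ρ xs)) := by
  rw [FirstOrder.Language.Term.realize_subst]
  congr 1
  funext a
  rcases a with x | i <;> rfl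

theorem sat_bind {m n : ℕ} (φ : Fml L m) (τ : ℕ ⊕ Fin m → Tm L n) (ρ : ℕ → M) (xs : Fin n → M) :
    (φ.bind τ).Sat ρ xs ↔
      φ.Sat (fun x => (τ (.inl x)).realize (Sum.elim ρ xs))
        fun i => (τ (.inr i)).realize (Sum.elim ρ xs) := by
  induction φ generalizing n with
  | eq s t => simp only [Fml.bind, Fml.Sat, realize_subst_elim]
  | rel R ts => simp only [Fml.bind, Fml.Sat, realize_subst_elim]
  | neg φ ih => simp only [Fml.bind, Fml.Sat, ih]
  | and φ ψ ih₁ ih₂ | or φ ψ ih₁ ih₂ | imp φ ψ ih₁ ih₂ =>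
    simp only [Fml.bind, Fml.Sat, ih₁, ih₂]
  | all φ ih | ex φ ih =>
    simp only [Fml.bind, Fml.Sat, ih, (realize_lift τ ρ xs _).1, (realize_lift τ ρ xs _).2]
  | rtc φ s t ih =>
    simp only [Fml.bind, Fml.Sat, ih, realize_subst_elim, (realize_lift _ ρ _ _).1,
      (realize_lift _ ρ _ _).2]

end Semantics

/-! ### The term structure of a Hintikka pair -/

theorem Herbrand.mk_eq {G : Set (Formula₀ L)} {s t : Term₀ L} :
    Herbrand.mk G s = Herbrand.mk G t ↔ Congr G s t :=
  ⟨fun h => Quotient.exact (s := termSetoid G) h, fun h => Quotient.sound (s := termSetoid G) h⟩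

theorem Herbrand.exists_mk {G : Set (Formula₀ L)} (a : Herbrand G) :
    ∃ t, a = Herbrand.mk G t :=
  (Quotient.exists_rep (s := termSetoid G) a).imp fun _ h => h.symm

theorem realize_herbrand (G : Set (Formula₀ L)) (t : Term₀ L) (xs : Fin 0 → Herbrand G) :
    t.realize (Sum.elim (Herbrand.val G) xs) = Herbrand.mk G t := by
  induction t with
  | var a => rcases a with x | i; exacts [rfl, i.elim0]
  | func f ts ih =>
    rw [FirstOrder.Language.Term.realize_func]
    simp only [ih]
    exact Herbrand.funMap_mk G f ts

theorem holds_inst (G : Set (Formula₀ L)) (φ : Fml L 1) (t : Term₀ L) :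
    (φ.inst t).Holds (Herbrand.val G) ↔
      φ.Sat (Herbrand.val G)
        (Fin.snoc (α := fun _ => Herbrand G) Fin.elim0 (Herbrand.mk G t)) := by
  rw [Fml.Holds, Fml.inst, sat_bind]
  simp only [Sum.elim_inl, Sum.elim_inr, realize_herbrand]
  refine iff_of_eq (congrArg _ (funext fun i => ?_))
  obtain rfl : i = Fin.last 0 := Subsingleton.elim _ _
  rw [Fin.snoc_last]

theorem holds_inst₂ (G : Set (Formula₀ L)) (φ : Fml L 2) (r t : Term₀ L) :
    (φ.inst₂ r t).Holds (Herbrand.val G) ↔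
      φ.Sat (Herbrand.val G)
        (Fin.snoc (α := fun _ => Herbrand G)
          (Fin.snoc (α := fun _ => Herbrand G) Fin.elim0 (Herbrand.mk G r))
          (Herbrand.mk G t)) := by
  rw [Fml.Holds, Fml.inst₂, sat_bind]
  simp only [Sum.elim_inl, Sum.elim_inr, realize_herbrand]
  refine iff_of_eq (congrArg _ (funext fun i => ?_))
  induction i using Fin.lastCases with
  | last => rw [Fin.snoc_last]; rfl
  | cast i =>
    obtain rfl : i = Fin.last 0 := Subsingleton.elim _ _
    rw [Fin.snoc_castSucc, Fin.snoc_last]; rfl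

end RTC

namespace RTC
variable {L : FirstOrder.Language.{u, v}}

/-! ### Hintikka pairs and their countermodels -/

/-- `(RTC_{x,y} φ)(s, t)` is witnessed in `G`: there are variables `z₁, …, zₖ` such that `G`
contains `φ[z₁/x, t/y]`, `φ[z₂/x, z₁/y]`, … and `s = zₖ` (or `s = t`, when `k = 0`). -/
inductive RtcChain (G : Set (Formula₀ L)) (φ : Fml L 2) (s : Term₀ L) : Term₀ L → Prop
  | base {t : Term₀ L} : Fml.eq s t ∈ G → RtcChain G φ s t
  | step {t : Term₀ L} (z : ℕ) : φ.inst₂ (fvar z) t ∈ G → RtcChain G φ s (fvar z) →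
      RtcChain G φ s t

/-- Pairs of sets of formulas which are saturated under the rules of the search: every formula of
`G` is to be made true and every formula of `D` is to be made false. -/
structure Hintikka (G D : Set (Formula₀ L)) : Prop where
  disj : ∀ φ, φ ∈ G → φ ∉ D
  eqRefl : ∀ t, Fml.eq t t ∉ D
  rtcRefl : ∀ φ s, Fml.rtc φ s s ∉ D
  negL : ∀ φ, Fml.neg φ ∈ G → φ ∈ D
  negR : ∀ φ, Fml.neg φ ∈ D → φ ∈ G
  andL : ∀ φ ψ, Fml.and φ ψ ∈ G → φ ∈ G ∧ ψ ∈ G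
  andR : ∀ φ ψ, Fml.and φ ψ ∈ D → φ ∈ D ∨ ψ ∈ D
  orL : ∀ φ ψ, Fml.or φ ψ ∈ G → φ ∈ G ∨ ψ ∈ G
  orR : ∀ φ ψ, Fml.or φ ψ ∈ D → φ ∈ D ∧ ψ ∈ D
  impL : ∀ φ ψ, Fml.imp φ ψ ∈ G → φ ∈ D ∨ ψ ∈ G
  impR : ∀ φ ψ, Fml.imp φ ψ ∈ D → φ ∈ G ∧ ψ ∈ D
  allL : ∀ φ, Fml.all φ ∈ G → ∀ t, φ.inst t ∈ G
  allR : ∀ φ, Fml.all φ ∈ D → ∃ z, φ.inst (fvar z) ∈ D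
  exL : ∀ φ, Fml.ex φ ∈ G → ∃ z, φ.inst (fvar z) ∈ G
  exR : ∀ φ, Fml.ex φ ∈ D → ∀ t, φ.inst t ∈ D
  rtcL : ∀ φ s t, Fml.rtc φ s t ∈ G → RtcChain G φ s t
  rtcR : ∀ φ s t, Fml.rtc φ s t ∈ D → ∀ r, Fml.rtc φ s r ∈ D ∨ φ.inst₂ r t ∈ D
  eq₁ : ∀ s t, Fml.eq s t ∈ G → ∀ (φ : Formula₀ L) (x : ℕ), φ.subst₁ x s ∈ D → φ.subst₁ x t ∈ D
  eq₂ : ∀ s t, Fml.eq s t ∈ G → ∀ (φ : Formula₀ L) (x : ℕ), φ.subst₁ x t ∈ D → φ.subst₁ x s ∈ D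

namespace Hintikka

variable {G D : Set (Formula₀ L)}

/-- If the arguments of a tuple may be replaced one at a time, then all may be replaced. -/
theorem replace_all {A : Type*} {k : ℕ} {ts us : Fin k → A} {P : (Fin k → A) → Prop}
    (h : ∀ vs i, vs i = ts i → P vs → P (Function.update vs i (us i))) (h₀ : P ts) : P us := by
  have key : ∀ s : Finset (Fin k), P fun i => if i ∈ s then us i else ts i := by
    intro s
    induction s using Finset.induction_on with
    | empty => simpa using h₀
    | insert a s ha ih =>
      have := h _ a (if_neg ha) ih
      convert this using 1
      funext j
      by_cases hj : j = a
      · subst hj; simp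
      · simp [hj]
  simpa using key Finset.univ

/-- Congruent terms may be replaced by each other inside the formulas of `D`.  The equality rules
give this for the equations in `G`; the general case follows since the relation of
interchangeability is a congruence. -/
theorem subst_congr (H : Hintikka G D) {s t : Term₀ L} (h : Congr G s t) :
    ∀ (φ : Formula₀ L) (x : ℕ), φ.subst₁ x s ∈ D ↔ φ.subst₁ x t ∈ D := by
  induction h with
  | base h => exact fun φ x => ⟨H.eq₁ _ _ h φ x, H.eq₂ _ _ h φ x⟩
  | refl t => exact fun _ _ => Iff.rfl
  | symm _ ih => exact fun φ x => (ih φ x).symm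
  | trans _ _ ih₁ ih₂ => exact fun φ x => (ih₁ φ x).trans (ih₂ φ x)
  | @func k f ts us _ ih =>
    have step : ∀ (φ : Formula₀ L) (x : ℕ) (vs : Fin k → Term₀ L) (i : Fin k) (s t : Term₀ L),
        (∀ (φ : Formula₀ L) (x : ℕ), φ.subst₁ x s ∈ D ↔ φ.subst₁ x t ∈ D) → vs i = s →
        φ.subst₁ x (.func f vs) ∈ D → φ.subst₁ x (.func f (Function.update vs i t)) ∈ D := by
      intro φ x vs i s t hst hs hD
      obtain ⟨y, hy⟩ := Infinite.exists_notMem_finset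
        (φ.fv ∪ Finset.univ.biUnion fun j => (vs j).varFinsetLeft)
      simp only [Finset.mem_union, Finset.mem_biUnion, Finset.mem_univ, true_and, not_or,
        not_exists] at hy
      rw [← subst₁_func hy.1 hy.2 i, ← hst, subst₁_func hy.1 hy.2 i, ← hs]
      rwa [Function.update_eq_self]
    intro φ x
    exact ⟨replace_all (P := fun vs => φ.subst₁ x (.func f vs) ∈ D)
        fun vs i hi => step φ x vs i _ _ (ih i) hi,
      replace_all (P := fun vs => φ.subst₁ x (.func f vs) ∈ D)
        fun vs i hi => step φ x vs i _ _ (fun φ x => (ih i φ x).symm) hi⟩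

theorem not_congr (H : Hintikka G D) {s t : Term₀ L} (h : Fml.eq s t ∈ D) : ¬ Congr G s t := by
  intro hc
  obtain ⟨x, hx⟩ := Infinite.exists_notMem_finset t.varFinsetLeft
  rw [← eq_subst₁ hx, H.subst_congr hc, eq_subst₁ hx] at h
  exact H.eqRefl _ h

theorem rtc_not_congr (H : Hintikka G D) {φ : Fml L 2} {s t : Term₀ L}
    (h : Fml.rtc φ s t ∈ D) : ¬ Congr G s t := by
  intro hc
  obtain ⟨x, hx⟩ := Infinite.exists_notMem_finset (φ.fv ∪ s.varFinsetLeft)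
  simp only [Finset.mem_union, not_or] at hx
  rw [← rtc_subst₁ hx.1 hx.2, ← H.subst_congr hc, rtc_subst₁ hx.1 hx.2] at h
  exact H.rtcRefl _ _ h

theorem rel_congr (H : Hintikka G D) {k : ℕ} {R : L.Relations k} {ts us : Fin k → Term₀ L}
    (hc : ∀ i, Congr G (ts i) (us i)) (h : Fml.rel R ts ∈ D) : Fml.rel R us ∈ D := by
  refine replace_all (P := fun vs => Fml.rel R vs ∈ D) (fun vs i hi hD => ?_) h
  obtain ⟨y, hy⟩ := Infinite.exists_notMem_finset
    (Finset.univ.biUnion fun j => (vs j).varFinsetLeft)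
  simp only [Finset.mem_biUnion, Finset.mem_univ, true_and, not_exists] at hy
  rw [← rel_subst₁ hy i, ← H.subst_congr (hc i), rel_subst₁ hy i, ← hi]
  rwa [Function.update_eq_self]

/-- Truth lemma for an `RTC` formula on the left: its chain of witnesses is a path in the term
structure. -/
theorem rtc_holds {φ : Fml L 2}
    (ih : ∀ r t, φ.inst₂ r t ∈ G → (φ.inst₂ r t).Holds (Herbrand.val G)) {s t : Term₀ L}
    (h : RtcChain G φ s t) : (Fml.rtc φ s t).Holds (Herbrand.val G) := by
  simp only [Fml.Holds, Fml.Sat, realize_herbrand]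
  induction h with
  | base h => exact .inl (Herbrand.mk_eq.2 (.base h))
  | @step t z hz _ ihc =>
    have hφ := (holds_inst₂ G φ _ _).1 (ih _ _ hz)
    right
    rcases ihc with hs | ⟨k, a, -, h0, hk, ha⟩
    · refine ⟨1, fun i => if i = 0 then Herbrand.mk G s else Herbrand.mk G t, one_pos, by simp,
        by simp, fun i hi => ?_⟩
      obtain rfl : i = 0 := by omega
      simpa [hs] using hφ
    · refine ⟨k + 1, fun i => if i ≤ k then a i else Herbrand.mk G t, Nat.succ_pos k, by simpa,
        by simp, fun i hi => ?_⟩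
      rcases (Nat.lt_succ_iff.1 hi).lt_or_eq with hlt | rfl
      · simpa [hlt.le, Nat.succ_le_of_lt hlt] using ha i hlt
      · simpa [← hk] using hφ

/-- Truth lemma for an `RTC` formula on the right: a path in the term structure would lead back to
an instance of the reflexivity axiom. -/
theorem rtc_not_holds (H : Hintikka G D) {φ : Fml L 2}
    (ih : ∀ r t, φ.inst₂ r t ∈ D → ¬ (φ.inst₂ r t).Holds (Herbrand.val G)) {s t : Term₀ L}
    (h : Fml.rtc φ s t ∈ D) : ¬ (Fml.rtc φ s t).Holds (Herbrand.val G) := by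
  simp only [Fml.Holds, Fml.Sat, realize_herbrand]
  rintro (hs | ⟨k, a, -, h0, hk, ha⟩)
  · exact H.rtc_not_congr h (Herbrand.mk_eq.1 hs)
  · induction k generalizing t with
    | zero => exact H.rtc_not_congr h (Herbrand.mk_eq.1 (h0.trans hk.symm))
    | succ k ihk =>
      obtain ⟨r, hr⟩ := Herbrand.exists_mk (a k)
      rcases H.rtcR φ s t h r with h' | h'
      · exact ihk h' hr.symm fun i hi => ha i (Nat.lt_succ_of_lt hi)
      · refine ih _ _ h' ((holds_inst₂ G φ _ _).2 ?_)
        rw [← hr, hk]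
        exact ha k (Nat.lt_succ_self k)

/-- Truth lemma: in the term structure every formula of `G` is true and every formula of `D` is
false.  The induction is on the size, since instances of `φ` are not subformulas of `∀ x φ`. -/
theorem truth (H : Hintikka G D) (n : ℕ) (φ : Formula₀ L) (hn : φ.size = n) :
    (φ ∈ G → φ.Holds (Herbrand.val G)) ∧ (φ ∈ D → ¬ φ.Holds (Herbrand.val G)) := by
  induction n using Nat.strong_induction_on generalizing φ with
  | _ n IH =>
  have ih : ∀ ψ : Formula₀ L, ψ.size < φ.size →
      (ψ ∈ G → ψ.Holds (Herbrand.val G)) ∧ (ψ ∈ D → ¬ ψ.Holds (Herbrand.val G)) :=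
    fun ψ hψ => IH _ (hn ▸ hψ) ψ rfl
  clear IH hn
  cases φ with
  | eq s t =>
    simp only [Fml.Holds, Fml.Sat, realize_herbrand, Herbrand.mk_eq]
    exact ⟨.base, H.not_congr⟩
  | rel R ts =>
    simp only [Fml.Holds, Fml.Sat, realize_herbrand]
    refine ⟨fun h => ⟨ts, fun _ => rfl, h⟩, ?_⟩
    rintro h ⟨us, hus, hG⟩
    exact H.disj _ hG (H.rel_congr (fun i => Herbrand.mk_eq.1 (hus i)) h)
  | neg φ =>
    have := ih φ (by simp [Fml.size])
    exact ⟨fun h => this.2 (H.negL _ h), fun h h' => h' (this.1 (H.negR _ h))⟩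
  | and φ ψ =>
    have h₁ := ih φ (by simp only [Fml.size]; omega)
    have h₂ := ih ψ (by simp only [Fml.size]; omega)
    refine ⟨fun h => ⟨h₁.1 (H.andL _ _ h).1, h₂.1 (H.andL _ _ h).2⟩, fun h h' => ?_⟩
    exact (H.andR _ _ h).elim (fun k => h₁.2 k h'.1) fun k => h₂.2 k h'.2
  | or φ ψ =>
    have h₁ := ih φ (by simp only [Fml.size]; omega)
    have h₂ := ih ψ (by simp only [Fml.size]; omega)
    exact ⟨fun h => (H.orL _ _ h).imp h₁.1 h₂.1,
      fun h h' => h'.elim (h₁.2 (H.orR _ _ h).1) (h₂.2 (H.orR _ _ h).2)⟩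
  | imp φ ψ =>
    have h₁ := ih φ (by simp only [Fml.size]; omega)
    have h₂ := ih ψ (by simp only [Fml.size]; omega)
    exact ⟨fun h h' => (H.impL _ _ h).elim (fun k => absurd h' (h₁.2 k)) h₂.1,
      fun h h' => h₂.2 (H.impR _ _ h).2 (h' (h₁.1 (H.impR _ _ h).1))⟩
  | all φ =>
    have hi : ∀ t, (φ.inst t).size < (Fml.all φ).size := fun t => by
      simp [Fml.inst, size_bind, Fml.size]
    refine ⟨fun h a => ?_, fun h h' => ?_⟩
    · obtain ⟨t, rfl⟩ := Herbrand.exists_mk a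
      exact (holds_inst G φ t).1 ((ih _ (hi t)).1 (H.allL _ h t))
    · obtain ⟨z, hz⟩ := H.allR _ h
      exact (ih _ (hi _)).2 hz ((holds_inst G φ _).2 (h' _))
  | ex φ =>
    have hi : ∀ t, (φ.inst t).size < (Fml.ex φ).size := fun t => by
      simp [Fml.inst, size_bind, Fml.size]
    refine ⟨fun h => ?_, ?_⟩
    · obtain ⟨z, hz⟩ := H.exL _ h
      exact ⟨_, (holds_inst G φ _).1 ((ih _ (hi _)).1 hz)⟩
    · rintro h ⟨a, ha⟩
      obtain ⟨t, rfl⟩ := Herbrand.exists_mk a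
      exact (ih _ (hi t)).2 (H.exR _ h t) ((holds_inst G φ t).2 ha)
  | rtc φ s t =>
    have hi : ∀ r t', (φ.inst₂ r t').size < (Fml.rtc φ s t).size := fun r t' => by
      simp [Fml.inst₂, size_bind, Fml.size]
    exact ⟨fun h => rtc_holds (fun r t' => (ih _ (hi r t')).1) (H.rtcL _ _ _ h),
      fun h => H.rtc_not_holds (fun r t' => (ih _ (hi r t')).2) h⟩

end Hintikka

end RTC

namespace RTC
variable {L : FirstOrder.Language.{u, v}}

/-! ### Finite derivation trees -/

theorem FinTree.label_grow_inf {f : Sequent L → FinTree L} {t : FinTree L} {p : List ℕ}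
    {I : Inference L} (h : t.label p = some (.inf I)) :
    (t.grow f).label p = some (.inf I) := by
  induction t generalizing p with
  | opn S' => rcases p with _ | ⟨j, p⟩ <;> simp [label] at h
  | nul J => exact h
  | one J t ih =>
    rcases p with _ | ⟨_ | j, p⟩
    · exact h
    · exact ih h
    · simp [label] at h
  | two J t₀ t₁ ih₀ ih₁ =>
    rcases p with _ | ⟨_ | _ | j, p⟩
    · exact h
    · exact ih₀ h
    · exact ih₁ h
    · simp [label] at h

theorem FinTree.label_grow_opn {f : Sequent L → FinTree L} {t : FinTree L} {p : List ℕ}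
    {S : Sequent L} (h : t.label p = some (.opn S)) (q : List ℕ) :
    (t.grow f).label (p ++ q) = (f S).label q := by
  induction t generalizing p with
  | opn S' =>
    rcases p with _ | ⟨j, p⟩ <;> simp [label] at h
    subst h; rfl
  | nul J => rcases p with _ | ⟨j, p⟩ <;> simp [label] at h
  | one J t ih =>
    rcases p with _ | ⟨_ | j, p⟩
    · simp [label] at h
    · exact ih h
    · simp [label] at h
  | two J t₀ t₁ ih₀ ih₁ =>
    rcases p with _ | ⟨_ | _ | j, p⟩
    · simp [label] at h
    · exact ih₀ h
    · exact ih₁ h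
    · simp [label] at h

theorem FinTree.mem_openNodes {t : FinTree L} {p : List ℕ} {S : Sequent L}
    (h : t.label p = some (.opn S)) : S ∈ t.openNodes := by
  induction t generalizing p with
  | opn S' =>
    rcases p with _ | ⟨j, p⟩ <;> simp [label] at h
    simp [openNodes, h]
  | nul J => rcases p with _ | ⟨j, p⟩ <;> simp [label] at h
  | one J t ih =>
    rcases p with _ | ⟨_ | j, p⟩ <;> simp [label] at h
    exact ih h
  | two J t₀ t₁ ih₀ ih₁ =>
    rcases p with _ | ⟨_ | _ | j, p⟩ <;> simp [label] at h
    · exact List.mem_append_left _ (ih₀ h)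
    · exact List.mem_append_right _ (ih₁ h)

/-- Open nodes are leaves. -/
theorem FinTree.eq_nil_of_opn {t : FinTree L} {p q : List ℕ} {S : Sequent L}
    (h : t.label p = some (.opn S)) (hq : t.label (p ++ q) ≠ none) : q = [] := by
  induction t generalizing p with
  | opn S' =>
    rcases p with _ | ⟨j, p⟩ <;> simp [label] at h
    rcases q with _ | ⟨j, q⟩ <;> simp [label] at hq ⊢
  | nul J => rcases p with _ | ⟨j, p⟩ <;> simp [label] at h
  | one J t ih =>
    rcases p with _ | ⟨_ | j, p⟩ <;> simp [label] at h
    exact ih h hq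
  | two J t₀ t₁ ih₀ ih₁ =>
    rcases p with _ | ⟨_ | _ | j, p⟩ <;> simp [label] at h
    · exact ih₀ h hq
    · exact ih₁ h hq

theorem FinTree.exists_depth (t : FinTree L) : ∃ d, ∀ p : List ℕ, d < p.length →
    t.label p = none := by
  induction t with
  | opn S' => exact ⟨0, fun p hp => by rcases p with _ | ⟨j, p⟩ <;> simp [label] at hp ⊢⟩
  | nul J => exact ⟨0, fun p hp => by rcases p with _ | ⟨j, p⟩ <;> simp [label] at hp ⊢⟩
  | one J t ih =>
    obtain ⟨d, hd⟩ := ih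
    refine ⟨d + 1, fun p hp => ?_⟩
    rcases p with _ | ⟨_ | j, p⟩ <;> simp [label] at hp ⊢
    exact hd p hp
  | two J t₀ t₁ ih₀ ih₁ =>
    obtain ⟨d₀, h₀⟩ := ih₀
    obtain ⟨d₁, h₁⟩ := ih₁
    refine ⟨d₀ + d₁ + 1, fun p hp => ?_⟩
    rcases p with _ | ⟨_ | _ | j, p⟩ <;> simp [label] at hp ⊢
    · exact h₀ p (by omega)
    · exact h₁ p (by omega)

theorem FinTree.grow_of_openNodes_eq_nil {f : Sequent L → FinTree L} {t : FinTree L}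
    (h : t.openNodes = []) : t.grow f = t := by
  induction t with
  | opn S' => simp [openNodes] at h
  | nul J => rfl
  | one J t ih => simp only [grow]; rw [ih h]
  | two J t₀ t₁ ih₀ ih₁ =>
    simp only [openNodes, List.append_eq_nil_iff] at h
    simp only [grow]
    rw [ih₀ h.1, ih₁ h.2]

theorem fresh_notMem (S : Sequent L) : S.fresh ∉ setFv S.left ∪ setFv S.right := by
  intro h
  have := Finset.le_sup (f := id) h
  simp only [Sequent.fresh, id] at this
  omega

theorem fv_subset_setFv {Γ : Finset (Formula₀ L)} {φ : Formula₀ L} (h : φ ∈ Γ) :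
    φ.fv ⊆ setFv Γ :=
  Finset.subset_biUnion_of_mem Fml.fv h

section Trees

variable [∀ n, Encodable (L.Functions n)] [∀ n, Encodable (L.Relations n)]

/-- The finite tree is a cut-free derivation, possibly with open nodes, of the sequent. -/
def FinTree.Ok : FinTree L → Sequent L → Prop
  | .opn S', S => S' = S
  | .nul I, S => I.conclusion = S ∧ I.SideCondition ∧ ¬ I.IsCut ∧ I.premises = []
  | .one I t, S => I.conclusion = S ∧ I.SideCondition ∧ ¬ I.IsCut ∧
      ∃ S₀, I.premises = [S₀] ∧ t.Ok S₀
  | .two I t₀ t₁, S => I.conclusion = S ∧ I.SideCondition ∧ ¬ I.IsCut ∧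
      ∃ S₀ S₁, I.premises = [S₀, S₁] ∧ t₀.Ok S₀ ∧ t₁.Ok S₁

theorem FinTree.Ok.grow {f : Sequent L → FinTree L} (hf : ∀ S, (f S).Ok S) {t : FinTree L}
    {S : Sequent L} (h : t.Ok S) : (t.grow f).Ok S := by
  induction t generalizing S with
  | opn S' => obtain rfl : S' = S := h; exact hf S'
  | nul I => exact h
  | one I t ih =>
    obtain ⟨h₁, h₂, h₃, S₀, h₄, h₅⟩ := h
    exact ⟨h₁, h₂, h₃, S₀, h₄, ih h₅⟩
  | two I t₀ t₁ ih₀ ih₁ =>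
    obtain ⟨h₁, h₂, h₃, S₀, S₁, h₄, h₅, h₆⟩ := h
    exact ⟨h₁, h₂, h₃, S₀, S₁, h₄, ih₀ h₅, ih₁ h₆⟩

theorem FinTree.Ok.root {t : FinTree L} {S : Sequent L} (h : t.Ok S) :
    ∃ l, t.label [] = some l ∧ l.sequent = S := by
  cases t with
  | opn S' => exact ⟨_, rfl, h⟩
  | nul I => exact ⟨_, rfl, h.1⟩
  | one I t => exact ⟨_, rfl, h.1⟩
  | two I t₀ t₁ => exact ⟨_, rfl, h.1⟩

theorem FinTree.Ok.isDerivation {t : FinTree L} {S : Sequent L} (h : t.Ok S) :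
    IsDerivation t.label S := by
  refine ⟨?_, fun p k => ?_, fun p I hI => ?_⟩
  · obtain ⟨l, hl, hS⟩ := h.root
    simp [hl, hS]
  · induction t generalizing S p with
    | opn S' => rcases p with _ | ⟨j, p⟩ <;> simp [label, Label.premises]
    | nul I => rcases p with _ | ⟨j, p⟩ <;> simp [label, Label.premises, h.2.2.2]
    | one I t ih =>
      obtain ⟨-, -, -, S₀, hS₀, ht⟩ := h
      rcases p with _ | ⟨_ | j, p⟩
      · rcases k with _ | k
        · obtain ⟨l, hl, hS⟩ := ht.root
          simp [label, Label.premises, hS₀, hl, hS]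
        · simp [label, Label.premises, hS₀]
      · exact ih ht p
      · simp [label]
    | two I t₀ t₁ ih₀ ih₁ =>
      obtain ⟨-, -, -, S₀, S₁, hS₀, ht₀, ht₁⟩ := h
      rcases p with _ | ⟨_ | _ | j, p⟩
      · rcases k with _ | _ | k
        · obtain ⟨l, hl, hS⟩ := ht₀.root
          simp [label, Label.premises, hS₀, hl, hS]
        · obtain ⟨l, hl, hS⟩ := ht₁.root
          simp [label, Label.premises, hS₀, hl, hS]
        · simp [label, Label.premises, hS₀]
      · exact ih₀ ht₀ p
      · exact ih₁ ht₁ p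
      · simp [label]
  · induction t generalizing S p with
    | opn S' => rcases p with _ | ⟨j, p⟩ <;> simp [label] at hI
    | nul J =>
      rcases p with _ | ⟨j, p⟩ <;> simp [label] at hI
      exact hI ▸ h.2.1
    | one J t ih =>
      rcases p with _ | ⟨_ | j, p⟩ <;> simp [label] at hI
      · exact hI ▸ h.2.1
      · obtain ⟨-, -, -, S₀, -, ht⟩ := h
        exact ih ht p hI
    | two J t₀ t₁ ih₀ ih₁ =>
      obtain ⟨-, hJ, -, S₀, S₁, -, ht₀, ht₁⟩ := h
      rcases p with _ | ⟨_ | _ | j, p⟩ <;> simp [label] at hI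
      · exact hI ▸ hJ
      · exact ih₀ ht₀ p hI
      · exact ih₁ ht₁ p hI

theorem FinTree.Ok.cutFree {t : FinTree L} {S : Sequent L} (h : t.Ok S) : CutFree t.label := by
  intro p I hI
  induction t generalizing S p with
  | opn S' => rcases p with _ | ⟨j, p⟩ <;> simp [label] at hI
  | nul J =>
    rcases p with _ | ⟨j, p⟩ <;> simp [label] at hI
    exact hI ▸ h.2.2.1
  | one J t ih =>
    rcases p with _ | ⟨_ | j, p⟩ <;> simp [label] at hI
    · exact hI ▸ h.2.2.1
    · obtain ⟨-, -, -, S₀, -, ht⟩ := h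
      exact ih ht p hI
  | two J t₀ t₁ ih₀ ih₁ =>
    obtain ⟨-, -, hJ, S₀, S₁, -, ht₀, ht₁⟩ := h
    rcases p with _ | ⟨_ | _ | j, p⟩ <;> simp [label] at hI
    · exact hI ▸ hJ
    · exact ih₀ ht₀ p hI
    · exact ih₁ ht₁ p hI

/-! ### Axioms and single rules of the search -/

theorem weaken_ok {Γ Δ : Finset (Formula₀ L)} {t : FinTree L} (h : t.Ok ⟨Γ, Δ⟩)
    (gs ds : List (Formula₀ L)) :
    (weaken Γ Δ t gs ds).Ok ⟨Γ ∪ gs.toFinset, Δ ∪ ds.toFinset⟩ := by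
  induction gs with
  | nil =>
    induction ds with
    | nil => simpa [weaken] using h
    | cons ψ ds ih =>
      rw [weaken]
      refine ⟨?_, trivial, id, ⟨Γ, Δ ∪ ds.toFinset⟩, rfl, ?_⟩
      · simp [Inference.conclusion]
      · simpa using ih
  | cons φ gs ih =>
    rw [weaken]
    refine ⟨?_, trivial, id, ⟨Γ ∪ gs.toFinset, Δ ∪ ds.toFinset⟩, rfl, ih⟩
    simp [Inference.conclusion]

theorem weaken_openNodes {Γ Δ : Finset (Formula₀ L)} {t : FinTree L} (h : t.openNodes = [])
    (gs ds : List (Formula₀ L)) : (weaken Γ Δ t gs ds).openNodes = [] := by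
  induction gs with
  | nil =>
    induction ds with
    | nil => simpa [weaken] using h
    | cons ψ ds ih => rw [weaken]; exact ih
  | cons φ gs ih => rw [weaken]; exact ih

theorem eqReflArg_eq_some {φ : Formula₀ L} {t : Term₀ L} :
    eqReflArg φ = some t ↔ φ = .eq t t := by
  cases φ <;> simp [eqReflArg]
  grind

theorem rtcReflArg_eq_some {ψ : Formula₀ L} {φ : Fml L 2} {s : Term₀ L} :
    rtcReflArg ψ = some (φ, s) ↔ ψ = .rtc φ s s := by
  cases ψ <;> simp [rtcReflArg]
  grind

theorem close_spec {S : Sequent L} {t : FinTree L} (h : close S = some t) :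
    t.Ok S ∧ t.openNodes = [] := by
  have key : ∀ (A B : Finset (Formula₀ L)) (t : FinTree L), t.Ok ⟨A, B⟩ → t.openNodes = [] →
      A ⊆ S.left → B ⊆ S.right →
      (weaken A B t (S.left \ A).sort (S.right \ B).sort).Ok S ∧
        (weaken A B t (S.left \ A).sort (S.right \ B).sort).openNodes = [] := by
    intro A B t ht ho hA hB
    refine ⟨?_, weaken_openNodes ho _ _⟩
    have := weaken_ok ht (S.left \ A).sort (S.right \ B).sort
    rwa [Finset.sort_toFinset, Finset.sort_toFinset, Finset.union_sdiff_of_subset hA,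
      Finset.union_sdiff_of_subset hB] at this
  unfold close at h
  split at h
  · rename_i φ hφ
    have hm : φ ∈ S.left ∩ S.right := by
      rw [← Finset.mem_sort (· ≤ ·)]
      exact List.mem_of_mem_head? hφ
    rw [Finset.mem_inter] at hm
    obtain rfl := Option.some.inj h
    rw [Finset.erase_eq, Finset.erase_eq]
    exact key {φ} {φ} _ ⟨rfl, trivial, id, rfl⟩ rfl (by simpa using hm.1) (by simpa using hm.2)
  · split at h
    · rename_i t ht
      obtain ⟨ψ, hψ, hψt⟩ := List.exists_of_findSome?_eq_some ht
      rw [Finset.mem_sort, eqReflArg_eq_some.1 hψt] at hψ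
      obtain rfl := Option.some.inj h
      have := key ∅ {.eq t t} (.nul (.eqR t)) ⟨rfl, trivial, id, rfl⟩ rfl (by simp) (by simpa)
      rwa [Finset.sdiff_empty, ← Finset.erase_eq] at this
    · split at h
      · rename_i φ s hs
        obtain ⟨ψ, hψ, hψt⟩ := List.exists_of_findSome?_eq_some hs
        rw [Finset.mem_sort, rtcReflArg_eq_some.1 hψt] at hψ
        obtain rfl := Option.some.inj h
        refine ⟨⟨?_, trivial, id, rfl⟩, rfl⟩
        simp [Inference.conclusion, Finset.insert_eq_of_mem hψ]
      · simp at h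

/-- A sequent that is not closed is not an instance of an axiom. -/
theorem close_eq_none {S : Sequent L} (h : close S = none) :
    (∀ φ ∈ S.left, φ ∉ S.right) ∧ (∀ t, Fml.eq t t ∉ S.right) ∧
      ∀ φ s, Fml.rtc φ s s ∉ S.right := by
  unfold close at h
  split at h
  · simp at h
  · rename_i hi
    split at h
    · simp at h
    · rename_i he
      split at h
      · simp at h
      · rename_i hr
        refine ⟨fun φ hl hr => ?_, fun t ht => ?_, fun φ s hs => ?_⟩
        · rw [List.head?_eq_none_iff] at hi
          have : φ ∈ (S.left ∩ S.right).sort := by simp [hl, hr]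
          simp [hi] at this
        · have := List.findSome?_eq_none_iff.1 he (.eq t t) (by simpa)
          simp [eqReflArg] at this
        · have := List.findSome?_eq_none_iff.1 hr (.rtc φ s s) (by simpa)
          simp [rtcReflArg] at this

/-- What the rule instances of the search have in common: they are cut-free applications of rules
with premises, which keep all formulas of the conclusion. -/
structure IsSearchStep (S : Sequent L) (I : Inference L) : Prop where
  conclusion : I.conclusion = S
  side : I.SideCondition
  not_cut : ¬ I.IsCut
  not_subst : ∀ Γ Δ θ, I ≠ .subst Γ Δ θ
  premises : (∃ S₀, I.premises = [S₀]) ∨ ∃ S₀ S₁, I.premises = [S₀, S₁]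
  mono : ∀ S' ∈ I.premises, S.left ⊆ S'.left ∧ S.right ⊆ S'.right

theorem leftRule_isSearchStep {S : Sequent L} {e : Elem L} {I : Inference L}
    (h : leftRule S e = some I) : IsSearchStep S I := by
  have hz := fresh_notMem S
  rw [Finset.mem_union, not_or] at hz
  rcases e with φ | ⟨φ, ψ⟩ | ⟨φ, ψ⟩ | ⟨φ, ψ⟩ | ⟨φ, t⟩ | ⟨φ, t⟩ | ⟨φ, s, t, r, z, Γ, Δ, hf⟩ |
    ⟨s, t, x, φ, _ | _, Γ, Δ⟩ <;> simp only [leftRule, Option.ite_none_right_eq_some,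
      Option.some.injEq] at h <;> obtain ⟨hm, rfl⟩ := h
  case rtc =>
    obtain ⟨hm, hl, hr⟩ := hm
    constructor
    · simp [Inference.conclusion, Finset.insert_eq_of_mem hm]
    · simp only [Inference.SideCondition, Finset.mem_union, setFv, Finset.mem_biUnion, not_or,
        not_exists, not_and]
      refine ⟨⟨fun ψ hψ => ?_, fun ψ hψ => ?_⟩, hf.2.2⟩
      · rcases Finset.mem_insert.1 (hl hψ) with rfl | h'
        · exact hf.2.2
        · exact hf.1 ψ (by simpa using h')
      · exact hf.2.1 ψ (by simpa using hr hψ)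
    · exact id
    · simp
    · simp [Inference.premises]
    · simp only [Inference.premises]
      grind
  case ex =>
    constructor
    · simp [Inference.conclusion, Finset.insert_eq_of_mem hm]
    · simp only [Inference.SideCondition, Finset.mem_union, not_or]
      exact ⟨hz, fun h => hz.1 (fv_subset_setFv hm h)⟩
    · exact id
    · simp
    · simp [Inference.premises]
    · simp only [Inference.premises]
      grind
  all_goals
    constructor
    · simp [Inference.conclusion, hm]
    · trivial
    · exact id
    · simp
    · simp [Inference.premises]
    · simp only [Inference.premises]
      grind

theorem rightRule_isSearchStep {S : Sequent L} {e : Elem L} {I : Inference L}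
    (h : rightRule S e = some I) : IsSearchStep S I := by
  have hz := fresh_notMem S
  rw [Finset.mem_union, not_or] at hz
  rcases e with φ | ⟨φ, ψ⟩ | ⟨φ, ψ⟩ | ⟨φ, ψ⟩ | ⟨φ, t⟩ | ⟨φ, t⟩ | ⟨φ, s, t, r, z, Γ, Δ, hf⟩ |
    ⟨s, t, x, φ, n, Γ, Δ⟩ <;> simp only [rightRule, Option.ite_none_right_eq_some,
      Option.some.injEq, reduceCtorEq] at h <;> obtain ⟨hm, rfl⟩ := h
  case all =>
    constructor
    · simp [Inference.conclusion, Finset.insert_eq_of_mem hm]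
    · simp only [Inference.SideCondition, Finset.mem_union, not_or]
      exact ⟨hz, fun h => hz.2 (fv_subset_setFv hm h)⟩
    · exact id
    · simp
    · simp [Inference.premises]
    · simp only [Inference.premises]
      grind
  all_goals
    constructor
    · simp [Inference.conclusion, hm]
    · trivial
    · exact id
    · simp
    · simp [Inference.premises]
    · simp only [Inference.premises]
      grind

theorem rule_eq {S : Sequent L} {I : Inference L} (h : IsSearchStep S I) :
    (∃ S₀, I.premises = [S₀] ∧ FinTree.rule I = .one I (.opn S₀)) ∨
      ∃ S₀ S₁, I.premises = [S₀, S₁] ∧ FinTree.rule I = .two I (.opn S₀) (.opn S₁) := by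
  rcases h.premises with ⟨S₀, h⟩ | ⟨S₀, S₁, h⟩
  · exact .inl ⟨S₀, h, by rw [FinTree.rule, h]⟩
  · exact .inr ⟨S₀, S₁, h, by rw [FinTree.rule, h]⟩

theorem applyRule_ok {S : Sequent L} {o : Option (Inference L)}
    (h : ∀ I, o = some I → IsSearchStep S I) : (applyRule S o).Ok S := by
  rcases o with _ | I
  · rfl
  · have hI := h I rfl
    rcases rule_eq hI with ⟨S₀, h₀, hr⟩ | ⟨S₀, S₁, h₀, hr⟩ <;> rw [applyRule, hr]
    · exact ⟨hI.conclusion, hI.side, hI.not_cut, S₀, h₀, rfl⟩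
    · exact ⟨hI.conclusion, hI.side, hI.not_cut, S₀, S₁, h₀, rfl, rfl⟩

theorem develop_ok (e : Elem L) (S : Sequent L) : (develop e S).Ok S := by
  unfold develop
  split
  · rename_i t ht
    exact (close_spec ht).1
  · exact (applyRule_ok fun I => leftRule_isSearchStep).grow fun S' =>
      applyRule_ok fun I => rightRule_isSearchStep

theorem stage_ok (E : ℕ → Elem L) (S : Sequent L) (i : ℕ) : (stage E S i).Ok S := by
  induction i with
  | zero => rfl
  | succ i ih => exact ih.grow fun S' => develop_ok _ S'

/-- Above each open node, the tree consists of steps of the search. -/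
def FinTree.Searched : FinTree L → Prop
  | .opn _ => True
  | .nul _ => True
  | .one I t => t.openNodes = [] ∨ IsSearchStep I.conclusion I ∧ t.Searched
  | .two I t₀ t₁ => t₀.openNodes ++ t₁.openNodes = [] ∨
      IsSearchStep I.conclusion I ∧ t₀.Searched ∧ t₁.Searched

theorem FinTree.searched_of_openNodes_eq_nil {t : FinTree L} (h : t.openNodes = []) :
    t.Searched := by
  cases t with
  | opn S => trivial
  | nul I => trivial
  | one I t => exact .inl h
  | two I t₀ t₁ => exact .inl h

theorem FinTree.Searched.grow {f : Sequent L → FinTree L} (hf : ∀ S, (f S).Searched)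
    {t : FinTree L} (h : t.Searched) : (t.grow f).Searched := by
  induction t with
  | opn S' => exact hf S'
  | nul I => trivial
  | one I t ih =>
    rcases h with h | ⟨h, h'⟩
    · refine .inl ?_
      rwa [grow_of_openNodes_eq_nil h]
    · exact .inr ⟨h, ih h'⟩
  | two I t₀ t₁ ih₀ ih₁ =>
    rcases h with h | ⟨h, h₀, h₁⟩
    · refine .inl ?_
      have h' := List.append_eq_nil_iff.1 h
      rwa [grow_of_openNodes_eq_nil h'.1, grow_of_openNodes_eq_nil h'.2]
    · exact .inr ⟨h, ih₀ h₀, ih₁ h₁⟩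

theorem applyRule_searched {S : Sequent L} {o : Option (Inference L)}
    (h : ∀ I, o = some I → IsSearchStep S I) : (applyRule S o).Searched := by
  rcases o with _ | I
  · trivial
  · have hI := h I rfl
    have hI' : IsSearchStep I.conclusion I := hI.conclusion.symm ▸ hI
    rcases rule_eq hI with ⟨S₀, h₀, hr⟩ | ⟨S₀, S₁, h₀, hr⟩ <;> rw [applyRule, hr]
    · exact .inr ⟨hI', trivial⟩
    · exact .inr ⟨hI', trivial, trivial⟩

theorem develop_searched (e : Elem L) (S : Sequent L) : (develop e S).Searched := by
  unfold develop
  split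
  · rename_i t ht
    exact FinTree.searched_of_openNodes_eq_nil (close_spec ht).2
  · exact (applyRule_searched fun I => leftRule_isSearchStep).grow fun S' =>
      applyRule_searched fun I => rightRule_isSearchStep

theorem stage_searched (E : ℕ → Elem L) (S : Sequent L) (i : ℕ) : (stage E S i).Searched := by
  induction i with
  | zero => trivial
  | succ i ih => exact ih.grow fun S' => develop_searched _ S'

theorem FinTree.Searched.isSearchStep {t : FinTree L} (h : t.Searched) {p q : List ℕ}
    {I : Inference L} {S' : Sequent L} (hI : t.label p = some (.inf I))
    (hS' : t.label (p ++ q) = some (.opn S')) : IsSearchStep I.conclusion I := by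
  induction t generalizing p with
  | opn S => rcases p with _ | ⟨j, p⟩ <;> simp [label] at hI
  | nul J =>
    rcases p with _ | ⟨j, p⟩ <;> simp [label] at hI
    rcases q with _ | ⟨j, q⟩ <;> simp [label] at hS'
  | one J t ih =>
    have := mem_openNodes hS'
    rcases h with h | ⟨h, h'⟩
    · simp [openNodes, h] at this
    · rcases p with _ | ⟨_ | j, p⟩ <;> simp [label] at hI
      · exact hI ▸ h
      · exact ih h' hI hS'
  | two J t₀ t₁ ih₀ ih₁ =>
    have := mem_openNodes hS'
    rcases h with h | ⟨h, h₀, h₁⟩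
    · simp only [openNodes, h] at this
      simp at this
    · rcases p with _ | ⟨_ | _ | j, p⟩ <;> simp [label] at hI
      · exact hI ▸ h
      · exact ih₀ h₀ hI hS'
      · exact ih₁ h₁ hI hS'

theorem FinTree.Searched.subset {t : FinTree L} (h : t.Searched) {S S' : Sequent L} (hS : t.Ok S)
    {p : List ℕ} (hS' : t.label p = some (.opn S')) :
    S.left ⊆ S'.left ∧ S.right ⊆ S'.right := by
  induction t generalizing S p with
  | opn S₀ =>
    rcases p with _ | ⟨j, p⟩ <;> simp [label] at hS'
    obtain rfl : S₀ = S := hS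
    simp [hS']
  | nul J => rcases p with _ | ⟨j, p⟩ <;> simp [label] at hS'
  | one J t ih =>
    have := mem_openNodes hS'
    rcases h with h | ⟨h, h'⟩
    · simp [openNodes, h] at this
    · obtain ⟨rfl, -, -, S₀, h₀, ht⟩ := hS
      rcases p with _ | ⟨_ | j, p⟩ <;> simp [label] at hS'
      obtain ⟨i₁, i₂⟩ := ih h' ht hS'
      obtain ⟨m₁, m₂⟩ := h.mono S₀ (by simp [h₀])
      exact ⟨m₁.trans i₁, m₂.trans i₂⟩
  | two J t₀ t₁ ih₀ ih₁ =>
    have := mem_openNodes hS'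
    rcases h with h | ⟨h, h₀, h₁⟩
    · simp only [openNodes, h] at this
      simp at this
    · obtain ⟨rfl, -, -, S₀, S₁, hp, ht₀, ht₁⟩ := hS
      rcases p with _ | ⟨_ | _ | j, p⟩ <;> simp [label] at hS'
      · obtain ⟨i₁, i₂⟩ := ih₀ h₀ ht₀ hS'
        obtain ⟨m₁, m₂⟩ := h.mono S₀ (by simp [hp])
        exact ⟨m₁.trans i₁, m₂.trans i₂⟩
      · obtain ⟨i₁, i₂⟩ := ih₁ h₁ ht₁ hS'
        obtain ⟨m₁, m₂⟩ := h.mono S₁ (by simp [hp])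
        exact ⟨m₁.trans i₁, m₂.trans i₂⟩

end Trees
end RTC

namespace RTC
variable {L : FirstOrder.Language.{u, v}}

section Limit

variable [∀ n, Encodable (L.Functions n)] [∀ n, Encodable (L.Relations n)]

/-! ### The limit of the stages -/

section Stages

variable {E : ℕ → Elem L} {S : Sequent L} {p : List ℕ} {I : Inference L} {S' : Sequent L}

theorem stage_label_inf {i j : ℕ} (hij : i ≤ j) (h : (stage E S i).label p = some (.inf I)) :
    (stage E S j).label p = some (.inf I) := by
  induction j, hij using Nat.le_induction with
  | base => exact h
  | succ j _ ih => exact FinTree.label_grow_inf ih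

theorem stage_succ_opn {i : ℕ} (h : (stage E S i).label p = some (.opn S')) (q : List ℕ) :
    (stage E S (i + 1)).label (p ++ q) = (develop (E i) S').label q :=
  FinTree.label_grow_opn h q

/-- The sequent at a node never changes, whereas an open node may turn into an inference. -/
theorem stage_label_sequent {i j : ℕ} (hij : i ≤ j) {l : Label L}
    (h : (stage E S i).label p = some l) :
    ∃ l', (stage E S j).label p = some l' ∧ l'.sequent = l.sequent := by
  induction j, hij using Nat.le_induction with
  | base => exact ⟨l, h, rfl⟩
  | succ j _ ih =>
    obtain ⟨l', hl', hs⟩ := ih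
    rcases l' with S' | I
    · obtain ⟨l'', h'', hs'⟩ := (develop_ok (E j) S').root
      refine ⟨l'', ?_, hs'.trans hs⟩
      rw [← h'', ← stage_succ_opn hl' [], List.append_nil]
    · exact ⟨_, FinTree.label_grow_inf hl', hs⟩

theorem exists_eventually_label (E : ℕ → Elem L) (S : Sequent L) (p : List ℕ) :
    ∃ l, ∀ᶠ i in atTop, (stage E S i).label p = l := by
  by_cases h : ∃ i I, (stage E S i).label p = some (.inf I)
  · obtain ⟨i, I, hI⟩ := h
    exact ⟨_, eventually_atTop.2 ⟨i, fun j hj => stage_label_inf hj hI⟩⟩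
  by_cases h' : ∃ i S', (stage E S i).label p = some (.opn S')
  · obtain ⟨i, S', hS'⟩ := h'
    refine ⟨some (.opn S'), eventually_atTop.2 ⟨i, fun j hj => ?_⟩⟩
    obtain ⟨l, hl, hs⟩ := stage_label_sequent hj hS'
    rcases l with S'' | I
    · rw [hl, show S'' = S' from hs]
    · exact absurd ⟨j, I, hl⟩ h
  · refine ⟨none, Eventually.of_forall fun i => ?_⟩
    rcases hl : (stage E S i).label p with _ | (S' | I)
    · rfl
    · exact absurd ⟨i, S', hl⟩ h'
    · exact absurd ⟨i, I, hl⟩ h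

/-- The labels of the stages stabilize, so that the default value in the definition of the limit is
never used. -/
theorem eventually_searchTree (E : ℕ → Elem L) (S : Sequent L) (p : List ℕ) :
    ∀ᶠ i in atTop, (stage E S i).label p = searchTree E S p := by
  have h := exists_eventually_label E S p
  rw [searchTree, dif_pos h]
  exact h.choose_spec

theorem searchTree_eq_inf {i : ℕ} (h : (stage E S i).label p = some (.inf I)) :
    searchTree E S p = some (.inf I) := by
  obtain ⟨j, hj, hij⟩ := ((eventually_searchTree E S p).and (eventually_ge_atTop i)).exists
  rw [← hj, stage_label_inf hij h]

theorem searchTree_isDerivation (E : ℕ → Elem L) (S : Sequent L) :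
    IsDerivation (searchTree E S) S where
  root := by
    obtain ⟨i, hi⟩ := (eventually_searchTree E S []).exists
    rw [← hi]
    exact (stage_ok E S i).isDerivation.root
  child p k := by
    obtain ⟨i, hi, hi'⟩ :=
      ((eventually_searchTree E S p).and (eventually_searchTree E S (p ++ [k]))).exists
    rw [← hi, ← hi']
    exact (stage_ok E S i).isDerivation.child p k
  side p I hI := by
    obtain ⟨i, hi⟩ := (eventually_searchTree E S p).exists
    exact (stage_ok E S i).isDerivation.side p I (hi.trans hI)

theorem searchTree_cutFree (E : ℕ → Elem L) (S : Sequent L) : CutFree (searchTree E S) := by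
  intro p I hI
  obtain ⟨i, hi⟩ := (eventually_searchTree E S p).exists
  exact (stage_ok E S i).cutFree p I (hi.trans hI)

end Stages

/-! ### Open nodes of the search tree -/

/-- At a node that remains open, no schedule element ever acts. -/
theorem hintikka_of_open {E : ℕ → Elem L} (hE : IsFair E) {S S' : Sequent L} {p : List ℕ}
    (h : searchTree E S p = some (.opn S')) : Hintikka {φ | φ ∈ S'.left} {φ | φ ∈ S'.right} := by
  have key : close S' = none ∧ ∀ e, leftRule S' e = none ∧ rightRule S' e = none := by
    have hev := eventually_searchTree E S p
    rw [h] at hev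
    have step : ∀ e, close S' = none ∧ leftRule S' e = none ∧ rightRule S' e = none := by
      intro e
      obtain ⟨i, rfl, hi, hi'⟩ := ((hE.recurs e).and_eventually
        (hev.and ((tendsto_add_atTop_nat 1).eventually hev))).exists
      have := stage_succ_opn hi []
      rw [List.append_nil, hi', develop] at this
      split at this
      · rename_i t ht
        cases t with
        | opn S => have := (close_spec ht).2; simp [FinTree.openNodes] at this
        | nul I => simp [FinTree.label] at this
        | one I t => simp [FinTree.label] at this
        | two I t₀ t₁ => simp [FinTree.label] at this
      · rename_i hc
        refine ⟨hc, ?_⟩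
        rcases hl : leftRule S' (E i) with _ | J
        · rw [hl, applyRule, FinTree.grow] at this
          rcases hr : rightRule S' (E i) with _ | J
          · simp
          · rw [hr, applyRule] at this
            rcases rule_eq (rightRule_isSearchStep hr) with ⟨S₀, -, hJ⟩ | ⟨S₀, S₁, -, hJ⟩ <;>
              simp [hJ, FinTree.label] at this
        · rw [hl, applyRule] at this
          rcases rule_eq (leftRule_isSearchStep hl) with ⟨S₀, -, hJ⟩ | ⟨S₀, S₁, -, hJ⟩ <;>
            simp [hJ, FinTree.label, FinTree.grow] at this
    -- Whether the node is closed does not depend on the element, so any element will do.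
    exact ⟨(step (.neg (.eq (fvar 0) (fvar 0)))).1, fun e => (step e).2⟩
  obtain ⟨hc, hr⟩ := key
  obtain ⟨h₁, h₂, h₃⟩ := close_eq_none hc
  constructor
  case disj => exact h₁
  case eqRefl => exact h₂
  case rtcRefl => exact h₃
  case negL => intro φ hφ; simpa [leftRule, show _ ∈ S'.left from hφ] using (hr (.neg φ)).1
  case negR => intro φ hφ; simpa [rightRule, show _ ∈ S'.right from hφ] using (hr (.neg φ)).2
  case andL => intro φ ψ hφ; simpa [leftRule, show _ ∈ S'.left from hφ] using (hr (.and φ ψ)).1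
  case andR => intro φ ψ hφ; simpa [rightRule, show _ ∈ S'.right from hφ] using (hr (.and φ ψ)).2
  case orL => intro φ ψ hφ; simpa [leftRule, show _ ∈ S'.left from hφ] using (hr (.or φ ψ)).1
  case orR => intro φ ψ hφ; simpa [rightRule, show _ ∈ S'.right from hφ] using (hr (.or φ ψ)).2
  case impL => intro φ ψ hφ; simpa [leftRule, show _ ∈ S'.left from hφ] using (hr (.imp φ ψ)).1
  case impR => intro φ ψ hφ; simpa [rightRule, show _ ∈ S'.right from hφ] using (hr (.imp φ ψ)).2
  case allL => intro φ hφ t; simpa [leftRule, show _ ∈ S'.left from hφ] using (hr (.all φ t)).1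
  case allR =>
    intro φ hφ; simpa [rightRule, show _ ∈ S'.right from hφ] using (hr (.all φ (fvar 0))).2
  case exL =>
    intro φ hφ; simpa [leftRule, show _ ∈ S'.left from hφ] using (hr (.ex φ (fvar 0))).1
  case exR => intro φ hφ t; simpa [rightRule, show _ ∈ S'.right from hφ] using (hr (.ex φ t)).2
  case rtcL =>
    intro φ s t hφ
    obtain ⟨z, hz⟩ := Infinite.exists_notMem_finset
      (setFv S'.left ∪ setFv S'.right ∪ (Fml.rtc φ s t).fv)
    simp only [setFv, Finset.mem_union, Finset.mem_biUnion, not_or, not_exists, not_and] at hz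
    have := (hr (.rtc φ s t s z S'.left.toList S'.right.toList
      ⟨by simpa using hz.1.1, by simpa using hz.1.2, hz.2⟩)).1
    simp [leftRule, show _ ∈ S'.left from hφ] at this
  case rtcR =>
    intro φ s t hφ r
    obtain ⟨z, hz⟩ := Infinite.exists_notMem_finset (Fml.rtc φ s t).fv
    have := (hr (.rtc φ s t r z [] [] ⟨by simp, by simp, hz⟩)).2
    simp [rightRule, show _ ∈ S'.right from hφ] at this
  case eq₁ =>
    intro s t hst φ x hφ
    have := (hr (.eq s t x φ false S'.left.toList S'.right.toList)).1
    simp [leftRule, show _ ∈ S'.left from hst, show _ ∈ S'.right from hφ] at this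
  case eq₂ =>
    intro s t hst φ x hφ
    have := (hr (.eq s t x φ true S'.left.toList S'.right.toList)).1
    simp [leftRule, show _ ∈ S'.left from hst, show _ ∈ S'.right from hφ] at this

/-! ### Infinite paths of the search tree -/

/-- The address reached after `n` steps along the path that chooses the premises `b`. -/
abbrev addr (b : ℕ → ℕ) (n : ℕ) : List ℕ := (List.range n).map b

theorem addr_succ (b : ℕ → ℕ) (n : ℕ) : addr b (n + 1) = addr b n ++ [b n] := by
  simp [addr, List.range_succ]

theorem addr_prefix (b : ℕ → ℕ) {m n : ℕ} (h : m ≤ n) :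
    ∃ q, addr b n = addr b m ++ q ∧ q.length = n - m := by
  induction n, h using Nat.le_induction with
  | base => exact ⟨[], by simp⟩
  | succ n hmn ih =>
    obtain ⟨q, hq, hl⟩ := ih
    refine ⟨q ++ [b n], by rw [addr_succ, hq, List.append_assoc], ?_⟩
    simp only [List.length_append, hl, List.length_singleton]
    omega

namespace IsInfinitePath

variable {E : ℕ → Elem L} {S : Sequent L} {b : ℕ → ℕ} {I : ℕ → Inference L}

theorem eventually_stage (h : IsInfinitePath (searchTree E S) b I) (n : ℕ) :
    ∀ᶠ i in atTop, (stage E S i).label (addr b n) = some (.inf (I n)) := by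
  have := eventually_searchTree E S (addr b n)
  rwa [show searchTree E S (addr b n) = _ from h n] at this

theorem premise (h : IsInfinitePath (searchTree E S) b I) (n : ℕ) :
    (I n).premises[b n]? = some (I (n + 1)).conclusion := by
  have := (searchTree_isDerivation E S).child (addr b n) (b n)
  rw [← addr_succ, show searchTree E S (addr b n) = _ from h n,
    show searchTree E S (addr b (n + 1)) = _ from h (n + 1)] at this
  simpa [Label.premises, Label.sequent] using this.symm

theorem root (h : IsInfinitePath (searchTree E S) b I) : (I 0).conclusion = S := by
  have := (searchTree_isDerivation E S).root
  rw [show searchTree E S [] = _ from h 0] at this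
  simpa [Label.sequent] using this

theorem sequent_eq (h : IsInfinitePath (searchTree E S) b I) {i n : ℕ} {l : Label L}
    (hl : (stage E S i).label (addr b n) = some l) : l.sequent = (I n).conclusion := by
  obtain ⟨j, hj, hij⟩ := ((h.eventually_stage n).and (eventually_ge_atTop i)).exists
  obtain ⟨l', hl', hs⟩ := stage_label_sequent hij hl
  rw [hj] at hl'
  rw [← hs, ← Option.some.inj hl']
  rfl

/-- An infinite path leaves each stage through an open node. -/
theorem exists_open (h : IsInfinitePath (searchTree E S) b I) (i : ℕ) :
    ∃ n, (stage E S i).label (addr b n) = some (.opn (I n).conclusion) := by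
  classical
  have hex : ∃ n, (stage E S i).label (addr b n) = none := by
    obtain ⟨d, hd⟩ := (stage E S i).exists_depth
    exact ⟨d + 1, hd _ (by simp)⟩
  obtain ⟨m, hm⟩ : ∃ m, Nat.find hex = m + 1 := by
    refine Nat.exists_eq_succ_of_ne_zero fun h0 => ?_
    have := Nat.find_spec hex
    rw [h0] at this
    obtain ⟨l, hl, -⟩ := (stage_ok E S i).root
    exact absurd (hl.symm.trans this) (by simp)
  have h₁ : (stage E S i).label (addr b (m + 1)) = none := hm ▸ Nat.find_spec hex
  have h₂ : (stage E S i).label (addr b m) ≠ none := Nat.find_min hex (by omega)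
  obtain ⟨l, hl⟩ := Option.ne_none_iff_exists'.1 h₂
  have hs := h.sequent_eq hl
  rcases l with S' | J
  · exact ⟨m, by rw [hl, ← hs]; rfl⟩
  · have hJ : J = I m := by
      have := searchTree_eq_inf hl
      rw [show searchTree E S (addr b m) = _ from h m] at this
      simpa using this.symm
    have hc := (stage_ok E S i).isDerivation.child (addr b m) (b m)
    rw [← addr_succ, h₁, hl, hJ] at hc
    simp [Label.premises, h.premise m] at hc

/-- The open nodes through which an infinite path leaves the stages move away from the root. -/
theorem eventually_le_open (h : IsInfinitePath (searchTree E S) b I) (n₀ : ℕ) :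
    ∀ᶠ i in atTop, ∀ n S', (stage E S i).label (addr b n) = some (.opn S') → n₀ ≤ n := by
  filter_upwards [h.eventually_stage n₀] with i hi n S' hn
  by_contra hlt
  obtain ⟨q, hq, hql⟩ := addr_prefix b (not_le.1 hlt).le
  rw [hq] at hi
  have := FinTree.eq_nil_of_opn hn (q := q) (by simp [hi])
  rw [this, List.length_nil] at hql
  omega

theorem isSearchStep (h : IsInfinitePath (searchTree E S) b I) (n : ℕ) :
    IsSearchStep (I n).conclusion (I n) := by
  obtain ⟨i, hi, hle⟩ := ((h.eventually_stage n).and (h.eventually_le_open n)).exists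
  obtain ⟨m, hm⟩ := h.exists_open i
  obtain ⟨q, hq, -⟩ := addr_prefix b (hle m _ hm)
  rw [hq] at hm
  exact (stage_searched E S i).isSearchStep hi hm

theorem mono (h : IsInfinitePath (searchTree E S) b I) {m n : ℕ} (hmn : m ≤ n) :
    (I m).conclusion.left ⊆ (I n).conclusion.left ∧
      (I m).conclusion.right ⊆ (I n).conclusion.right := by
  induction n, hmn using Nat.le_induction with
  | base => exact ⟨subset_rfl, subset_rfl⟩
  | succ n _ ih =>
    obtain ⟨h₁, h₂⟩ := (h.isSearchStep n).mono _ (List.mem_of_getElem? (h.premise n))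
    exact ⟨ih.1.trans h₁, ih.2.trans h₂⟩

/-- The open node at which an infinite path leaves a stage is not closed at the next one, since the
closed tree that takes its place has no open node through which the path could leave. -/
theorem close_open (h : IsInfinitePath (searchTree E S) b I) {i n : ℕ}
    (hn : (stage E S i).label (addr b n) = some (.opn (I n).conclusion)) :
    close (I n).conclusion = none := by
  by_contra hc
  obtain ⟨t, ht⟩ := Option.ne_none_iff_exists'.1 hc
  have hd : develop (E i) (I n).conclusion = t := by rw [develop, ht]
  obtain ⟨hok, hop⟩ := close_spec ht
  obtain ⟨n', hn'⟩ := h.exists_open (i + 1)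
  rcases le_or_gt n n' with hle | hlt
  · obtain ⟨q, hq, -⟩ := addr_prefix b hle
    rw [hq, stage_succ_opn hn q, hd] at hn'
    simpa [hop] using FinTree.mem_openNodes hn'
  · obtain ⟨q, hq, hql⟩ := addr_prefix b hlt.le
    have := stage_succ_opn hn []
    rw [List.append_nil, hd] at this
    obtain ⟨l, hl, -⟩ := hok.root
    have hnil := FinTree.eq_nil_of_opn hn' (q := q) (by rw [← hq, this, hl]; simp)
    rw [hnil, List.length_nil] at hql
    omega

/-- Every schedule element that occurs infinitely often acts arbitrarily late on the path: first by
its left rule at an open node of the current stage, and then by its right rule. -/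
theorem fire (h : IsInfinitePath (searchTree E S) b I) {P : ℕ → Prop} (hP : ∃ᶠ i in atTop, P i)
    (n₀ : ℕ) :
    ∃ i n, P i ∧ n₀ ≤ n ∧ (I n).conclusion ∈ (stage E S i).openNodes ∧
      close (I n).conclusion = none ∧
      (∀ J, leftRule (I n).conclusion (E i) = some J → I n = J) ∧
      ∃ n', n₀ ≤ n' ∧ ∀ J, rightRule (I n').conclusion (E i) = some J → I n' = J := by
  obtain ⟨i, hi, hle⟩ := (hP.and_eventually (h.eventually_le_open n₀)).exists
  obtain ⟨n, hn⟩ := h.exists_open i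
  have hc := h.close_open hn
  have hinf : ∀ (m : ℕ) (J : Inference L),
      (stage E S (i + 1)).label (addr b m) = some (.inf J) → I m = J := by
    intro m J hJ
    have := searchTree_eq_inf hJ
    rw [show searchTree E S (addr b m) = _ from h m] at this
    simpa using this
  have hd : develop (E i) (I n).conclusion =
      (applyRule (I n).conclusion (leftRule (I n).conclusion (E i))).grow
        fun S' => applyRule S' (rightRule S' (E i)) := by rw [develop, hc]
  have hroot : ∀ (S' : Sequent L) (J : Inference L), rightRule S' (E i) = some J →
      (applyRule S' (rightRule S' (E i))).label [] = some (.inf J) := by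
    intro S' J hJ
    rw [hJ, applyRule]
    rcases rule_eq (rightRule_isSearchStep hJ) with ⟨S₀, -, hr⟩ | ⟨S₀, S₁, -, hr⟩ <;> rw [hr] <;>
      rfl
  refine ⟨i, n, hi, hle n _ hn, FinTree.mem_openNodes hn, hc, fun J hJ => hinf n J ?_, ?_⟩
  · have := stage_succ_opn hn []
    rw [List.append_nil] at this
    rw [this, hd, hJ, applyRule]
    rcases rule_eq (leftRule_isSearchStep hJ) with ⟨S₀, -, hr⟩ | ⟨S₀, S₁, -, hr⟩ <;> rw [hr] <;>
      rfl
  · rcases hl : leftRule (I n).conclusion (E i) with _ | J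
    · refine ⟨n, hle n _ hn, fun K hK => hinf n K ?_⟩
      have := stage_succ_opn hn []
      rw [List.append_nil] at this
      rw [this, hd, hl]
      exact hroot _ K hK
    · refine ⟨n + 1, (hle n _ hn).trans n.le_succ, fun K hK => hinf (n + 1) K ?_⟩
      have hJ : I n = J := by
        refine hinf n J ?_
        have := stage_succ_opn hn []
        rw [List.append_nil] at this
        rw [this, hd, hl, applyRule]
        rcases rule_eq (leftRule_isSearchStep hl) with ⟨S₀, -, hr⟩ | ⟨S₀, S₁, -, hr⟩ <;>
          rw [hr] <;> rfl
      have hp := h.premise n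
      rw [addr_succ, stage_succ_opn hn, hd, hl, applyRule]
      rw [hJ] at hp
      rcases rule_eq (leftRule_isSearchStep hl) with ⟨S₀, h₀, hr⟩ | ⟨S₀, S₁, h₀, hr⟩ <;> rw [hr]
      · rw [h₀] at hp
        rcases hb : b n with _ | k
        · rw [hb] at hp
          obtain rfl : S₀ = _ := by simpa using hp
          exact hroot _ K hK
        · simp [hb] at hp
      · rw [h₀] at hp
        rcases hb : b n with _ | _ | k
        · rw [hb] at hp
          obtain rfl : S₀ = _ := by simpa using hp
          exact hroot _ K hK
        · rw [hb] at hp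
          obtain rfl : S₁ = _ := by simpa using hp
          exact hroot _ K hK
        · simp [hb] at hp

end IsInfinitePath

end Limit
end RTC

namespace RTC
variable {L : FirstOrder.Language.{u, v}}

section LimitPath

variable [∀ n, Encodable (L.Functions n)] [∀ n, Encodable (L.Relations n)]

/-! ### The limit sequent of an untraceable path -/

/-- The next formula, as the second argument of the `RTC` formula, of the trace which progresses
whenever the path allows it to. -/
noncomputable def nextArg (φ : Fml L 2) (s t : Term₀ L) (k : ℕ) : Inference L → Term₀ L
  | .rtcCase _ _ φ' s' t' z => if k = 1 ∧ Fml.rtc φ s t = .rtc φ' s' t' then fvar z else t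
  | _ => t

theorem nextArg_spec (φ : Fml L 2) (s t : Term₀ L) (k : ℕ) (I : Inference L) :
    (∃ Γ Δ z, I = .rtcCase Γ Δ φ s t z ∧ k = 1 ∧ nextArg φ s t k I = fvar z) ∨
      nextArg φ s t k I = t ∧ ∀ Γ Δ z, I = .rtcCase Γ Δ φ s t z → k ≠ 1 := by
  cases I with
  | rtcCase Γ Δ φ' s' t' z =>
    by_cases h : k = 1 ∧ Fml.rtc φ s t = .rtc φ' s' t'
    · obtain ⟨hk, he⟩ := h
      cases he
      exact .inl ⟨Γ, Δ, z, rfl, hk, by simp [nextArg, hk]⟩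
    · refine .inr ⟨by simp only [nextArg, if_neg h], ?_⟩
      rintro Γ' Δ' z' he hk
      cases he
      exact h ⟨hk, rfl⟩
  | _ => exact .inr ⟨rfl, by simp⟩

theorem tracePair_of_isSearchStep {S : Sequent L} {I : Inference L} (h : IsSearchStep S I) {k : ℕ}
    {τ τ' : Formula₀ L} (hτ : τ.IsRTC) (hτ' : τ'.IsRTC) (hm : τ ∈ I.conclusion.left)
    (hm' : ∃ S', I.premises[k]? = some S' ∧ τ' ∈ S'.left) (hp : Progress I k τ τ' ∨ τ = τ') :
    TracePair I k τ τ' := by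
  refine ⟨hτ, hτ', hm, hm', ?_⟩
  cases I <;> first | exact hp | exact absurd rfl (h.not_subst _ _ _)

namespace IsInfinitePath

variable {E : ℕ → Elem L} {S : Sequent L} {b : ℕ → ℕ} {I : ℕ → Inference L}

/-- On an untraceable path, unfolding an `RTC` formula on the left must end with an equation: if the
right-hand premise of the case rule were chosen again and again, the unfoldings would form an
infinitely progressing trace. -/
theorem rtcChain (h : IsInfinitePath (searchTree E S) b I) (hE : IsFair E)
    (hT : ¬ Traceable b I) {φ : Fml L 2} {s t : Term₀ L} {n₀ : ℕ}
    (h₀ : Fml.rtc φ s t ∈ (I n₀).conclusion.left) :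
    RtcChain {ψ | ∃ n, ψ ∈ (I n).conclusion.left} φ s t := by
  -- The trace consists of the formulas `(RTC_{x,y} φ)(s, u i)`.
  let u : ℕ → Term₀ L := fun i =>
    Nat.rec t (fun i t' => nextArg φ s t' (b (n₀ + i)) (I (n₀ + i))) i
  have hu : ∀ i, u (i + 1) = nextArg φ s (u i) (b (n₀ + i)) (I (n₀ + i)) := fun _ => rfl
  have hstep : ∀ i, (Progress (I (n₀ + i)) (b (n₀ + i)) (.rtc φ s (u i)) (.rtc φ s (u (i + 1))) ∧
      ∃ z, u (i + 1) = fvar z ∧ Fml.rtc φ s (fvar z) ∈ (I (n₀ + i + 1)).conclusion.left ∧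
        φ.inst₂ (fvar z) (u i) ∈ (I (n₀ + i + 1)).conclusion.left) ∨
      u (i + 1) = u i ∧ ∀ Γ Δ z, I (n₀ + i) = .rtcCase Γ Δ φ s (u i) z → b (n₀ + i) ≠ 1 := by
    intro i
    rcases nextArg_spec φ s (u i) (b (n₀ + i)) (I (n₀ + i)) with ⟨Γ, Δ, z, hI, hb, hn⟩ | hn
    · left
      have hp := h.premise (n₀ + i)
      rw [hI, hb] at hp
      have hp' : _ = (I (n₀ + i + 1)).conclusion := Option.some.inj hp
      rw [hu, hn]
      refine ⟨?_, z, rfl, ?_, ?_⟩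
      · rw [hI, hb]; exact ⟨rfl, rfl, rfl⟩
      · rw [← hp']; simp
      · rw [← hp']; simp
    · right
      rw [hu]
      exact hn
  have hmem : ∀ i, Fml.rtc φ s (u i) ∈ (I (n₀ + i)).conclusion.left := by
    intro i
    induction i with
    | zero => exact h₀
    | succ i ih =>
      rcases hstep i with ⟨-, z, hz, hm, -⟩ | ⟨he, -⟩
      · rw [hz]; exact hm
      · rw [he]; exact (h.mono (Nat.le_succ _)).1 ih
  have hpair : ∀ i, TracePair (I (n₀ + i)) (b (n₀ + i)) (.rtc φ s (u i))
      (.rtc φ s (u (i + 1))) := fun i =>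
    tracePair_of_isSearchStep (h.isSearchStep _) ⟨_, _, _, rfl⟩ ⟨_, _, _, rfl⟩ (hmem i)
      ⟨_, h.premise _, hmem (i + 1)⟩ ((hstep i).imp (fun h => h.1) fun h => by rw [h.1])
  have hfin : ¬ ∃ᶠ i in atTop, Progress (I (n₀ + i)) (b (n₀ + i)) (.rtc φ s (u i))
      (.rtc φ s (u (i + 1))) := fun hf => hT ⟨n₀, fun i => .rtc φ s (u i), hpair, hf⟩
  obtain ⟨N, hN⟩ := eventually_atTop.1 (not_frequently.1 hfin)
  have hconst : ∀ i, N ≤ i → u i = u N := by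
    intro i hi
    induction i, hi using Nat.le_induction with
    | base => rfl
    | succ i hi ih =>
      rcases hstep i with ⟨hp, -⟩ | ⟨he, -⟩
      · exact absurd hp (hN i hi)
      · rw [he, ih]
  -- Fairness applies the case rule to the formula at which the trace has come to rest, and the path
  -- does not enter the right-hand premise.
  have hbase : RtcChain {ψ | ∃ n, ψ ∈ (I n).conclusion.left} φ s (u N) := by
    obtain ⟨i, n, ⟨z, Γ, Δ, hf, he, hw⟩, hn, ho, -, hl, -⟩ :=
      h.fire (hE.rtc S φ s (u N) s) (n₀ + N)
    obtain ⟨m, rfl⟩ : ∃ m, n = n₀ + m := ⟨n - n₀, by omega⟩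
    have hm := hmem m
    rw [hconst m (by omega)] at hm
    have hI := hl (.rtcCase (I (n₀ + m)).conclusion.left (I (n₀ + m)).conclusion.right φ s (u N) z)
      (by rw [he, leftRule, if_pos]
          exact ⟨hm, (hw _ ho).1.trans (Finset.subset_insert _ _), (hw _ ho).2⟩)
    have hp := List.mem_of_getElem? (h.premise (n₀ + m))
    have hb : b (n₀ + m) ≠ 1 := by
      rcases hstep m with ⟨hp, -⟩ | ⟨-, hb⟩
      · exact absurd hp (hN m (by omega))
      · exact hb _ _ z (by rw [hconst m (by omega)]; exact hI)
    refine .base ⟨n₀ + m + 1, ?_⟩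
    have hp := h.premise (n₀ + m)
    rw [hI] at hp
    rcases hk : b (n₀ + m) with _ | _ | k
    · rw [hk] at hp
      have hp' : _ = (I (n₀ + m + 1)).conclusion := Option.some.inj hp
      rw [← hp']; simp
    · exact absurd hk hb
    · rw [hk] at hp
      simp [Inference.premises] at hp
  -- Each step of the trace back towards `t` prolongs the chain by one variable.
  have hdown : ∀ i, RtcChain {ψ | ∃ n, ψ ∈ (I n).conclusion.left} φ s (u i) →
      RtcChain {ψ | ∃ n, ψ ∈ (I n).conclusion.left} φ s (u 0) := by
    intro i
    induction i with
    | zero => exact id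
    | succ i ih =>
      intro hc
      refine ih ?_
      rcases hstep i with ⟨-, z, hz, -, hm⟩ | ⟨he, -⟩
      · exact .step z ⟨_, hm⟩ (hz ▸ hc)
      · exact he ▸ hc
  exact hdown N hbase

/-- On an untraceable path the unions of the left-hand and of the right-hand sides are saturated: a
formula persists once it has appeared, and later on the schedule makes its rule act. -/
theorem hintikka (h : IsInfinitePath (searchTree E S) b I) (hE : IsFair E)
    (hT : ¬ Traceable b I) :
    Hintikka {φ | ∃ n, φ ∈ (I n).conclusion.left} {φ | ∃ n, φ ∈ (I n).conclusion.right} := by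
  -- The premise chosen by the path after an action of the left, respectively the right rule for a
  -- recurring schedule element `e`, which may be taken beyond any given stage.
  have left : ∀ (e : Elem L) (n₀ : ℕ), ∃ n, n₀ ≤ n ∧ ∀ J, leftRule (I n).conclusion e = some J →
      (I (n + 1)).conclusion ∈ J.premises := by
    intro e n₀
    obtain ⟨i, n, rfl, hn, -, -, hl, -⟩ := h.fire (hE.recurs e) n₀
    exact ⟨n, hn, fun J hJ => hl J hJ ▸ List.mem_of_getElem? (h.premise n)⟩
  have right : ∀ (e : Elem L) (n₀ : ℕ), ∃ n, n₀ ≤ n ∧ ∀ J,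
      rightRule (I n).conclusion e = some J → (I (n + 1)).conclusion ∈ J.premises := by
    intro e n₀
    obtain ⟨i, -, rfl, -, -, -, -, n, hn, hr⟩ := h.fire (hE.recurs e) n₀
    exact ⟨n, hn, fun J hJ => hr J hJ ▸ List.mem_of_getElem? (h.premise n)⟩
  have closed : ∀ n₀, ∃ n, n₀ ≤ n ∧ close (I n).conclusion = none := by
    intro n₀
    obtain ⟨i, n, -, hn, -, hc, -⟩ := h.fire (hE.recurs (.neg (.eq (fvar 0) (fvar 0)))) n₀
    exact ⟨n, hn, hc⟩
  constructor
  case disj =>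
    rintro φ ⟨m, hm⟩ ⟨m', hm'⟩
    obtain ⟨n, hn, hc⟩ := closed (max m m')
    exact (close_eq_none hc).1 φ ((h.mono ((le_max_left _ _).trans hn)).1 hm)
      ((h.mono ((le_max_right _ _).trans hn)).2 hm')
  case eqRefl =>
    rintro t ⟨m, hm⟩
    obtain ⟨n, hn, hc⟩ := closed m
    exact (close_eq_none hc).2.1 t ((h.mono hn).2 hm)
  case rtcRefl =>
    rintro φ s ⟨m, hm⟩
    obtain ⟨n, hn, hc⟩ := closed m
    exact (close_eq_none hc).2.2 φ s ((h.mono hn).2 hm)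
  case negL =>
    rintro φ ⟨m, hm⟩
    obtain ⟨n, hn, hJ⟩ := left (.neg φ) m
    have := hJ _ (by rw [leftRule, if_pos ((h.mono hn).1 hm)])
    simp only [Inference.premises, List.mem_singleton] at this
    exact ⟨n + 1, by simp [this]⟩
  case negR =>
    rintro φ ⟨m, hm⟩
    obtain ⟨n, hn, hJ⟩ := right (.neg φ) m
    have := hJ _ (by rw [rightRule, if_pos ((h.mono hn).2 hm)])
    simp only [Inference.premises, List.mem_singleton] at this
    exact ⟨n + 1, by simp [this]⟩
  case andL =>
    rintro φ ψ ⟨m, hm⟩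
    obtain ⟨n, hn, hJ⟩ := left (.and φ ψ) m
    have := hJ _ (by rw [leftRule, if_pos ((h.mono hn).1 hm)])
    simp only [Inference.premises, List.mem_singleton] at this
    exact ⟨⟨n + 1, by simp [this]⟩, ⟨n + 1, by simp [this]⟩⟩
  case andR =>
    rintro φ ψ ⟨m, hm⟩
    obtain ⟨n, hn, hJ⟩ := right (.and φ ψ) m
    have := hJ _ (by rw [rightRule, if_pos ((h.mono hn).2 hm)])
    simp only [Inference.premises, List.mem_cons, List.not_mem_nil, or_false] at this
    exact this.imp (fun h => ⟨n + 1, by simp [h]⟩) fun h => ⟨n + 1, by simp [h]⟩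
  case orL =>
    rintro φ ψ ⟨m, hm⟩
    obtain ⟨n, hn, hJ⟩ := left (.or φ ψ) m
    have := hJ _ (by rw [leftRule, if_pos ((h.mono hn).1 hm)])
    simp only [Inference.premises, List.mem_cons, List.not_mem_nil, or_false] at this
    exact this.imp (fun h => ⟨n + 1, by simp [h]⟩) fun h => ⟨n + 1, by simp [h]⟩
  case orR =>
    rintro φ ψ ⟨m, hm⟩
    obtain ⟨n, hn, hJ⟩ := right (.or φ ψ) m
    have := hJ _ (by rw [rightRule, if_pos ((h.mono hn).2 hm)])
    simp only [Inference.premises, List.mem_singleton] at this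
    exact ⟨⟨n + 1, by simp [this]⟩, ⟨n + 1, by simp [this]⟩⟩
  case impL =>
    rintro φ ψ ⟨m, hm⟩
    obtain ⟨n, hn, hJ⟩ := left (.imp φ ψ) m
    have := hJ _ (by rw [leftRule, if_pos ((h.mono hn).1 hm)])
    simp only [Inference.premises, List.mem_cons, List.not_mem_nil, or_false] at this
    exact this.imp (fun h => ⟨n + 1, by simp [h]⟩) fun h => ⟨n + 1, by simp [h]⟩
  case impR =>
    rintro φ ψ ⟨m, hm⟩
    obtain ⟨n, hn, hJ⟩ := right (.imp φ ψ) m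
    have := hJ _ (by rw [rightRule, if_pos ((h.mono hn).2 hm)])
    simp only [Inference.premises, List.mem_singleton] at this
    exact ⟨⟨n + 1, by simp [this]⟩, ⟨n + 1, by simp [this]⟩⟩
  case allL =>
    rintro φ ⟨m, hm⟩ t
    obtain ⟨n, hn, hJ⟩ := left (.all φ t) m
    have := hJ _ (by rw [leftRule, if_pos ((h.mono hn).1 hm)])
    simp only [Inference.premises, List.mem_singleton] at this
    exact ⟨n + 1, by simp [this]⟩
  case allR =>
    rintro φ ⟨m, hm⟩
    obtain ⟨n, hn, hJ⟩ := right (.all φ (fvar 0)) m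
    have := hJ _ (by rw [rightRule, if_pos ((h.mono hn).2 hm)])
    simp only [Inference.premises, List.mem_singleton] at this
    exact ⟨_, n + 1, by rw [this]; exact Finset.mem_insert_self _ _⟩
  case exL =>
    rintro φ ⟨m, hm⟩
    obtain ⟨n, hn, hJ⟩ := left (.ex φ (fvar 0)) m
    have := hJ _ (by rw [leftRule, if_pos ((h.mono hn).1 hm)])
    simp only [Inference.premises, List.mem_singleton] at this
    exact ⟨_, n + 1, by rw [this]; exact Finset.mem_insert_self _ _⟩
  case exR =>
    rintro φ ⟨m, hm⟩ t
    obtain ⟨n, hn, hJ⟩ := right (.ex φ t) m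
    have := hJ _ (by rw [rightRule, if_pos ((h.mono hn).2 hm)])
    simp only [Inference.premises, List.mem_singleton] at this
    exact ⟨n + 1, by simp [this]⟩
  case rtcL =>
    rintro φ s t ⟨m, hm⟩
    exact h.rtcChain hE hT hm
  case rtcR =>
    rintro φ s t ⟨m, hm⟩ r
    obtain ⟨z, hz⟩ := Infinite.exists_notMem_finset (Fml.rtc φ s t).fv
    obtain ⟨n, hn, hJ⟩ := right (.rtc φ s t r z [] [] ⟨by simp, by simp, hz⟩) m
    have := hJ _ (by rw [rightRule, if_pos ((h.mono hn).2 hm)])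
    simp only [Inference.premises, List.mem_cons, List.not_mem_nil, or_false] at this
    exact this.imp (fun h => ⟨n + 1, by simp [h]⟩) fun h => ⟨n + 1, by simp [h]⟩
  case eq₁ =>
    rintro s t ⟨m, hm⟩ φ x ⟨m', hm'⟩
    obtain ⟨i, n, ⟨Γ, Δ, he, hw⟩, hn, ho, -, hl, -⟩ := h.fire (hE.eq S s t x φ false) (max m m')
    have hI := hl (.eqL₂ (I n).conclusion.left (I n).conclusion.right s t x φ)
      (by rw [he, leftRule, if_pos]
          exact ⟨(h.mono ((le_max_left _ _).trans hn)).1 hm,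
            (hw _ ho).1.trans (Finset.subset_insert _ _),
            (h.mono ((le_max_right _ _).trans hn)).2 hm',
            (hw _ ho).2.trans (Finset.subset_insert _ _)⟩)
    have := List.mem_of_getElem? (h.premise n)
    rw [hI] at this
    simp only [Inference.premises, List.mem_singleton] at this
    exact ⟨n + 1, by simp [this]⟩
  case eq₂ =>
    rintro s t ⟨m, hm⟩ φ x ⟨m', hm'⟩
    obtain ⟨i, n, ⟨Γ, Δ, he, hw⟩, hn, ho, -, hl, -⟩ := h.fire (hE.eq S s t x φ true) (max m m')
    have hI := hl (.eqL₁ (I n).conclusion.left (I n).conclusion.right s t x φ)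
      (by rw [he, leftRule, if_pos]
          exact ⟨(h.mono ((le_max_left _ _).trans hn)).1 hm,
            (hw _ ho).1.trans (Finset.subset_insert _ _),
            (h.mono ((le_max_right _ _).trans hn)).2 hm',
            (hw _ ho).2.trans (Finset.subset_insert _ _)⟩)
    have := List.mem_of_getElem? (h.premise n)
    rw [hI] at this
    simp only [Inference.premises, List.mem_singleton] at this
    exact ⟨n + 1, by simp [this]⟩

end IsInfinitePath

/-! ### Countermodels from limit sequents -/

/-- The search tree is a cut-free derivation in any case, so that it can fail to be a proof only
because of an open node or an untraceable path. -/
theorem exists_isLimitSequent {E : ℕ → Elem L} {S : Sequent L}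
    (h : ¬ IsProof (searchTree E S) S) : ∃ G D, IsLimitSequent (searchTree E S) G D := by
  by_contra hn
  refine h ⟨⟨searchTree_isDerivation E S, fun p S' hp => hn ⟨_, _, .inl ⟨p, S', hp, rfl, rfl⟩⟩⟩,
    fun b I hb => ?_⟩
  by_contra hT
  exact hn ⟨_, _, .inr ⟨b, I, hb, hT, rfl, rfl⟩⟩

theorem isLimitSequent_hintikka {E : ℕ → Elem L} (hE : IsFair E) {S : Sequent L}
    {G D : Set (Formula₀ L)} (h : IsLimitSequent (searchTree E S) G D) :
    (∀ φ ∈ S.left, φ ∈ G) ∧ (∀ ψ ∈ S.right, ψ ∈ D) ∧ Hintikka G D := by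
  rcases h with ⟨p, S', hp, rfl, rfl⟩ | ⟨b, I, hb, hT, rfl, rfl⟩
  · obtain ⟨i, hi⟩ := (eventually_searchTree E S p).exists
    obtain ⟨h₁, h₂⟩ := (stage_searched E S i).subset (stage_ok E S i) (hi.trans hp)
    exact ⟨h₁, h₂, hintikka_of_open hE hp⟩
  · exact ⟨fun φ hφ => ⟨0, by rwa [hb.root]⟩, fun φ hφ => ⟨0, by rwa [hb.root]⟩,
      hb.hintikka hE hT⟩

/-- If the search tree of `S` were not a proof, the term structure of one of its limit sequents
would be a countermodel of `S`. -/
theorem isProof_of_valid {E : ℕ → Elem L} (hE : IsFair E) {S : Sequent L} (hS : S.Valid) :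
    IsProof (searchTree E S) S := by
  by_contra h
  obtain ⟨G, D, hGD⟩ := exists_isLimitSequent h
  obtain ⟨h₁, h₂, H⟩ := isLimitSequent_hintikka hE hGD
  have : Nonempty (Herbrand G) := ⟨Herbrand.val G 0⟩
  obtain ⟨ψ, hψ, hh⟩ := hS (Herbrand G) (Herbrand.val G) fun φ hφ =>
    (H.truth _ φ rfl).1 (h₁ φ hφ)
  exact (H.truth _ ψ rfl).2 (h₂ ψ hψ) hh

end LimitPath
end RTC

namespace RTC

/-! ### Primitive recursive functions -/

/- The closure properties of the primitive recursive functions are stated for functions with an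
arbitrary domain and registered with `fun_prop`, which then proves that explicit definitions are
primitive recursive. -/

attribute [fun_prop] Primrec

section Primrec

variable {α β γ σ : Type*} [Primcodable α] [Primcodable β] [Primcodable γ] [Primcodable σ]

@[fun_prop] theorem primrec_id : Primrec fun a : α => a := Primrec.id

@[fun_prop] theorem primrec_const (x : σ) : Primrec fun _ : α => x := Primrec.const x

@[fun_prop] theorem primrec_comp {f : β → σ} {g : α → β} (hf : Primrec f) (hg : Primrec g) :
    Primrec fun a => f (g a) := hf.comp hg

@[fun_prop] theorem primrec_pair {f : α → β} {g : α → γ} (hf : Primrec f) (hg : Primrec g) :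
    Primrec fun a => (f a, g a) := hf.pair hg

@[fun_prop] theorem primrec_fst {f : α → β × γ} (hf : Primrec f) : Primrec fun a => (f a).1 :=
  Primrec.fst.comp hf

@[fun_prop] theorem primrec_snd {f : α → β × γ} (hf : Primrec f) : Primrec fun a => (f a).2 :=
  Primrec.snd.comp hf

@[fun_prop] theorem primrec_natPair {f g : α → ℕ} (hf : Primrec f) (hg : Primrec g) :
    Primrec fun a => Nat.pair (f a) (g a) := Primrec₂.natPair.comp hf hg

@[fun_prop] theorem primrec_unpair {f : α → ℕ} (hf : Primrec f) :
    Primrec fun a => Nat.unpair (f a) := Primrec.unpair.comp hf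

@[fun_prop] theorem primrec_add {f g : α → ℕ} (hf : Primrec f) (hg : Primrec g) :
    Primrec fun a => f a + g a := Primrec.nat_add.comp hf hg

@[fun_prop] theorem primrec_sub {f g : α → ℕ} (hf : Primrec f) (hg : Primrec g) :
    Primrec fun a => f a - g a := Primrec.nat_sub.comp hf hg

@[fun_prop] theorem primrec_max {f g : α → ℕ} (hf : Primrec f) (hg : Primrec g) :
    Primrec fun a => max (f a) (g a) := Primrec.nat_max.comp hf hg

@[fun_prop] theorem primrec_encode {f : α → β} (hf : Primrec f) :
    Primrec fun a => Encodable.encode (f a) := Primrec.encode.comp hf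

@[fun_prop] theorem primrec_ofNat {f : α → ℕ} (hf : Primrec f) :
    Primrec fun a => Denumerable.ofNat (List ℕ) (f a) :=
  (Primrec.ofNat (List ℕ)).comp hf

@[fun_prop] theorem primrec_cons {f : α → β} {g : α → List β} (hf : Primrec f) (hg : Primrec g) :
    Primrec fun a => f a :: g a := Primrec.list_cons.comp hf hg

@[fun_prop] theorem primrec_append {f g : α → List β} (hf : Primrec f) (hg : Primrec g) :
    Primrec fun a => f a ++ g a := Primrec.list_append.comp hf hg

@[fun_prop] theorem primrec_length {f : α → List β} (hf : Primrec f) :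
    Primrec fun a => (f a).length := Primrec.list_length.comp hf

@[fun_prop] theorem primrec_take {f : α → ℕ} {g : α → List β} (hf : Primrec f) (hg : Primrec g) :
    Primrec fun a => (g a).take (f a) := Primrec.list_take.comp hf hg

@[fun_prop] theorem primrec_range {f : α → ℕ} (hf : Primrec f) :
    Primrec fun a => List.range (f a) := Primrec.list_range.comp hf

@[fun_prop] theorem primrec_flatten {f : α → List (List β)} (hf : Primrec f) :
    Primrec fun a => (f a).flatten := Primrec.list_flatten.comp hf

@[fun_prop] theorem primrec_head? {f : α → List β} (hf : Primrec f) :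
    Primrec fun a => (f a).head? := Primrec.list_head?.comp hf

@[fun_prop] theorem primrec_getD {f : α → List β} {g : α → ℕ} (d : β) (hf : Primrec f)
    (hg : Primrec g) : Primrec fun a => (f a).getD (g a) d := (Primrec.list_getD d).comp hf hg

@[fun_prop] theorem primrec_map {f : α → List β} {g : α → β → σ} (hf : Primrec f)
    (hg : Primrec fun p : α × β => g p.1 p.2) : Primrec fun a => (f a).map (g a) :=
  Primrec.list_map hf hg

@[fun_prop] theorem primrec_flatMap {f : α → List β} {g : α → β → List σ} (hf : Primrec f)
    (hg : Primrec fun p : α × β => g p.1 p.2) : Primrec fun a => (f a).flatMap (g a) :=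
  Primrec.list_flatMap hf hg

@[fun_prop] theorem primrec_foldl {f : α → List β} {g : α → σ} {h : α → σ → β → σ}
    (hf : Primrec f) (hg : Primrec g) (hh : Primrec fun p : α × σ × β => h p.1 p.2.1 p.2.2) :
    Primrec fun a => (f a).foldl (h a) (g a) :=
  Primrec.list_foldl (h := fun a p => h a p.1 p.2) hf hg hh

@[fun_prop] theorem primrec_foldr {f : α → List β} {g : α → σ} {h : α → β → σ → σ}
    (hf : Primrec f) (hg : Primrec g) (hh : Primrec fun p : α × β × σ => h p.1 p.2.1 p.2.2) :
    Primrec fun a => (f a).foldr (h a) (g a) :=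
  Primrec.list_foldr (h := fun a p => h a p.1 p.2) hf hg hh

@[fun_prop] theorem primrec_lookup [inst : BEq β] [LawfulBEq β] {f : α → β} {g : α → List (β × σ)}
    (hf : Primrec f) (hg : Primrec g) : Primrec fun a => (g a).lookup (f a) := by
  let := instDecidableEqOfLawfulBEq (α := β)
  rw [lawful_beq_subsingleton inst instBEqOfDecidableEq]
  exact Primrec.listLookup.comp hf hg

@[fun_prop] theorem primrec_some {f : α → β} (hf : Primrec f) : Primrec fun a => some (f a) :=
  Primrec.option_some.comp hf

@[fun_prop] theorem primrec_optionGetD {f : α → Option β} {g : α → β} (hf : Primrec f)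
    (hg : Primrec g) : Primrec fun a => (f a).getD (g a) := Primrec.option_getD.comp hf hg

@[fun_prop] theorem primrec_elim {f : α → Option β} {g : α → σ} {h : α → β → σ} (hf : Primrec f)
    (hg : Primrec g) (hh : Primrec fun p : α × β => h p.1 p.2) :
    Primrec fun a => (f a).elim (g a) (h a) :=
  (Primrec.option_casesOn (f := g) (g := h) hf hg hh).of_eq fun a => by cases f a <;> rfl

@[fun_prop] theorem primrec_ite {c : α → Prop} [DecidablePred c] {f g : α → σ}
    (hc : Primrec fun a => decide (c a)) (hf : Primrec f) (hg : Primrec g) :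
    Primrec fun a => if c a then f a else g a := Primrec.ite hc.primrecPred hf hg

@[fun_prop] theorem primrec_decide_eq [DecidableEq β] {f g : α → β} (hf : Primrec f)
    (hg : Primrec g) : Primrec fun a => decide (f a = g a) := (Primrec.eq.comp hf hg).decide

@[fun_prop] theorem primrec_decide_lt {f g : α → ℕ} (hf : Primrec f) (hg : Primrec g) :
    Primrec fun a => decide (f a < g a) := (Primrec.nat_lt.comp hf hg).decide

@[fun_prop] theorem primrec_decide_le {f g : α → ℕ} (hf : Primrec f) (hg : Primrec g) :
    Primrec fun a => decide (f a ≤ g a) := (Primrec.nat_le.comp hf hg).decide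

@[fun_prop] theorem primrec_decide_and {p q : α → Prop} [DecidablePred p] [DecidablePred q]
    (hp : Primrec fun a => decide (p a)) (hq : Primrec fun a => decide (q a)) :
    Primrec fun a => decide (p a ∧ q a) := (hp.primrecPred.and hq.primrecPred).decide

@[fun_prop] theorem primrec_decide_or {p q : α → Prop} [DecidablePred p] [DecidablePred q]
    (hp : Primrec fun a => decide (p a)) (hq : Primrec fun a => decide (q a)) :
    Primrec fun a => decide (p a ∨ q a) := (hp.primrecPred.or hq.primrecPred).decide

@[fun_prop] theorem primrec_decide_not {p : α → Prop} [DecidablePred p]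
    (hp : Primrec fun a => decide (p a)) : Primrec fun a => decide (¬ p a) :=
  hp.primrecPred.not.decide

theorem primrec_filter_aux {f : α → List β} {p : α → β → Prop} [∀ a, DecidablePred (p a)]
    (hf : Primrec f) (hp : Primrec fun x : α × β => decide (p x.1 x.2)) :
    Primrec fun a => (f a).filter (p a ·) := by
  have : Primrec fun a => (f a).flatMap fun b => if p a b then [b] else [] := by fun_prop
  refine this.of_eq fun a => ?_
  induction f a with
  | nil => rfl
  | cons b l ih => by_cases h : p a b <;> simp [h, ih]

@[fun_prop] theorem primrec_filter {f : α → List β} {p : α → β → Bool} (hf : Primrec f)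
    (hp : Primrec fun x : α × β => p x.1 x.2) : Primrec fun a => (f a).filter (p a) := by
  have := primrec_filter_aux (p := fun a b => p a b = true) hf (by simpa using hp)
  simpa using this

@[fun_prop] theorem primrec_decide_mem [DecidableEq β] {f : α → β} {g : α → List β}
    (hf : Primrec f) (hg : Primrec g) : Primrec fun a => decide (f a ∈ g a) := by
  have : Primrec fun a => decide (¬ ((g a).filter fun b => decide (b = f a)) = []) := by fun_prop
  refine this.of_eq fun a => ?_
  simp

@[fun_prop] theorem primrec_all {f : α → List β} {p : α → β → Bool} (hf : Primrec f)
    (hp : Primrec fun x : α × β => p x.1 x.2) : Primrec fun a => (f a).all (p a) := by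
  have hn : Primrec fun x : α × β => !p x.1 x.2 := Primrec.not.comp hp
  have : Primrec fun a => decide (((f a).filter fun b => !p a b).length = 0) := by fun_prop
  refine this.of_eq fun a => ?_
  rw [Bool.eq_iff_iff]
  simp

end Primrec

/-! ### Recursion on codes -/

theorem mem_ofNat_lt {x m : ℕ} (h : x ∈ Denumerable.ofNat (List ℕ) m) : x < m := by
  have key : ∀ l : List ℕ, x ∈ l → x < Encodable.encode l := by
    intro l
    induction l with
    | nil => simp
    | cons a l ih =>
      intro h
      rw [Encodable.encode_list_cons]
      rcases List.mem_cons.1 h with rfl | h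
      · exact Nat.lt_succ_of_le (Nat.left_le_pair _ _)
      · exact Nat.lt_succ_of_le ((ih h).le.trans (Nat.right_le_pair _ _))
  simpa using key _ h

/-- The codes of the immediate subterms. -/
def tmChildren (c : ℕ) : List ℕ :=
  if c.unpair.1 = 2 then Denumerable.ofNat (List ℕ) c.unpair.2.unpair.2 else []

/-- The codes of the immediate subformulas. -/
def fmChildren (c : ℕ) : List ℕ :=
  if c.unpair.1 = 2 ∨ c.unpair.1 = 6 ∨ c.unpair.1 = 7 then [c.unpair.2]
  else if c.unpair.1 = 3 ∨ c.unpair.1 = 4 ∨ c.unpair.1 = 5 then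
    [c.unpair.2.unpair.1, c.unpair.2.unpair.2]
  else if c.unpair.1 = 8 then [c.unpair.2.unpair.1] else []

theorem tmChildren_lt (c : ℕ) : ∀ x ∈ tmChildren c, x < c := by
  intro x hx
  unfold tmChildren at hx
  split at hx
  · exact (mem_ofNat_lt hx).trans_le ((Nat.unpair_right_le _).trans (Nat.unpair_right_le _))
  · simp at hx

theorem fmChildren_lt (c : ℕ) : ∀ x ∈ fmChildren c, x < c := by
  intro x hx
  have h := Nat.add_le_pair c.unpair.1 c.unpair.2
  rw [Nat.pair_unpair] at h
  have h₁ := Nat.unpair_left_le c.unpair.2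
  have h₂ := Nat.unpair_right_le c.unpair.2
  unfold fmChildren at hx
  split_ifs at hx <;> simp at hx <;> omega

@[fun_prop] theorem tmChildren_primrec : Primrec tmChildren := by
  unfold tmChildren
  fun_prop

@[fun_prop] theorem fmChildren_primrec : Primrec fmChildren := by
  unfold fmChildren
  fun_prop

section Fold

variable {α σ : Type*} [Primcodable α] [Primcodable σ]

/-- Recursion on codes, along the immediate constituents `children c < c` of a code `c`. -/
def codeFold {σ : Type*} (children : ℕ → List ℕ) (hc : ∀ c, ∀ x ∈ children c, x < c)
    (node : ℕ → List σ → σ) (c : ℕ) : σ :=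
  node c ((children c).attach.map fun x => codeFold children hc node x.1)
termination_by c
decreasing_by exact hc c _ x.2

theorem codeFold_eq {σ : Type*} (children : ℕ → List ℕ) (hc : ∀ c, ∀ x ∈ children c, x < c)
    (node : ℕ → List σ → σ) (c : ℕ) :
    codeFold children hc node c = node c ((children c).map (codeFold children hc node)) := by
  rw [codeFold]
  congr 1
  exact List.attach_map_val (l := children c) (f := codeFold children hc node)

/-- Recursion on codes is a course-of-values recursion, hence primitive recursive, also uniformly in
a parameter of the step. -/
theorem codeFold_primrec {children : ℕ → List ℕ} (hc : ∀ c, ∀ x ∈ children c, x < c)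
    {node : α → ℕ → List σ → σ} (hp : Primrec children)
    (hn : Primrec fun p : α × ℕ × List σ => node p.1 p.2.1 p.2.2) :
    Primrec fun p : α × ℕ => codeFold children hc (node p.1) p.2 := by
  refine Primrec.nat_omega_rec (fun a c => codeFold children hc (node a) c) (m := fun _ c => c)
    (l := fun _ c => children c) (g := fun a p => some (node a p.1 p.2)) Primrec.snd ?_ ?_
    (fun a c x hx => hc c x hx) fun a c => by rw [codeFold_eq children hc (node a) c]
  · exact hp.comp Primrec.snd
  · exact Primrec.option_some.comp hn

end Fold
end RTC

namespace RTC
variable {L : FirstOrder.Language.{u, v}}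

/-! ### Substitution and free variables on codes -/

/-- The action on the codes of variables of a substitution: `σ.1` lists codes of variables and of
the terms to put in their place; the remaining slots move down by `σ.2`.  As the codes do not depend
on the binding depth, the same action describes the extension of the substitution under binders. -/
def leafCode (σ : List (ℕ × ℕ) × ℕ) (c : ℕ) : ℕ :=
  (σ.1.lookup c).getD (if c.unpair.1 = 1 then Nat.pair 1 (c.unpair.2 - σ.2) else c)

/-- The step of `tmSub`. -/
def tmSubNode (σ : List (ℕ × ℕ) × ℕ) (c : ℕ) (vs : List ℕ) : ℕ :=
  if c.unpair.1 = 2 then Nat.pair 2 (Nat.pair c.unpair.2.unpair.1 (Encodable.encode vs))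
  else leafCode σ c

/-- Substitution on codes of terms. -/
def tmSub (σ : List (ℕ × ℕ) × ℕ) : ℕ → ℕ :=
  codeFold tmChildren tmChildren_lt (tmSubNode σ)

/-- The step of `fmSub`. -/
def fmSubNode (σ : List (ℕ × ℕ) × ℕ) (c : ℕ) (vs : List ℕ) : ℕ :=
  if c.unpair.1 = 0 then
    Nat.pair 0 (Nat.pair (tmSub σ c.unpair.2.unpair.1) (tmSub σ c.unpair.2.unpair.2))
  else if c.unpair.1 = 1 then
    Nat.pair 1 (Nat.pair c.unpair.2.unpair.1 (Encodable.encode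
      ((Denumerable.ofNat (List ℕ) c.unpair.2.unpair.2).map fun x => tmSub σ x)))
  else if c.unpair.1 = 8 then
    Nat.pair 8 (Nat.pair (vs.getD 0 0) (Nat.pair (tmSub σ c.unpair.2.unpair.2.unpair.1)
      (tmSub σ c.unpair.2.unpair.2.unpair.2)))
  else if c.unpair.1 = 3 ∨ c.unpair.1 = 4 ∨ c.unpair.1 = 5 then
    Nat.pair c.unpair.1 (Nat.pair (vs.getD 0 0) (vs.getD 1 0))
  else Nat.pair c.unpair.1 (vs.getD 0 0)

/-- Substitution on codes of formulas. -/
def fmSub (σ : List (ℕ × ℕ) × ℕ) : ℕ → ℕ :=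
  codeFold fmChildren fmChildren_lt (fmSubNode σ)

/-- The step of `tmVars`. -/
def tmVarsNode (c : ℕ) (vs : List (List ℕ)) : List ℕ :=
  if c.unpair.1 = 2 then vs.flatten else if c.unpair.1 = 0 then [c.unpair.2] else []

/-- The free variables in a code of a term. -/
def tmVars : ℕ → List ℕ :=
  codeFold tmChildren tmChildren_lt tmVarsNode

/-- The step of `fmVars`. -/
def fmVarsNode (c : ℕ) (vs : List (List ℕ)) : List ℕ :=
  if c.unpair.1 = 0 then tmVars c.unpair.2.unpair.1 ++ tmVars c.unpair.2.unpair.2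
  else if c.unpair.1 = 1 then
    (Denumerable.ofNat (List ℕ) c.unpair.2.unpair.2).flatMap tmVars
  else if c.unpair.1 = 8 then
    vs.flatten ++ tmVars c.unpair.2.unpair.2.unpair.1 ++ tmVars c.unpair.2.unpair.2.unpair.2
  else vs.flatten

/-- The free variables in a code of a formula. -/
def fmVars : ℕ → List ℕ :=
  codeFold fmChildren fmChildren_lt fmVarsNode

section Primrec

variable {α : Type*} [Primcodable α]

@[fun_prop] theorem leafCode_primrec {f : α → List (ℕ × ℕ) × ℕ} {g : α → ℕ} (hf : Primrec f)
    (hg : Primrec g) : Primrec fun a => leafCode (f a) (g a) := by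
  unfold leafCode
  fun_prop

@[fun_prop] theorem tmSub_primrec {f : α → List (ℕ × ℕ) × ℕ} {g : α → ℕ} (hf : Primrec f)
    (hg : Primrec g) : Primrec fun a => tmSub (f a) (g a) := by
  have : Primrec fun p : (List (ℕ × ℕ) × ℕ) × ℕ × List ℕ => tmSubNode p.1 p.2.1 p.2.2 := by
    unfold tmSubNode
    fun_prop
  exact ((codeFold_primrec (node := tmSubNode) tmChildren_lt tmChildren_primrec this).comp
    (hf.pair hg)).of_eq fun _ => rfl

@[fun_prop] theorem fmSub_primrec {f : α → List (ℕ × ℕ) × ℕ} {g : α → ℕ} (hf : Primrec f)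
    (hg : Primrec g) : Primrec fun a => fmSub (f a) (g a) := by
  have : Primrec fun p : (List (ℕ × ℕ) × ℕ) × ℕ × List ℕ => fmSubNode p.1 p.2.1 p.2.2 := by
    unfold fmSubNode
    fun_prop
  exact ((codeFold_primrec (node := fmSubNode) fmChildren_lt fmChildren_primrec this).comp
    (hf.pair hg)).of_eq fun _ => rfl

@[fun_prop] theorem tmVars_primrec : Primrec tmVars := by
  have : Primrec fun p : Unit × ℕ × List (List ℕ) => tmVarsNode p.2.1 p.2.2 := by
    unfold tmVarsNode
    fun_prop
  exact ((codeFold_primrec (node := fun _ => tmVarsNode) tmChildren_lt tmChildren_primrec this).comp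
    ((Primrec.const ()).pair Primrec.id)).of_eq fun _ => rfl

@[fun_prop] theorem fmVars_primrec : Primrec fmVars := by
  have : Primrec fun p : Unit × ℕ × List (List ℕ) => fmVarsNode p.2.1 p.2.2 := by
    unfold fmVarsNode
    fun_prop
  exact ((codeFold_primrec (node := fun _ => fmVarsNode) fmChildren_lt fmChildren_primrec this).comp
    ((Primrec.const ()).pair Primrec.id)).of_eq fun _ => rfl

end Primrec

theorem pair_beq (a b c d : ℕ) : (Nat.pair a b == Nat.pair c d) = decide (a = c ∧ b = d) := by
  rw [beq_eq_decide]
  exact decide_eq_decide.2 Nat.pair_eq_pair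

section Code

variable [∀ n, Encodable (L.Functions n)]

theorem tmCode_var_ne {n : ℕ} (a : ℕ ⊕ Fin n) :
    (tmCode (.var a : Tm L n)).unpair.1 ≠ 2 := by
  rcases a with x | i <;> simp [tmCode]

@[simp] theorem tmChildren_func {n k : ℕ} (f : L.Functions k) (ts : Fin k → Tm L n) :
    tmChildren (tmCode (.func f ts : Tm L n)) = List.ofFn fun i => tmCode (ts i) := by
  simp [tmChildren, tmCode]

theorem tmSub_code {m n : ℕ} {σ : List (ℕ × ℕ) × ℕ} {τ : ℕ ⊕ Fin m → Tm L n}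
    (h : ∀ a, leafCode σ (tmCode (.var a : Tm L m)) = tmCode (τ a)) (t : Tm L m) :
    tmSub σ (tmCode t) = tmCode (t.subst τ) := by
  induction t with
  | var a =>
    rw [tmSub, codeFold_eq, tmSubNode, if_neg (tmCode_var_ne a), h]
    rfl
  | func f ts ih =>
    rw [tmSub, codeFold_eq, tmSubNode, ← tmSub, tmChildren_func, List.map_ofFn]
    simp only [Function.comp_def, ih]
    simp [tmCode, FirstOrder.Language.Term.subst]

theorem tmCode_shift {n : ℕ} (t : Tm L n) : tmCode (shift t) = tmCode t := by
  induction t with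
  | var a => rcases a with x | i <;> rfl
  | func f ts ih =>
    simp only [shift, FirstOrder.Language.Term.relabel, tmCode] at ih ⊢
    simp only [ih]

theorem mem_tmVars {n : ℕ} {x : ℕ} (t : Tm L n) :
    x ∈ tmVars (tmCode t) ↔ x ∈ t.varFinsetLeft := by
  induction t with
  | var a =>
    rw [tmVars, codeFold_eq, tmVarsNode]
    rcases a with y | i <;> simp [tmCode, FirstOrder.Language.Term.varFinsetLeft]
  | func f ts ih =>
    rw [tmVars, codeFold_eq, tmVarsNode, ← tmVars, tmChildren_func, List.map_ofFn]
    simp [tmCode, FirstOrder.Language.Term.varFinsetLeft, List.mem_ofFn, ih]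

theorem leafCode_lift {m n : ℕ} {σ : List (ℕ × ℕ) × ℕ} {τ : ℕ ⊕ Fin m → Tm L n}
    (h : ∀ a, leafCode σ (tmCode (.var a : Tm L m)) = tmCode (τ a))
    (hs : leafCode σ (Nat.pair 1 m) = Nat.pair 1 n) (a : ℕ ⊕ Fin (m + 1)) :
    leafCode σ (tmCode (.var a : Tm L (m + 1))) = tmCode (lift τ a) := by
  rcases a with x | i
  · rw [lift_inl, tmCode_shift, ← h]; rfl
  · induction i using Fin.lastCases with
    | last => rw [lift_last]; exact hs
    | cast i => rw [lift_castSucc, tmCode_shift, ← h]; rfl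

variable [∀ n, Encodable (L.Relations n)]

/-- Substitution on codes is correct if it is so on variables and slots: `h` says this at the depth
`m`, and `hs` for the slots that are bound further inside. -/
theorem fmSub_code {m n : ℕ} {σ : List (ℕ × ℕ) × ℕ} {τ : ℕ ⊕ Fin m → Tm L n}
    (h : ∀ a, leafCode σ (tmCode (.var a : Tm L m)) = tmCode (τ a))
    (hs : ∀ k, leafCode σ (Nat.pair 1 (m + k)) = Nat.pair 1 (n + k)) (φ : Fml L m) :
    fmSub σ φ.code = (φ.bind τ).code := by
  induction φ generalizing n with
  | eq s t =>
    rw [fmSub, codeFold_eq, fmSubNode]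
    simp [Fml.code, Fml.bind, tmSub_code h]
  | rel R ts =>
    rw [fmSub, codeFold_eq, fmSubNode]
    simp [Fml.code, Fml.bind, tmSub_code h, Function.comp_def]
  | neg φ ih =>
    have := ih h hs
    rw [fmSub, codeFold_eq, fmSubNode, ← fmSub]
    simp [Fml.code, Fml.bind, fmChildren, this]
  | and φ ψ ih₁ ih₂ | or φ ψ ih₁ ih₂ | imp φ ψ ih₁ ih₂ =>
    have h₁ := ih₁ h hs
    have h₂ := ih₂ h hs
    rw [fmSub, codeFold_eq, fmSubNode, ← fmSub]
    simp [Fml.code, Fml.bind, fmChildren, h₁, h₂]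
  | all φ ih | ex φ ih =>
    have := ih (leafCode_lift h (hs 0)) fun k => by
      rw [add_assoc, add_assoc, add_comm 1 k]; exact hs (k + 1)
    rw [fmSub, codeFold_eq, fmSubNode, ← fmSub]
    simp [Fml.code, Fml.bind, fmChildren, this]
  | rtc φ s t ih =>
    have := ih (leafCode_lift (leafCode_lift h (hs 0)) (hs 1)) fun k => by
      rw [show n + 1 + 1 + k = n + (k + 2) by omega, add_assoc, add_comm 2 k]
      exact hs (k + 2)
    rw [fmSub, codeFold_eq, fmSubNode, ← fmSub]
    simp [Fml.code, Fml.bind, fmChildren, tmSub_code h, this]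

theorem code_inst (φ : Fml L 1) (t : Term₀ L) :
    (φ.inst t).code = fmSub ([(Nat.pair 1 0, tmCode t)], 1) φ.code := by
  refine (fmSub_code (fun a => ?_) (fun k => ?_) φ).symm
  · rcases a with x | i
    · simp [leafCode, tmCode, List.lookup, pair_beq]
    · obtain rfl : i = 0 := Subsingleton.elim _ _
      simp [leafCode, tmCode, List.lookup]
  · simp [leafCode, List.lookup, pair_beq, Nat.add_comm]

theorem code_inst₂ (φ : Fml L 2) (r t : Term₀ L) :
    (φ.inst₂ r t).code =
      fmSub ([(Nat.pair 1 0, tmCode r), (Nat.pair 1 1, tmCode t)], 2) φ.code := by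
  refine (fmSub_code (fun a => ?_) (fun k => ?_) φ).symm
  · rcases a with x | i
    · simp [leafCode, tmCode, List.lookup, pair_beq]
    · fin_cases i <;> simp [leafCode, tmCode, List.lookup, pair_beq]
  · have : 2 + k ≠ 1 := by omega
    simp [leafCode, List.lookup, pair_beq, this]

theorem code_subst₁ (φ : Formula₀ L) (x : ℕ) (t : Term₀ L) :
    (φ.subst₁ x t).code = fmSub ([(Nat.pair 0 x, tmCode t)], 0) φ.code := by
  rw [subst₁_eq]
  refine (fmSub_code (fun a => ?_) (fun k => ?_) φ).symm
  · rcases a with y | i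
    · by_cases h : y = x
      · subst h
        rw [single_self]
        simp [leafCode, tmCode, List.lookup]
      · rw [single_of_ne _ h]
        simp [leafCode, tmCode, List.lookup, pair_beq, h]
    · exact i.elim0
  · simp [leafCode, List.lookup, pair_beq]

theorem mem_fmVars {n : ℕ} {x : ℕ} (φ : Fml L n) : x ∈ fmVars φ.code ↔ x ∈ φ.fv := by
  induction φ with
  | eq s t =>
    rw [fmVars, codeFold_eq, fmVarsNode]
    simp [Fml.code, Fml.fv, mem_tmVars]
  | rel R ts =>
    rw [fmVars, codeFold_eq, fmVarsNode]
    simp [Fml.code, Fml.fv, List.mem_ofFn, mem_tmVars]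
  | neg φ ih | all φ ih | ex φ ih =>
    rw [fmVars, codeFold_eq, fmVarsNode, ← fmVars]
    simp [Fml.code, Fml.fv, fmChildren, ih]
  | and φ ψ ih₁ ih₂ | or φ ψ ih₁ ih₂ | imp φ ψ ih₁ ih₂ =>
    rw [fmVars, codeFold_eq, fmVarsNode, ← fmVars]
    simp [Fml.code, Fml.fv, fmChildren, ih₁, ih₂]
  | rtc φ s t ih =>
    rw [fmVars, codeFold_eq, fmVarsNode, ← fmVars]
    simp [Fml.code, Fml.fv, fmChildren, mem_tmVars, ih]

end Code
end RTC

namespace RTC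
variable {L : FirstOrder.Language.{u, v}}

/-! ### Recognizing codes -/

/-- A fact, restated under `n` binders: the demand `j = 0` becomes `j - n = 0`, that is, `j ≤ n`. -/
def lowerFact (n f : ℕ) : ℕ :=
  if f.unpair.1 = 2 then Nat.pair 2 (f.unpair.2 - n) else f

/-- The demand that the argument list `l` of the symbol `h` has the right length. -/
def lengthFact (h : ℕ) (l : List ℕ) : List ℕ :=
  if l.length = h.unpair.1 then [] else [Nat.pair 3 0]

/-- The step of `tmFacts`. -/
def tmFactsNode (c : ℕ) (vs : List (List ℕ)) : List ℕ :=
  if c.unpair.1 = 0 then []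
  else if c.unpair.1 = 1 then [Nat.pair 2 (c.unpair.2 + 1)]
  else if c.unpair.1 = 2 then
    Nat.pair 0 c.unpair.2.unpair.1 ::
      (lengthFact c.unpair.2.unpair.1 (Denumerable.ofNat (List ℕ) c.unpair.2.unpair.2) ++
        vs.flatten)
  else [Nat.pair 3 0]

/-- The facts on which it depends whether `c` is the code of a term.  A fact is the number
`Nat.pair 0 h` if `h` has to number a function symbol, `Nat.pair 1 h` if `h` has to number a
predicate symbol, `Nat.pair 2 j` if `j` has to be `0` (slot `i` contributes `i + 1`, so that its
fact holds under `n` binders if `i < n`) and anything else if the code is ill-formed. -/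
def tmFacts : ℕ → List ℕ := codeFold tmChildren tmChildren_lt tmFactsNode

/-- The step of `fmFacts`. -/
def fmFactsNode (c : ℕ) (vs : List (List ℕ)) : List ℕ :=
  if c.unpair.1 = 0 then tmFacts c.unpair.2.unpair.1 ++ tmFacts c.unpair.2.unpair.2
  else if c.unpair.1 = 1 then
    Nat.pair 1 c.unpair.2.unpair.1 ::
      (lengthFact c.unpair.2.unpair.1 (Denumerable.ofNat (List ℕ) c.unpair.2.unpair.2) ++
        (Denumerable.ofNat (List ℕ) c.unpair.2.unpair.2).flatMap tmFacts)
  else if c.unpair.1 = 6 ∨ c.unpair.1 = 7 then vs.flatten.map fun f => lowerFact 1 f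
  else if c.unpair.1 = 8 then
    (vs.flatten.map fun f => lowerFact 2 f) ++
      (tmFacts c.unpair.2.unpair.2.unpair.1 ++ tmFacts c.unpair.2.unpair.2.unpair.2)
  else if c.unpair.1 ≤ 5 then vs.flatten
  else [Nat.pair 3 0]

/-- The facts on which it depends whether `c` is the code of a formula. -/
def fmFacts : ℕ → List ℕ := codeFold fmChildren fmChildren_lt fmFactsNode

section Primrec

variable {α : Type*} [Primcodable α]

@[fun_prop] theorem lowerFact_primrec {f g : α → ℕ} (hf : Primrec f) (hg : Primrec g) :
    Primrec fun a => lowerFact (f a) (g a) := by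
  unfold lowerFact
  fun_prop

@[fun_prop] theorem lengthFact_primrec {f : α → ℕ} {g : α → List ℕ} (hf : Primrec f)
    (hg : Primrec g) : Primrec fun a => lengthFact (f a) (g a) := by
  unfold lengthFact
  fun_prop

@[fun_prop] theorem tmFacts_primrec : Primrec tmFacts := by
  have : Primrec fun p : Unit × ℕ × List (List ℕ) => tmFactsNode p.2.1 p.2.2 := by
    unfold tmFactsNode
    fun_prop
  exact ((codeFold_primrec (node := fun _ => tmFactsNode) tmChildren_lt tmChildren_primrec
    this).comp ((Primrec.const ()).pair Primrec.id)).of_eq fun _ => rfl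

@[fun_prop] theorem fmFacts_primrec : Primrec fmFacts := by
  have : Primrec fun p : Unit × ℕ × List (List ℕ) => fmFactsNode p.2.1 p.2.2 := by
    unfold fmFactsNode
    fun_prop
  exact ((codeFold_primrec (node := fun _ => fmFactsNode) fmChildren_lt fmChildren_primrec
    this).comp ((Primrec.const ()).pair Primrec.id)).of_eq fun _ => rfl

end Primrec

theorem lowerFact_lowerFact (m n f : ℕ) : lowerFact m (lowerFact n f) = lowerFact (m + n) f := by
  by_cases h : f.unpair.1 = 2
  · simp [lowerFact, h, Nat.sub_sub, Nat.add_comm]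
  · simp [lowerFact, h]

section Valid

variable [∀ n, Encodable (L.Functions n)]

theorem exists_args {n k : ℕ} {l : List ℕ} (hl : l.length = k)
    (h : ∀ x ∈ l, ∃ t : Tm L n, tmCode t = x) :
    ∃ ts : Fin k → Tm L n, (List.ofFn fun i => tmCode (ts i)) = l := by
  subst hl
  choose ts hts using fun i : Fin l.length => h _ (l.get_mem i)
  refine ⟨ts, ?_⟩
  simp [hts]

variable [∀ n, Encodable (L.Relations n)]

variable (L) in
/-- The number `e` is that of a `k`-ary function symbol. -/
def FunctionNumber (k e : ℕ) : Prop := ∃ g : L.Functions k, Encodable.encode g = e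

variable (L) in
/-- The number `e` is that of a `k`-ary predicate symbol. -/
def RelationNumber (k e : ℕ) : Prop := ∃ R : L.Relations k, Encodable.encode R = e

variable (L) in
/-- The meaning of a fact. -/
def FactHolds (f : ℕ) : Prop :=
  (f.unpair.1 = 0 ∧ FunctionNumber L f.unpair.2.unpair.1 f.unpair.2.unpair.2) ∨
  (f.unpair.1 = 1 ∧ RelationNumber L f.unpair.2.unpair.1 f.unpair.2.unpair.2) ∨
  f.unpair.1 = 2 ∧ f.unpair.2 = 0

variable (L) in
/-- All of the facts hold, at depth `n`. -/
def FactsHold (n : ℕ) (l : List ℕ) : Prop := ∀ f ∈ l, FactHolds L (lowerFact n f)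

@[simp] theorem factsHold_nil (n : ℕ) : FactsHold L n [] := by simp [FactsHold]

@[simp] theorem factsHold_append {n : ℕ} {l l' : List ℕ} :
    FactsHold L n (l ++ l') ↔ FactsHold L n l ∧ FactsHold L n l' := by
  simp [FactsHold, or_imp, forall_and]

@[simp] theorem factsHold_cons {n f : ℕ} {l : List ℕ} :
    FactsHold L n (f :: l) ↔ FactHolds L (lowerFact n f) ∧ FactsHold L n l := by
  simp [FactsHold]

theorem factsHold_flatten {n : ℕ} {l : List (List ℕ)} :
    FactsHold L n l.flatten ↔ ∀ x ∈ l, FactsHold L n x := by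
  simp only [FactsHold, List.mem_flatten]
  exact ⟨fun h x hx f hf => h f ⟨x, hx, hf⟩, fun h f ⟨x, hx, hf⟩ => h x hx f hf⟩

theorem factsHold_flatMap {n : ℕ} {l : List ℕ} {F : ℕ → List ℕ} :
    FactsHold L n (l.flatMap F) ↔ ∀ x ∈ l, FactsHold L n (F x) := by
  simp only [FactsHold, List.mem_flatMap]
  exact ⟨fun h x hx f hf => h f ⟨x, hx, hf⟩, fun h f ⟨x, hx, hf⟩ => h x hx f hf⟩

@[simp] theorem factsHold_lower {m n : ℕ} {l : List ℕ} :
    FactsHold L n (l.map fun f => lowerFact m f) ↔ FactsHold L (n + m) l := by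
  simp [FactsHold, lowerFact_lowerFact]

@[simp] theorem factHolds_bad (n : ℕ) : ¬ FactHolds L (lowerFact n (Nat.pair 3 0)) := by
  simp [FactHolds, lowerFact]

theorem factHolds_function (n h : ℕ) : FactHolds L (lowerFact n (Nat.pair 0 h)) ↔
    FunctionNumber L h.unpair.1 h.unpair.2 := by
  simp [FactHolds, lowerFact]

theorem factHolds_relation (n h : ℕ) : FactHolds L (lowerFact n (Nat.pair 1 h)) ↔
    RelationNumber L h.unpair.1 h.unpair.2 := by
  simp [FactHolds, lowerFact]

theorem factHolds_slot (n j : ℕ) : FactHolds L (lowerFact n (Nat.pair 2 (j + 1))) ↔ j < n := by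
  simp [FactHolds, lowerFact]
  omega

theorem factsHold_length (n h : ℕ) (l : List ℕ) :
    FactsHold L n (lengthFact h l) ↔ l.length = h.unpair.1 := by
  unfold lengthFact
  split_ifs with hl <;> simp [hl]

theorem factsHold_tmFacts_code {n : ℕ} (t : Tm L n) : FactsHold L n (tmFacts (tmCode t)) := by
  induction t with
  | var a =>
    rw [tmFacts, codeFold_eq, tmFactsNode]
    rcases a with x | i
    · simp [tmCode]
    · simp [tmCode, factHolds_slot]
  | func f ts ih =>
    rw [tmFacts, codeFold_eq, ← tmFacts, tmFactsNode, tmChildren_func]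
    simpa [tmCode, factsHold_length, factHolds_function, factsHold_flatten, List.mem_ofFn, ih]
      using ⟨f, rfl⟩

theorem exists_term_of_factsHold {n c : ℕ} (h : FactsHold L n (tmFacts c)) :
    ∃ t : Tm L n, tmCode t = c := by
  induction c using Nat.strong_induction_on with
  | _ c ih =>
  rw [tmFacts, codeFold_eq, ← tmFacts, tmFactsNode] at h
  split_ifs at h with h0 h1 h2
  · exact ⟨.var (.inl c.unpair.2), by rw [tmCode, ← h0, Nat.pair_unpair]⟩
  · simp only [factsHold_cons, factHolds_slot, factsHold_nil, and_true] at h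
    exact ⟨.var (.inr ⟨c.unpair.2, h⟩), by rw [tmCode]; simp only; rw [← h1, Nat.pair_unpair]⟩
  · simp only [factsHold_cons, factsHold_append, factHolds_function, factsHold_length,
      factsHold_flatten, List.mem_map, forall_exists_index, and_imp,
      forall_apply_eq_imp_iff₂] at h
    obtain ⟨⟨g, hg⟩, hl, hx⟩ := h
    have hch : tmChildren c = Denumerable.ofNat (List ℕ) c.unpair.2.unpair.2 := if_pos h2
    obtain ⟨ts, hts⟩ := exists_args (L := L) (n := n) hl fun x hx' =>
      ih x (tmChildren_lt c x (hch ▸ hx')) (hx x (hch ▸ hx'))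
    refine ⟨.func g ts, ?_⟩
    rw [tmCode, hts, hg, Nat.pair_unpair, Denumerable.encode_ofNat, Nat.pair_unpair, ← h2,
      Nat.pair_unpair]
  · simp at h

/-- Being the code of a term comes down to finitely many facts, which do not depend on the signature
but for the numbers of its symbols. -/
theorem factsHold_tmFacts {n c : ℕ} :
    FactsHold L n (tmFacts c) ↔ ∃ t : Tm L n, tmCode t = c :=
  ⟨exists_term_of_factsHold, by rintro ⟨t, rfl⟩; exact factsHold_tmFacts_code t⟩

theorem factsHold_fmFacts_code {n : ℕ} (φ : Fml L n) : FactsHold L n (fmFacts φ.code) := by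
  induction φ with
  | eq s t =>
    rw [fmFacts, codeFold_eq, fmFactsNode]
    simp [Fml.code, factsHold_tmFacts_code]
  | rel R ts =>
    rw [fmFacts, codeFold_eq, fmFactsNode]
    simpa [Fml.code, factsHold_length, factHolds_relation, factsHold_flatMap, List.mem_ofFn,
      factsHold_tmFacts_code] using ⟨R, rfl⟩
  | neg φ ih | all φ ih | ex φ ih =>
    rw [fmFacts, codeFold_eq, ← fmFacts, fmFactsNode]
    simp [Fml.code, fmChildren, ih]
  | and φ ψ ih₁ ih₂ | or φ ψ ih₁ ih₂ | imp φ ψ ih₁ ih₂ =>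
    rw [fmFacts, codeFold_eq, ← fmFacts, fmFactsNode]
    simp [Fml.code, fmChildren, ih₁, ih₂]
  | rtc φ s t ih =>
    rw [fmFacts, codeFold_eq, ← fmFacts, fmFactsNode]
    simp [Fml.code, fmChildren, ih, factsHold_tmFacts_code]

theorem exists_formula_of_factsHold {n c : ℕ} (h : FactsHold L n (fmFacts c)) :
    ∃ φ : Fml L n, φ.code = c := by
  induction c using Nat.strong_induction_on generalizing n with
  | _ c ih =>
  have hch := fmChildren_lt c
  have hc : Nat.pair c.unpair.1 c.unpair.2 = c := Nat.pair_unpair c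
  have hc' : Nat.pair c.unpair.2.unpair.1 c.unpair.2.unpair.2 = c.unpair.2 := Nat.pair_unpair _
  have htag : c.unpair.1 ≤ 8 := by
    by_contra hlt
    rw [fmFacts, codeFold_eq, fmFactsNode] at h
    simp [show c.unpair.1 ≠ 0 by omega, show c.unpair.1 ≠ 1 by omega,
      show c.unpair.1 ≠ 6 by omega, show c.unpair.1 ≠ 7 by omega,
      show c.unpair.1 ≠ 8 by omega, show ¬ c.unpair.1 ≤ 5 by omega] at h
  rw [fmFacts, codeFold_eq, ← fmFacts, fmFactsNode] at h
  obtain ht | ht | ht | ht | ht | ht | ht | ht | ht : c.unpair.1 = 0 ∨ c.unpair.1 = 1 ∨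
    c.unpair.1 = 2 ∨ c.unpair.1 = 3 ∨ c.unpair.1 = 4 ∨ c.unpair.1 = 5 ∨ c.unpair.1 = 6 ∨
    c.unpair.1 = 7 ∨ c.unpair.1 = 8 := by omega
  all_goals
    rw [ht] at hc
    simp only [fmChildren, ht, OfNat.ofNat_ne_zero, OfNat.ofNat_ne_one,
      one_ne_zero, or_self, or_true, if_true, if_false, Nat.reduceEqDiff, Nat.reduceLeDiff,
      factsHold_append, factsHold_tmFacts, List.map_cons, List.map_nil, List.flatten_cons,
      List.flatten_nil, List.append_nil, List.mem_cons, List.not_mem_nil, or_false,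
      forall_eq_or_imp, forall_eq, factsHold_lower, factsHold_cons, factHolds_relation,
      factsHold_length, factsHold_flatMap] at h hch
  · obtain ⟨⟨s, hs⟩, ⟨t, ht⟩⟩ := h
    exact ⟨.eq s t, by rw [Fml.code, hs, ht, hc', hc]⟩
  · obtain ⟨⟨R, hR⟩, hl, hx⟩ := h
    obtain ⟨ts, hts⟩ := exists_args hl hx
    exact ⟨.rel R ts, by
      rw [Fml.code, hts, hR, Nat.pair_unpair, Denumerable.encode_ofNat, hc', hc]⟩
  · obtain ⟨φ, hφ⟩ := ih _ hch h
    exact ⟨.neg φ, by rw [Fml.code, hφ, hc]⟩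
  · obtain ⟨φ, hφ⟩ := ih _ hch.1 h.1
    obtain ⟨ψ, hψ⟩ := ih _ hch.2 h.2
    exact ⟨.and φ ψ, by rw [Fml.code, hφ, hψ, hc', hc]⟩
  · obtain ⟨φ, hφ⟩ := ih _ hch.1 h.1
    obtain ⟨ψ, hψ⟩ := ih _ hch.2 h.2
    exact ⟨.or φ ψ, by rw [Fml.code, hφ, hψ, hc', hc]⟩
  · obtain ⟨φ, hφ⟩ := ih _ hch.1 h.1
    obtain ⟨ψ, hψ⟩ := ih _ hch.2 h.2
    exact ⟨.imp φ ψ, by rw [Fml.code, hφ, hψ, hc', hc]⟩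
  · obtain ⟨φ, hφ⟩ := ih _ hch h
    exact ⟨.all φ, by rw [Fml.code, hφ, hc]⟩
  · obtain ⟨φ, hφ⟩ := ih _ hch h
    exact ⟨.ex φ, by rw [Fml.code, hφ, hc]⟩
  · obtain ⟨hφ, ⟨s, hs⟩, ⟨t, ht⟩⟩ := h
    obtain ⟨φ, hφ⟩ := ih _ hch hφ
    exact ⟨.rtc φ s t, by rw [Fml.code, hφ, hs, ht, Nat.pair_unpair, hc', hc]⟩

theorem factsHold_fmFacts {n c : ℕ} :
    FactsHold L n (fmFacts c) ↔ ∃ φ : Fml L n, φ.code = c :=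
  ⟨exists_formula_of_factsHold, by rintro ⟨t, rfl⟩; exact factsHold_fmFacts_code t⟩

end Valid
end RTC

namespace RTC
variable {L : FirstOrder.Language.{u, v}}

/-! ### Sequents on codes -/

/-- Insertion into a strictly increasing list. -/
def ins (c : ℕ) (l : List ℕ) : List ℕ :=
  (l.filter fun x => decide (x < c)) ++ c :: l.filter fun x => decide (c < x)

theorem mem_ins {c x : ℕ} {l : List ℕ} : x ∈ ins c l ↔ x = c ∨ x ∈ l := by
  simp only [ins, List.mem_append, List.mem_filter, List.mem_cons, decide_eq_true_eq]
  constructor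
  · rintro (h | h | h)
    exacts [.inr h.1, .inl h, .inr h.1]
  · rintro (h | h)
    · exact .inr (.inl h)
    · rcases lt_trichotomy x c with h' | h' | h'
      exacts [.inl ⟨h, h'⟩, .inr (.inl h'), .inr (.inr ⟨h, h'⟩)]

theorem ins_pairwise {c : ℕ} {l : List ℕ} (h : l.Pairwise (· < ·)) :
    (ins c l).Pairwise (· < ·) := by
  rw [ins, List.pairwise_append, List.pairwise_cons]
  refine ⟨h.filter _, ⟨fun x hx => ?_, h.filter _⟩, fun x hx y hy => ?_⟩
  · simpa using (List.mem_filter.1 hx).2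
  · have h₁ : x < c := by simpa using (List.mem_filter.1 hx).2
    rcases List.mem_cons.1 hy with rfl | hy
    · exact h₁
    · exact h₁.trans (by simpa using (List.mem_filter.1 hy).2)

/-- A sequent, on codes: the codes of the formulas on either side in increasing order. -/
abbrev SeqCode := List ℕ × List ℕ

/-- The code of an open node. -/
def openCode (s : SeqCode) : ℕ :=
  Nat.pair 0 (Nat.pair (Encodable.encode s.1) (Encodable.encode s.2))

/-- The sequent at an open node. -/
def openSeq (c : ℕ) : SeqCode :=
  (Denumerable.ofNat (List ℕ) c.unpair.2.unpair.1, Denumerable.ofNat (List ℕ) c.unpair.2.unpair.2)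

@[simp] theorem openSeq_openCode (s : SeqCode) : openSeq (openCode s) = s := by
  simp [openSeq, openCode]

/-- One more than the largest free variable. -/
def freshVar (l : List ℕ) : ℕ := (l.flatMap fmVars).foldr max 0 + 1

/-! ### Labelled trees on codes -/

/-- A finite tree, on codes: the list of its addresses with the codes of their labels. -/
abbrev Table := List (List ℕ × ℕ)

/-- A node, seen from the parent whose `k`-th child is the root. -/
def under (k : ℕ) (e : List ℕ × ℕ) : List ℕ × ℕ := (k :: e.1, e.2)

/-- Replacement of every open node. -/
def growTable (f : ℕ → Table) (T : Table) : Table :=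
  T.flatMap fun e => if e.2.unpair.1 = 0 then (f e.2).map fun d => (e.1 ++ d.1, d.2) else [e]

/-- The tree `T` followed by weakenings on the right. -/
def weakRTable (A B ds : List ℕ) (T : Table) : Table × List ℕ :=
  ds.foldr (fun c st => (([], Nat.pair 1 (Encodable.encode
    [2, Encodable.encode A, Encodable.encode st.2, c])) :: st.1.map fun e => under 0 e,
    ins c st.2)) (T, B)

/-- The tree `T` followed by weakenings on the left. -/
def weakLTable (A B gs : List ℕ) (T : Table) : Table × List ℕ :=
  gs.foldr (fun c st => (([], Nat.pair 1 (Encodable.encode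
    [1, Encodable.encode st.2, Encodable.encode B, c])) :: st.1.map fun e => under 0 e,
    ins c st.2)) (T, A)

/-- The tree `T` for the sequent with sides `A` and `B`, followed by weakenings. -/
def weakTable (A B gs ds : List ℕ) (T : Table) : Table :=
  (weakLTable A (weakRTable A B ds T).2 gs (weakRTable A B ds T).1).1

/-- Codes of formulas `t = t`. -/
def IsEqRefl (c : ℕ) : Prop := c.unpair.1 = 0 ∧ c.unpair.2.unpair.1 = c.unpair.2.unpair.2

/-- Codes of formulas `(RTC_{x,y} φ)(s, s)`. -/
def IsRtcRefl (c : ℕ) : Prop :=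
  c.unpair.1 = 8 ∧ c.unpair.2.unpair.2.unpair.1 = c.unpair.2.unpair.2.unpair.2

instance : DecidablePred IsEqRefl := fun _ => inferInstanceAs (Decidable (_ ∧ _))

instance : DecidablePred IsRtcRefl := fun _ => inferInstanceAs (Decidable (_ ∧ _))

/-- `close`, on codes. -/
def closeTable (s : SeqCode) : Option Table :=
  (s.1.filter fun c => decide (c ∈ s.2)).head?.elim
    ((s.2.filter fun c => decide (IsEqRefl c)).head?.elim
      ((s.2.filter fun c => decide (IsRtcRefl c)).head?.elim none fun c =>
        some [([], Nat.pair 1 (Encodable.encode [20, Encodable.encode s.1, Encodable.encode s.2,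
          c.unpair.2.unpair.1, c.unpair.2.unpair.2.unpair.1]))])
      fun c => some (weakTable [] [c] s.1 (s.2.filter fun x => decide (x ≠ c))
        [([], Nat.pair 1 (Encodable.encode [17, c.unpair.2.unpair.1]))]))
    fun c => some (weakTable [c] [c] (s.1.filter fun x => decide (x ≠ c))
      (s.2.filter fun x => decide (x ≠ c)) [([], Nat.pair 1 (Encodable.encode [0, c]))])

/-- The code of an inference with sides `s`, and its premises. -/
abbrev RuleCode := ℕ × List SeqCode

/-- The code of an inference whose parameters are its number, its sides, and the list `l`. -/
def infCode (k : ℕ) (s : SeqCode) (l : List ℕ) : ℕ :=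
  Encodable.encode (k :: Encodable.encode s.1 :: Encodable.encode s.2 :: l)

/-- The case rule, on codes. -/
def caseCode (e : List ℕ) (s : SeqCode) : Option RuleCode :=
  if Nat.pair 8 (Nat.pair (e.getD 1 0) (Nat.pair (e.getD 2 0) (e.getD 3 0))) ∈ s.1 ∧
      (s.1.all fun c => decide (c = Nat.pair 8 (Nat.pair (e.getD 1 0) (Nat.pair (e.getD 2 0)
        (e.getD 3 0))) ∨ c ∈ Denumerable.ofNat (List ℕ) (e.getD 6 0))) = true ∧
      (s.2.all fun c => decide (c ∈ Denumerable.ofNat (List ℕ) (e.getD 7 0))) = true then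
    some (infCode 22 s [e.getD 1 0, e.getD 2 0, e.getD 3 0, e.getD 5 0],
      [(ins (Nat.pair 0 (Nat.pair (e.getD 2 0) (e.getD 3 0))) s.1, s.2),
        (ins (Nat.pair 8 (Nat.pair (e.getD 1 0) (Nat.pair (e.getD 2 0) (Nat.pair 0 (e.getD 5 0)))))
          (ins (fmSub ([(Nat.pair 1 0, Nat.pair 0 (e.getD 5 0)), (Nat.pair 1 1, e.getD 3 0)], 2)
            (e.getD 1 0)) s.1), s.2)])
  else none

/-- An equality rule with number `k` and equation `q`, replacing the formula `a` by `b`. -/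
def eqCode (k q a b : ℕ) (e : List ℕ) (s : SeqCode) : Option RuleCode :=
  if q ∈ s.1 ∧
      (s.1.all fun c => decide (c = q ∨ c ∈ Denumerable.ofNat (List ℕ) (e.getD 6 0))) = true ∧
      a ∈ s.2 ∧
      (s.2.all fun c => decide (c = a ∨ c ∈ Denumerable.ofNat (List ℕ) (e.getD 7 0))) = true then
    some (infCode k s [e.getD 1 0, e.getD 2 0, e.getD 3 0, e.getD 4 0], [(s.1, ins b s.2)])
  else none

/-- The equality rules, on codes. -/
def eqRuleCode (e : List ℕ) (s : SeqCode) : Option RuleCode :=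
  if e.getD 5 0 = 0 then
    eqCode 16 (Nat.pair 0 (Nat.pair (e.getD 1 0) (e.getD 2 0)))
      (fmSub ([(Nat.pair 0 (e.getD 3 0), e.getD 1 0)], 0) (e.getD 4 0))
      (fmSub ([(Nat.pair 0 (e.getD 3 0), e.getD 2 0)], 0) (e.getD 4 0)) e s
  else
    eqCode 15 (Nat.pair 0 (Nat.pair (e.getD 1 0) (e.getD 2 0)))
      (fmSub ([(Nat.pair 0 (e.getD 3 0), e.getD 2 0)], 0) (e.getD 4 0))
      (fmSub ([(Nat.pair 0 (e.getD 3 0), e.getD 1 0)], 0) (e.getD 4 0)) e s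

/-- The propositional left rules, on codes. -/
def propLeftCode (e : List ℕ) (s : SeqCode) : Option RuleCode :=
  if e.getD 0 0 = 0 then
    if Nat.pair 2 (e.getD 1 0) ∈ s.1 then
      some (infCode 9 s [e.getD 1 0], [(s.1, ins (e.getD 1 0) s.2)])
    else none
  else if e.getD 0 0 = 1 then
    if Nat.pair 3 (Nat.pair (e.getD 1 0) (e.getD 2 0)) ∈ s.1 then
      some (infCode 5 s [e.getD 1 0, e.getD 2 0],
        [(ins (e.getD 1 0) (ins (e.getD 2 0) s.1), s.2)])
    else none
  else if e.getD 0 0 = 2 then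
    if Nat.pair 4 (Nat.pair (e.getD 1 0) (e.getD 2 0)) ∈ s.1 then
      some (infCode 3 s [e.getD 1 0, e.getD 2 0],
        [(ins (e.getD 1 0) s.1, s.2), (ins (e.getD 2 0) s.1, s.2)])
    else none
  else
    if Nat.pair 5 (Nat.pair (e.getD 1 0) (e.getD 2 0)) ∈ s.1 then
      some (infCode 7 s [e.getD 1 0, e.getD 2 0],
        [(s.1, ins (e.getD 1 0) s.2), (ins (e.getD 2 0) s.1, s.2)])
    else none

/-- The propositional right rules, on codes. -/
def propRightCode (e : List ℕ) (s : SeqCode) : Option RuleCode :=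
  if e.getD 0 0 = 0 then
    if Nat.pair 2 (e.getD 1 0) ∈ s.2 then
      some (infCode 10 s [e.getD 1 0], [(ins (e.getD 1 0) s.1, s.2)])
    else none
  else if e.getD 0 0 = 1 then
    if Nat.pair 3 (Nat.pair (e.getD 1 0) (e.getD 2 0)) ∈ s.2 then
      some (infCode 6 s [e.getD 1 0, e.getD 2 0],
        [(s.1, ins (e.getD 1 0) s.2), (s.1, ins (e.getD 2 0) s.2)])
    else none
  else if e.getD 0 0 = 2 then
    if Nat.pair 4 (Nat.pair (e.getD 1 0) (e.getD 2 0)) ∈ s.2 then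
      some (infCode 4 s [e.getD 1 0, e.getD 2 0],
        [(s.1, ins (e.getD 1 0) (ins (e.getD 2 0) s.2))])
    else none
  else
    if Nat.pair 5 (Nat.pair (e.getD 1 0) (e.getD 2 0)) ∈ s.2 then
      some (infCode 8 s [e.getD 1 0, e.getD 2 0],
        [(ins (e.getD 1 0) s.1, ins (e.getD 2 0) s.2)])
    else none

/-- `leftRule`, on codes. -/
def leftCode (e : List ℕ) (s : SeqCode) : Option RuleCode :=
  if e.getD 0 0 < 4 then propLeftCode e s
  else if e.getD 0 0 = 4 then
    if Nat.pair 6 (e.getD 1 0) ∈ s.1 then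
      some (infCode 13 s [e.getD 1 0, e.getD 2 0],
        [(ins (fmSub ([(Nat.pair 1 0, e.getD 2 0)], 1) (e.getD 1 0)) s.1, s.2)])
    else none
  else if e.getD 0 0 = 5 then
    if Nat.pair 7 (e.getD 1 0) ∈ s.1 then
      some (infCode 11 s [e.getD 1 0, freshVar (s.1 ++ s.2)],
        [(ins (fmSub ([(Nat.pair 1 0, Nat.pair 0 (freshVar (s.1 ++ s.2)))], 1) (e.getD 1 0)) s.1,
          s.2)])
    else none
  else if e.getD 0 0 = 6 then caseCode e s
  else eqRuleCode e s

/-- `rightRule`, on codes. -/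
def rightCode (e : List ℕ) (s : SeqCode) : Option RuleCode :=
  if e.getD 0 0 < 4 then propRightCode e s
  else if e.getD 0 0 = 4 then
    if Nat.pair 6 (e.getD 1 0) ∈ s.2 then
      some (infCode 14 s [e.getD 1 0, freshVar (s.1 ++ s.2)],
        [(s.1, ins (fmSub ([(Nat.pair 1 0, Nat.pair 0 (freshVar (s.1 ++ s.2)))], 1) (e.getD 1 0))
          s.2)])
    else none
  else if e.getD 0 0 = 5 then
    if Nat.pair 7 (e.getD 1 0) ∈ s.2 then
      some (infCode 12 s [e.getD 1 0, e.getD 2 0],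
        [(s.1, ins (fmSub ([(Nat.pair 1 0, e.getD 2 0)], 1) (e.getD 1 0)) s.2)])
    else none
  else if e.getD 0 0 = 6 then
    if Nat.pair 8 (Nat.pair (e.getD 1 0) (Nat.pair (e.getD 2 0) (e.getD 3 0))) ∈ s.2 then
      some (infCode 21 s [e.getD 1 0, e.getD 2 0, e.getD 3 0, e.getD 4 0],
        [(s.1, ins (Nat.pair 8 (Nat.pair (e.getD 1 0) (Nat.pair (e.getD 2 0) (e.getD 4 0)))) s.2),
          (s.1, ins (fmSub ([(Nat.pair 1 0, e.getD 4 0), (Nat.pair 1 1, e.getD 3 0)], 2)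
            (e.getD 1 0)) s.2)])
    else none
  else none

/-- `applyRule`, on codes. -/
def applyTable (s : SeqCode) (o : Option RuleCode) : Table :=
  o.elim [([], openCode s)] fun r => ([], Nat.pair 1 r.1) ::
    (List.range r.2.length).map fun k => ([k], openCode (r.2.getD k ([], [])))

/-- `develop`, on codes. -/
def developTable (e : List ℕ) (c : ℕ) : Table :=
  (closeTable (openSeq c)).elim
    (growTable (fun c' => applyTable (openSeq c') (rightCode e (openSeq c')))
      (applyTable (openSeq c) (leftCode e (openSeq c)))) fun T => T

section Primrec

variable {α : Type*} [Primcodable α]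

@[fun_prop] theorem ins_primrec {f : α → ℕ} {g : α → List ℕ} (hf : Primrec f) (hg : Primrec g) :
    Primrec fun a => ins (f a) (g a) := by
  unfold ins
  fun_prop

@[fun_prop] theorem openCode_primrec : Primrec openCode := by
  unfold openCode
  fun_prop

@[fun_prop] theorem openSeq_primrec : Primrec openSeq := by
  unfold openSeq
  fun_prop

@[fun_prop] theorem freshVar_primrec : Primrec freshVar := by
  unfold freshVar
  fun_prop

@[fun_prop] theorem under_primrec {f : α → ℕ} {g : α → List ℕ × ℕ} (hf : Primrec f)
    (hg : Primrec g) : Primrec fun a => under (f a) (g a) := by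
  unfold under
  fun_prop

@[fun_prop] theorem growTable_primrec {f : α → ℕ → Table} {T : α → Table}
    (hf : Primrec fun p : α × ℕ => f p.1 p.2) (hT : Primrec T) :
    Primrec fun a => growTable (f a) (T a) := by
  unfold growTable
  have : Primrec fun p : α × List ℕ × ℕ => f p.1 p.2.2 :=
    hf.comp (Primrec.fst.pair (Primrec.snd.comp Primrec.snd))
  fun_prop

@[fun_prop] theorem weakRTable_primrec {A B ds : α → List ℕ} {T : α → Table} (hA : Primrec A)
    (hB : Primrec B) (hd : Primrec ds) (hT : Primrec T) :
    Primrec fun a => weakRTable (A a) (B a) (ds a) (T a) := by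
  unfold weakRTable
  fun_prop

@[fun_prop] theorem weakLTable_primrec {A B ds : α → List ℕ} {T : α → Table} (hA : Primrec A)
    (hB : Primrec B) (hd : Primrec ds) (hT : Primrec T) :
    Primrec fun a => weakLTable (A a) (B a) (ds a) (T a) := by
  unfold weakLTable
  fun_prop

@[fun_prop] theorem weakTable_primrec {A B gs ds : α → List ℕ} {T : α → Table} (hA : Primrec A)
    (hB : Primrec B) (hg : Primrec gs) (hd : Primrec ds) (hT : Primrec T) :
    Primrec fun a => weakTable (A a) (B a) (gs a) (ds a) (T a) := by
  unfold weakTable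
  fun_prop

@[fun_prop] theorem isRtcRefl_primrec {f : α → ℕ} (hf : Primrec f) :
    Primrec fun a => decide (IsRtcRefl (f a)) := by
  have : Primrec fun a => decide ((f a).unpair.1 = 8 ∧
      (f a).unpair.2.unpair.2.unpair.1 = (f a).unpair.2.unpair.2.unpair.2) := by fun_prop
  exact this.of_eq fun _ => by congr

@[fun_prop] theorem closeTable_primrec : Primrec closeTable := by
  unfold closeTable
  fun_prop

@[fun_prop] theorem infCode_primrec (k : ℕ) {s : α → SeqCode} {l : α → List ℕ} (hs : Primrec s)
    (hl : Primrec l) : Primrec fun a => infCode k (s a) (l a) := by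
  unfold infCode
  fun_prop

@[fun_prop] theorem caseCode_primrec {e : α → List ℕ} {s : α → SeqCode} (he : Primrec e)
    (hs : Primrec s) : Primrec fun a => caseCode (e a) (s a) := by
  unfold caseCode
  fun_prop

@[fun_prop] theorem eqCode_primrec (k : ℕ) {q a b : α → ℕ} {e : α → List ℕ} {s : α → SeqCode}
    (hq : Primrec q) (ha : Primrec a) (hb : Primrec b) (he : Primrec e) (hs : Primrec s) :
    Primrec fun x => eqCode k (q x) (a x) (b x) (e x) (s x) := by
  unfold eqCode
  fun_prop

@[fun_prop] theorem eqRuleCode_primrec {e : α → List ℕ} {s : α → SeqCode} (he : Primrec e)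
    (hs : Primrec s) : Primrec fun a => eqRuleCode (e a) (s a) := by
  unfold eqRuleCode
  fun_prop

@[fun_prop] theorem propLeftCode_primrec {e : α → List ℕ} {s : α → SeqCode} (he : Primrec e)
    (hs : Primrec s) : Primrec fun a => propLeftCode (e a) (s a) := by
  unfold propLeftCode
  fun_prop

@[fun_prop] theorem propRightCode_primrec {e : α → List ℕ} {s : α → SeqCode} (he : Primrec e)
    (hs : Primrec s) : Primrec fun a => propRightCode (e a) (s a) := by
  unfold propRightCode
  fun_prop

@[fun_prop] theorem leftCode_primrec {e : α → List ℕ} {s : α → SeqCode} (he : Primrec e)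
    (hs : Primrec s) : Primrec fun a => leftCode (e a) (s a) := by
  unfold leftCode
  fun_prop

@[fun_prop] theorem rightCode_primrec {e : α → List ℕ} {s : α → SeqCode} (he : Primrec e)
    (hs : Primrec s) : Primrec fun a => rightCode (e a) (s a) := by
  unfold rightCode
  fun_prop

@[fun_prop] theorem applyTable_primrec {s : α → SeqCode} {o : α → Option RuleCode}
    (hs : Primrec s) (ho : Primrec o) : Primrec fun a => applyTable (s a) (o a) := by
  unfold applyTable
  fun_prop

@[fun_prop] theorem developTable_primrec {e : α → List ℕ} {c : α → ℕ} (he : Primrec e)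
    (hc : Primrec c) : Primrec fun a => developTable (e a) (c a) := by
  unfold developTable
  fun_prop

end Primrec
end RTC

namespace RTC
variable {L : FirstOrder.Language.{u, v}}

section Codes

variable [∀ n, Encodable (L.Functions n)] [∀ n, Encodable (L.Relations n)]

/-! ### The search on codes agrees with the search -/

/-- The codes of the members of a finite set of formulas, in increasing order. -/
def setList (Γ : Finset (Formula₀ L)) : List ℕ := Γ.sort.map Fml.code

@[simp] theorem encode_setList (Γ : Finset (Formula₀ L)) :
    Encodable.encode (setList Γ) = setCode Γ := rfl

theorem mem_setList' {Γ : Finset (Formula₀ L)} {c : ℕ} :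
    c ∈ setList Γ ↔ ∃ φ ∈ Γ, φ.code = c := by
  simp [setList]

@[simp] theorem mem_setList {Γ : Finset (Formula₀ L)} {φ : Formula₀ L} :
    φ.code ∈ setList Γ ↔ φ ∈ Γ := by
  rw [mem_setList']
  exact ⟨fun ⟨ψ, h, e⟩ => Fml.code_injective e ▸ h, fun h => ⟨φ, h, rfl⟩⟩

theorem setList_pairwise (Γ : Finset (Formula₀ L)) : (setList Γ).Pairwise (· < ·) := by
  rw [setList, List.pairwise_map]
  exact (Finset.sortedLT_sort Γ).pairwise

theorem eq_setList {Γ : Finset (Formula₀ L)} {l : List ℕ} (hl : l.Pairwise (· < ·))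
    (h : ∀ c, c ∈ l ↔ ∃ φ ∈ Γ, φ.code = c) : l = setList Γ :=
  hl.eq_of_mem_iff (setList_pairwise Γ) fun c => (h c).trans mem_setList'.symm

@[simp] theorem ins_setList (Γ : Finset (Formula₀ L)) (φ : Formula₀ L) :
    ins φ.code (setList Γ) = setList (insert φ Γ) := by
  refine eq_setList (ins_pairwise (setList_pairwise Γ)) fun c => ?_
  simp [mem_ins, mem_setList', eq_comm]

@[simp] theorem setList_empty : setList (∅ : Finset (Formula₀ L)) = [] := by
  simp [setList]

@[simp] theorem setList_singleton (φ : Formula₀ L) : setList {φ} = [φ.code] := by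
  simp [setList]

theorem setList_erase (Γ : Finset (Formula₀ L)) (φ : Formula₀ L) :
    ((setList Γ).filter fun x => decide (x ≠ φ.code)) = setList (Γ.erase φ) := by
  refine eq_setList ((setList_pairwise Γ).filter _) fun c => ?_
  simp only [List.mem_filter, mem_setList', decide_eq_true_eq, Finset.mem_erase]
  constructor
  · rintro ⟨⟨ψ, h, rfl⟩, h'⟩
    exact ⟨ψ, ⟨fun e => h' (e ▸ rfl), h⟩, rfl⟩
  · rintro ⟨ψ, ⟨h', h⟩, rfl⟩
    exact ⟨⟨ψ, h, rfl⟩, fun e => h' (Fml.code_injective e)⟩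

theorem setList_inter (Γ Δ : Finset (Formula₀ L)) :
    ((setList Γ).filter fun x => decide (x ∈ setList Δ)) = setList (Γ ∩ Δ) := by
  refine eq_setList ((setList_pairwise Γ).filter _) fun c => ?_
  simp only [List.mem_filter, decide_eq_true_eq, Finset.mem_inter]
  constructor
  · rintro ⟨h, h'⟩
    obtain ⟨ψ, h, rfl⟩ := mem_setList'.1 h
    exact ⟨ψ, ⟨mem_setList.1 h, mem_setList.1 h'⟩, rfl⟩
  · rintro ⟨ψ, ⟨h, h'⟩, rfl⟩
    exact ⟨mem_setList.2 h, mem_setList.2 h'⟩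

theorem setList_all_insert (Γ : Finset (Formula₀ L)) (φ : Formula₀ L) (l : List (Formula₀ L)) :
    ((setList Γ).all fun c => decide (c = φ.code ∨ c ∈ l.map Fml.code)) = true ↔
      Γ ⊆ insert φ l.toFinset := by
  simp only [List.all_eq_true, decide_eq_true_eq, Finset.subset_iff, Finset.mem_insert,
    List.mem_toFinset, mem_setList', forall_exists_index, and_imp]
  constructor
  · intro h ψ hψ
    simpa [Fml.code_injective.eq_iff] using h _ ψ hψ rfl
  · rintro h _ ψ hψ rfl
    simpa [Fml.code_injective.eq_iff] using h hψ

theorem setList_all (Γ : Finset (Formula₀ L)) (l : List (Formula₀ L)) :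
    ((setList Γ).all fun c => decide (c ∈ l.map Fml.code)) = true ↔ Γ ⊆ l.toFinset := by
  simp only [List.all_eq_true, decide_eq_true_eq, Finset.subset_iff, List.mem_toFinset,
    mem_setList', forall_exists_index, and_imp]
  constructor
  · intro h ψ hψ
    simpa [Fml.code_injective.eq_iff] using h _ ψ hψ rfl
  · rintro h _ ψ hψ rfl
    simpa [Fml.code_injective.eq_iff] using h hψ

/-- The sequent, on codes. -/
def Sequent.codes (S : Sequent L) : SeqCode := (setList S.left, setList S.right)

@[simp] theorem openCode_codes (S : Sequent L) : openCode S.codes = (Label.opn S).code := rfl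

@[simp] theorem openSeq_code (S : Sequent L) : openSeq (Label.opn S).code = S.codes := by
  rw [← openCode_codes, openSeq_openCode]

theorem le_foldr_max {l : List ℕ} {x : ℕ} (h : x ∈ l) : x ≤ l.foldr max 0 := by
  induction l with
  | nil => simp at h
  | cons a l ih =>
    rcases List.mem_cons.1 h with rfl | h
    · exact le_max_left _ _
    · exact (ih h).trans (le_max_right _ _)

theorem foldr_max_le {l : List ℕ} {m : ℕ} (h : ∀ x ∈ l, x ≤ m) : l.foldr max 0 ≤ m := by
  induction l with
  | nil => simp
  | cons a l ih =>
    exact max_le (h a (by simp)) (ih fun x hx => h x (by simp [hx]))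

theorem freshVar_codes (S : Sequent L) : freshVar (S.codes.1 ++ S.codes.2) = S.fresh := by
  have hm (x : ℕ) : x ∈ (S.codes.1 ++ S.codes.2).flatMap fmVars ↔
      x ∈ setFv S.left ∪ setFv S.right := by
    simp only [Sequent.codes, List.mem_flatMap, List.mem_append, mem_setList', Finset.mem_union,
      setFv, Finset.mem_biUnion]
    constructor
    · rintro ⟨c, ⟨φ, h, rfl⟩ | ⟨φ, h, rfl⟩, hx⟩
      exacts [.inl ⟨φ, h, (mem_fmVars φ).1 hx⟩, .inr ⟨φ, h, (mem_fmVars φ).1 hx⟩]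
    · rintro (⟨φ, h, hx⟩ | ⟨φ, h, hx⟩)
      exacts [⟨_, .inl ⟨φ, h, rfl⟩, (mem_fmVars φ).2 hx⟩,
        ⟨_, .inr ⟨φ, h, rfl⟩, (mem_fmVars φ).2 hx⟩]
  rw [freshVar, Sequent.fresh]
  congr 1
  refine le_antisymm (foldr_max_le fun x hx => ?_) (Finset.sup_le fun x hx => ?_)
  · exact Finset.le_sup (f := id) ((hm x).1 hx)
  · exact le_foldr_max ((hm x).2 hx)

/-- A finite tree, on codes. -/
def FinTree.table : FinTree L → Table
  | .opn S => [([], (Label.opn S).code)]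
  | .nul I => [([], (Label.inf I).code)]
  | .one I t => ([], (Label.inf I).code) :: t.table.map (under 0)
  | .two I t₀ t₁ => ([], (Label.inf I).code) :: (t₀.table.map (under 0) ++ t₁.table.map (under 1))

theorem lookup_under_cons (j k : ℕ) (p : List ℕ) (T : Table) :
    (T.map (under k)).lookup (j :: p) = if j = k then T.lookup p else none := by
  induction T with
  | nil => simp
  | cons e T ih =>
    rw [List.map_cons, under, List.lookup_cons, List.lookup_cons, ih]
    have hb : (j :: p == k :: e.1) = (j == k && p == e.1) := rfl
    rw [hb]
    by_cases h : j = k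
    · cases h' : p == e.1 <;> simp [h]
    · simp only [beq_eq_false_iff_ne.2 h, Bool.false_and, if_neg h]

theorem lookup_table (t : FinTree L) (p : List ℕ) :
    t.table.lookup p = (t.label p).map Label.code := by
  induction t generalizing p with
  | opn S => cases p <;> simp [FinTree.table, FinTree.label]
  | nul I => cases p <;> simp [FinTree.table, FinTree.label]
  | one I t ih =>
    cases p with
    | nil => simp [FinTree.table, FinTree.label]
    | cons j p =>
      rw [FinTree.table, List.lookup_cons, lookup_under_cons, ih]
      rcases j with _ | j <;> simp [FinTree.label]
  | two I t₀ t₁ ih₀ ih₁ =>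
    cases p with
    | nil => simp [FinTree.table, FinTree.label]
    | cons j p =>
      rw [FinTree.table, List.lookup_cons, List.lookup_append, lookup_under_cons,
        lookup_under_cons, ih₀, ih₁]
      rcases j with _ | _ | j <;> simp [FinTree.label]

theorem growTable_under (f : ℕ → Table) (k : ℕ) (T : Table) :
    growTable f (T.map (under k)) = (growTable f T).map (under k) := by
  simp only [growTable, List.flatMap_map, List.map_flatMap, under]
  refine List.flatMap_congr fun e _ => ?_
  split_ifs with h <;> simp [under, h]

/-- Tables and trees grow alike if their open nodes do. -/
theorem table_grow {f : ℕ → Table} {F : Sequent L → FinTree L}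
    (h : ∀ S, f (Label.opn S).code = (F S).table) (t : FinTree L) :
    (t.grow F).table = growTable f t.table := by
  have hinf (I : Inference L) (T : Table) : growTable f (([], (Label.inf I).code) :: T) =
      ([], (Label.inf I).code) :: growTable f T := by
    simp [growTable, Label.code]
  induction t with
  | opn S => simp [FinTree.grow, FinTree.table, growTable, ← h, Label.code]
  | nul I => exact (hinf I []).symm
  | one I t ih => rw [FinTree.grow, FinTree.table, FinTree.table, hinf, growTable_under, ih]
  | two I t₀ t₁ ih₀ ih₁ =>
    rw [FinTree.grow, FinTree.table, FinTree.table, hinf, growTable, List.flatMap_append,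
      ← growTable, ← growTable, growTable_under, growTable_under, ih₀, ih₁]

theorem weakRTable_eq (Γ Δ : Finset (Formula₀ L)) (t : FinTree L) (ds : List (Formula₀ L)) :
    weakRTable (setList Γ) (setList Δ) (ds.map Fml.code) t.table =
      ((weaken Γ Δ t [] ds).table, setList (Δ ∪ ds.toFinset)) := by
  induction ds with
  | nil => simp [weakRTable, weaken]
  | cons φ ds ih =>
    rw [List.map_cons, weakRTable, List.foldr_cons, ← weakRTable, ih]
    simp [weaken, FinTree.table, Label.code, Inference.code]

theorem weakLTable_eq (Γ Δ : Finset (Formula₀ L)) (t : FinTree L) (gs ds : List (Formula₀ L)) :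
    weakLTable (setList Γ) (setList (Δ ∪ ds.toFinset)) (gs.map Fml.code)
        (weaken Γ Δ t [] ds).table =
      ((weaken Γ Δ t gs ds).table, setList (Γ ∪ gs.toFinset)) := by
  induction gs with
  | nil => simp [weakLTable]
  | cons φ gs ih =>
    rw [List.map_cons, weakLTable, List.foldr_cons, ← weakLTable, ih]
    simp [weaken, FinTree.table, Label.code, Inference.code]

theorem weakTable_eq (Γ Δ : Finset (Formula₀ L)) (t : FinTree L) (gs ds : List (Formula₀ L)) :
    weakTable (setList Γ) (setList Δ) (gs.map Fml.code) (ds.map Fml.code) t.table =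
      (weaken Γ Δ t gs ds).table := by
  rw [weakTable, weakRTable_eq, weakLTable_eq]

theorem head?_isEqRefl (l : List (Formula₀ L)) :
    ((l.map Fml.code).filter fun c => decide (IsEqRefl c)).head? =
      (l.findSome? eqReflArg).map fun t => (Fml.eq t t : Formula₀ L).code := by
  induction l with
  | nil => rfl
  | cons φ l ih =>
    rw [List.map_cons, List.filter_cons, List.findSome?_cons]
    cases φ with
    | eq s t =>
      by_cases h : s = t
      · simp [IsEqRefl, eqReflArg, Fml.code, h]
      · simpa [IsEqRefl, eqReflArg, Fml.code, h, tmCode_injective.eq_iff] using ih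
    | _ => simpa [IsEqRefl, eqReflArg, Fml.code] using ih

theorem head?_isRtcRefl (l : List (Formula₀ L)) :
    ((l.map Fml.code).filter fun c => decide (IsRtcRefl c)).head? =
      (l.findSome? rtcReflArg).map fun q => (Fml.rtc q.1 q.2 q.2 : Formula₀ L).code := by
  induction l with
  | nil => rfl
  | cons φ l ih =>
    rw [List.map_cons, List.filter_cons, List.findSome?_cons]
    cases φ with
    | rtc φ s t =>
      by_cases h : s = t
      · simp [IsRtcRefl, rtcReflArg, Fml.code, h]
      · simpa [IsRtcRefl, rtcReflArg, Fml.code, h, tmCode_injective.eq_iff] using ih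
    | _ => simpa [IsRtcRefl, rtcReflArg, Fml.code] using ih

theorem closeTable_codes (S : Sequent L) :
    closeTable S.codes = (close S).map FinTree.table := by
  rw [closeTable, close, Sequent.codes, setList_inter, setList, List.head?_map]
  cases h₁ : (S.left ∩ S.right).sort.head? with
  | some φ =>
    simp only [Option.map_some, Option.elim_some, setList_erase, Option.some.injEq]
    exact (congrArg₂ (fun a b => weakTable a b _ _ _) (setList_singleton φ).symm
      (setList_singleton φ).symm).trans (weakTable_eq {φ} {φ} (.nul (.ax φ)) _ _)
  | none =>
    simp only [Option.map_none, Option.elim_none]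
    rw [setList, setList, head?_isEqRefl, head?_isRtcRefl]
    cases h₂ : S.right.sort.findSome? eqReflArg with
    | some t =>
      simp only [Option.map_some, Option.elim_some, Option.some.injEq]
      rw [← setList, ← setList, setList_erase]
      refine Eq.trans ?_ (weakTable_eq ∅ {.eq t t} (.nul (.eqR t)) _ _)
      rw [setList_empty, setList_singleton]
      simp [setList, FinTree.table, Label.code, Inference.code, Fml.code]
    | none =>
      simp only [Option.map_none, Option.elim_none]
      cases h₃ : S.right.sort.findSome? rtcReflArg with
      | some q => simp [FinTree.table, Label.code, Inference.code, Fml.code, setCode, listCode]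
      | none => rfl

/-- The parameters of a schedule element. -/
def Elem.params (e : Elem L) : List ℕ := Denumerable.ofNat (List ℕ) e.code

theorem Elem.ofNat_code (e : Elem L) : Denumerable.ofNat (List ℕ) e.code = e.params := rfl

/-- An inference, on codes. -/
def Inference.ruleCode (I : Inference L) : RuleCode := (I.code, I.premises.map Sequent.codes)

/-- The codes of the formulas with a given outermost symbol, folded back. -/
theorem code_fold {n : ℕ} : (∀ φ : Fml L n, Nat.pair 2 φ.code = (Fml.neg φ).code) ∧
    (∀ φ ψ : Fml L n, Nat.pair 3 (Nat.pair φ.code ψ.code) = (Fml.and φ ψ).code) ∧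
    (∀ φ ψ : Fml L n, Nat.pair 4 (Nat.pair φ.code ψ.code) = (Fml.or φ ψ).code) ∧
    (∀ φ ψ : Fml L n, Nat.pair 5 (Nat.pair φ.code ψ.code) = (Fml.imp φ ψ).code) ∧
    (∀ φ : Fml L (n + 1), Nat.pair 6 φ.code = (Fml.all φ).code) ∧
    (∀ φ : Fml L (n + 1), Nat.pair 7 φ.code = (Fml.ex φ).code) :=
  ⟨fun _ => rfl, fun _ _ => rfl, fun _ _ => rfl, fun _ _ => rfl, fun _ => rfl, fun _ => rfl⟩

theorem code_fold_eq (s t : Term₀ L) :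
    Nat.pair 0 (Nat.pair (tmCode s) (tmCode t)) = (Fml.eq s t).code := rfl

theorem code_fold_rtc (φ : Fml L 2) (s t : Term₀ L) :
    Nat.pair 8 (Nat.pair φ.code (Nat.pair (tmCode s) (tmCode t))) = (Fml.rtc φ s t).code := rfl

theorem leftCode_params (e : Elem L) (S : Sequent L) :
    leftCode e.params S.codes = (leftRule S e).map Inference.ruleCode := by
  rw [Elem.params]
  cases e with
  | rtc φ s t r z Γ Δ h =>
    simp only [Elem.code, Denumerable.ofNat_encode, leftRule, leftCode, caseCode,
      List.getD_cons_zero, List.getD_cons_succ, listCode, code_fold_rtc, Sequent.codes, mem_setList,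
      setList_all_insert, setList_all, show Nat.pair 0 z = tmCode (fvar z : Term₀ L) from rfl,
      ← code_inst₂, ins_setList,
      code_fold_eq]
    norm_num only [if_true, if_false]
    split_ifs <;> rfl
  | eq s t x φ n Γ Δ =>
    cases n <;>
    simp only [Elem.code, Denumerable.ofNat_encode, leftRule, leftCode, eqRuleCode, eqCode,
      List.getD_cons_zero, List.getD_cons_succ, listCode, code_fold_eq, Sequent.codes, mem_setList,
      setList_all_insert, ← code_subst₁, ins_setList] <;>
    norm_num only [if_true, if_false, Encodable.encode_false, Encodable.encode_true] <;>
    split_ifs <;> rfl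
  | ex φ t =>
    simp only [Elem.code, Denumerable.ofNat_encode, leftRule, leftCode, List.getD_cons_zero,
      List.getD_cons_succ, freshVar_codes, ← code_inst, code_fold,
      show Nat.pair 0 S.fresh = tmCode (fvar S.fresh : Term₀ L) from rfl]
    simp only [Sequent.codes, mem_setList, ins_setList]
    norm_num only [if_true, if_false]
    split_ifs <;> rfl
  | _ =>
    simp only [Elem.code, Denumerable.ofNat_encode, leftRule, leftCode, propLeftCode,
      List.getD_cons_zero, List.getD_cons_succ, Sequent.codes, ← code_inst, code_fold, mem_setList,
      ins_setList]
    norm_num only [if_true, if_false]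
    split_ifs <;> rfl

theorem rightCode_params (e : Elem L) (S : Sequent L) :
    rightCode e.params S.codes = (rightRule S e).map Inference.ruleCode := by
  rw [Elem.params]
  cases e with
  | rtc φ s t r z Γ Δ h =>
    simp only [Elem.code, Denumerable.ofNat_encode, rightRule, rightCode, List.getD_cons_zero,
      List.getD_cons_succ, code_fold_rtc, Sequent.codes, mem_setList, ← code_inst₂, ins_setList]
    norm_num only [if_true, if_false]
    split_ifs <;> rfl
  | all φ t =>
    simp only [Elem.code, Denumerable.ofNat_encode, rightRule, rightCode, List.getD_cons_zero,
      List.getD_cons_succ, freshVar_codes, ← code_inst, code_fold,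
      show Nat.pair 0 S.fresh = tmCode (fvar S.fresh : Term₀ L) from rfl]
    simp only [Sequent.codes, mem_setList, ins_setList]
    norm_num only [if_true, if_false]
    split_ifs <;> rfl
  | eq s t x φ n Γ Δ =>
    simp only [Elem.code, Denumerable.ofNat_encode, rightRule, rightCode, List.getD_cons_zero]
    rfl
  | _ =>
    simp only [Elem.code, Denumerable.ofNat_encode, rightRule, rightCode, propRightCode,
      List.getD_cons_zero, List.getD_cons_succ, Sequent.codes, ← code_inst, code_fold, mem_setList,
      ins_setList]
    norm_num only [if_true, if_false]
    split_ifs <;> rfl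

theorem Inference.length_premises (I : Inference L) : I.premises.length ≤ 2 := by
  cases I <;> simp [Inference.premises]

theorem applyTable_codes (S : Sequent L) (o : Option (Inference L)) :
    applyTable S.codes (o.map Inference.ruleCode) = (applyRule S o).table := by
  cases o with
  | none => rfl
  | some I =>
    have h := I.length_premises
    simp only [applyTable, applyRule, FinTree.rule, Option.map_some, Option.elim_some,
      Inference.ruleCode]
    rcases hp : I.premises with _ | ⟨S₀, _ | ⟨S₁, _ | ⟨S₂, l⟩⟩⟩
    · rfl
    · rfl
    · rfl
    · rw [hp, List.length_cons, List.length_cons, List.length_cons] at h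
      omega

/-- What the search does at an open node, on codes. -/
theorem developTable_code (e : Elem L) (S : Sequent L) :
    developTable e.params (Label.opn S).code = (develop e S).table := by
  rw [developTable, develop, openSeq_code, closeTable_codes]
  cases close S with
  | some t => rfl
  | none =>
    rw [Option.map_none, Option.elim_none, leftCode_params, applyTable_codes, ← table_grow]
    intro S'
    rw [openSeq_code, rightCode_params, applyTable_codes]

theorem stage_succ_table (E : ℕ → Elem L) (S : Sequent L) (i : ℕ) :
    (stage E S (i + 1)).table = growTable (developTable (E i).params) (stage E S i).table :=
  table_grow (developTable_code (E i)) _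

end Codes
end RTC

namespace RTC
variable {L : FirstOrder.Language.{u, v}}

/-! ### Recursive search trees -/

theorem FinTree.grow_grow (t : FinTree L) (f g : Sequent L → FinTree L) :
    (t.grow f).grow g = t.grow fun S => (f S).grow g := by
  induction t with
  | opn S => rfl
  | nul I => rfl
  | one I t ih => simp [FinTree.grow, ih]
  | two I t₀ t₁ ih₀ ih₁ => simp [FinTree.grow, ih₀, ih₁]

/-- No open node of the table lies at or below the root on the way to the address `p`. -/
def settled (T : Table) (p : List ℕ) : Bool :=
  T.all fun e => decide (¬ (e.2.unpair.1 = 0 ∧ e.1 = p.take e.1.length))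

@[fun_prop] theorem settled_primrec {α : Type*} [Primcodable α] {T : α → Table} {p : α → List ℕ}
    (hT : Primrec T) (hp : Primrec p) : Primrec fun a => settled (T a) (p a) := by
  unfold settled
  fun_prop

theorem settled_under {k : ℕ} {T : Table} {p : List ℕ} :
    settled (T.map (under k)) (k :: p) = settled T p := by
  rw [Bool.eq_iff_iff]
  simp only [settled, List.all_eq_true, List.mem_map, decide_eq_true_eq, forall_exists_index,
    and_imp, forall_apply_eq_imp_iff₂, under, List.length_cons, List.take_succ_cons,
    List.cons.injEq, true_and]

section Codes

variable [∀ n, Encodable (L.Functions n)] [∀ n, Encodable (L.Relations n)]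

/-- The label at an address is final once the nodes on the way to it are closed. -/
theorem label_grow_of_settled {t : FinTree L} {p : List ℕ} (h : settled t.table p = true)
    (f : Sequent L → FinTree L) : (t.grow f).label p = t.label p := by
  induction t generalizing p with
  | opn S => simp [settled, FinTree.table, Label.code] at h
  | nul I => rfl
  | one I t ih =>
    rcases p with _ | ⟨_ | j, p⟩
    · rfl
    · refine ih ?_
      rw [← settled_under]
      exact (Bool.and_eq_true_iff.1 h).2
    · rfl
  | two I t₀ t₁ ih₀ ih₁ =>
    rw [FinTree.table, settled, List.all_cons, List.all_append] at h
    rcases p with _ | ⟨_ | _ | j, p⟩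
    · rfl
    · refine ih₀ ?_
      rw [← settled_under]
      exact (Bool.and_eq_true_iff.1 (Bool.and_eq_true_iff.1 h).2).1
    · refine ih₁ ?_
      rw [← settled_under]
      exact (Bool.and_eq_true_iff.1 (Bool.and_eq_true_iff.1 h).2).2
    · rfl

theorem label_of_mem_table {t : FinTree L} {e : List ℕ × ℕ} (h : e ∈ t.table) :
    (t.label e.1).map Label.code = some e.2 := by
  induction t generalizing e with
  | opn S | nul I =>
    obtain rfl := List.mem_singleton.1 h
    rfl
  | one I t ih =>
    rcases List.mem_cons.1 h with rfl | h
    · rfl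
    · obtain ⟨d, hd, rfl⟩ := List.mem_map.1 h
      exact ih hd
  | two I t₀ t₁ ih₀ ih₁ =>
    rcases List.mem_cons.1 h with rfl | h
    · rfl
    · rcases List.mem_append.1 h with h | h
      · obtain ⟨d, hd, rfl⟩ := List.mem_map.1 h
        exact ih₀ hd
      · obtain ⟨d, hd, rfl⟩ := List.mem_map.1 h
        exact ih₁ hd

theorem exists_stage_add (E : ℕ → Elem L) (S : Sequent L) (i k : ℕ) :
    ∃ f, stage E S (i + k) = (stage E S i).grow f := by
  induction k with
  | zero =>
    refine ⟨.opn, ?_⟩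
    rw [Nat.add_zero]
    induction stage E S i with
    | opn S => rfl
    | nul I => rfl
    | one I t ih => rw [FinTree.grow, ← ih]
    | two I t₀ t₁ ih₀ ih₁ => rw [FinTree.grow, ← ih₀, ← ih₁]
  | succ k ih =>
    obtain ⟨f, hf⟩ := ih
    exact ⟨_, by rw [← Nat.add_assoc, stage, hf, FinTree.grow_grow]⟩

theorem searchTree_of_settled {E : ℕ → Elem L} {S : Sequent L} {i : ℕ} {p : List ℕ}
    (h : settled (stage E S i).table p = true) :
    searchTree E S p = (stage E S i).label p := by
  obtain ⟨N, hN⟩ := eventually_atTop.1 (eventually_searchTree E S p)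
  obtain ⟨f, hf⟩ := exists_stage_add E S i N
  rw [← hN (i + N) (Nat.le_add_left _ _), hf, label_grow_of_settled h]

/-- If the search tree has no open nodes, each address is settled at some stage: from some stage on
the finitely many labels on the way to it are those of the search tree. -/
theorem exists_settled {E : ℕ → Elem L} {S : Sequent L}
    (h : ∀ p S', searchTree E S p ≠ some (.opn S')) (p : List ℕ) :
    ∃ i, settled (stage E S i).table p = true := by
  have hev : ∀ᶠ i in atTop, ∀ k ∈ Finset.range (p.length + 1),
      (stage E S i).label (p.take k) = searchTree E S (p.take k) :=
    (Finset.eventually_all _).2 fun k _ => eventually_searchTree E S _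
  obtain ⟨i, hi⟩ := hev.exists
  refine ⟨i, ?_⟩
  rw [settled, List.all_eq_true]
  intro e he
  rw [decide_eq_true_eq]
  rintro ⟨h0, hp⟩
  have hk := hi e.1.length (Finset.mem_range.2 (by
    have := congrArg List.length hp
    rw [List.length_take] at this
    omega))
  have hl := label_of_mem_table he
  rw [← hp] at hk
  rw [hk] at hl
  obtain ⟨l, hl, hc⟩ := Option.map_eq_some_iff.1 hl
  cases l with
  | opn S' => exact h _ _ hl
  | inf I => simp [← hc, Label.code] at h0

theorem stage_table_computable {E : ℕ → Elem L} (hE : RecursiveSchedule E) (S : Sequent L) :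
    Computable fun i => (stage E S i).table := by
  obtain ⟨G, hG, hGe⟩ : ∃ G : ℕ × Table → Table, Computable G ∧
      ∀ q, G q = growTable (developTable (Denumerable.ofNat (List ℕ) q.1)) q.2 :=
    ⟨_, Primrec.to_comp (by fun_prop), fun _ => rfl⟩
  have hs : Computable₂ fun (_ : ℕ) (q : ℕ × Table) => G ((E q.1).code, q.2) :=
    hG.comp ((hE.comp (Computable.fst.comp Computable.snd)).pair
      (Computable.snd.comp Computable.snd))
  refine (Computable.nat_rec Computable.id (Computable.const (stage E S 0).table) hs).of_eq ?_
  intro i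
  induction i with
  | zero => rfl
  | succ i ih =>
    rw [stage_succ_table, ← ih]
    exact hGe _

/-- The label at `p` is found by running the search until `p` is settled. -/
theorem searchTree_recursive {E : ℕ → Elem L} (hE : RecursiveSchedule E) {S : Sequent L}
    (h : ∀ p S', searchTree E S p ≠ some (.opn S')) : RecursiveTree (searchTree E S) := by
  have hT := stage_table_computable hE S
  have hset : Computable fun q : List ℕ × ℕ => settled (stage E S q.2).table q.1 := by
    have : Primrec fun q : Table × List ℕ => settled q.1 q.2 := by fun_prop
    exact this.to_comp.comp ((hT.comp Computable.snd).pair Computable.fst)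
  have hlook : Computable fun q : List ℕ × ℕ => (stage E S q.2).table.lookup q.1 := by
    have : Primrec fun q : Table × List ℕ => q.1.lookup q.2 := by fun_prop
    exact this.to_comp.comp ((hT.comp Computable.snd).pair Computable.fst)
  have hpart := (Partrec.rfind (p := fun p i => Part.some (settled (stage E S i).table p))
    hset.partrec).map hlook.to₂
  refine Partrec.of_eq_tot hpart fun p => ?_
  obtain ⟨n, hn⟩ := exists_settled h p
  obtain ⟨i, hi⟩ := Part.dom_iff_mem.1 (Nat.rfind_dom.2 ⟨n, by simpa using hn, by simp⟩ :
    (Nat.rfind fun i => Part.some (settled (stage E S i).table p)).Dom)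
  refine Part.mem_map_iff _ |>.2 ⟨i, hi, ?_⟩
  have := Nat.rfind_spec hi
  rw [searchTree_of_settled (i := i) (by simpa using this), ← lookup_table]

end Codes
end RTC

namespace RTC
variable {L : FirstOrder.Language.{u, v}}

/-! ### Recognizing codes of schedule elements -/

/-- The facts on which it depends whether the list gives the parameters of a schedule element. -/
def elemFacts (l : List ℕ) : List ℕ :=
  if l = [0, l.getD 1 0] then fmFacts (l.getD 1 0)
  else if l = [1, l.getD 1 0, l.getD 2 0] ∨ l = [2, l.getD 1 0, l.getD 2 0] ∨
      l = [3, l.getD 1 0, l.getD 2 0] then fmFacts (l.getD 1 0) ++ fmFacts (l.getD 2 0)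
  else if l = [4, l.getD 1 0, l.getD 2 0] ∨ l = [5, l.getD 1 0, l.getD 2 0] then
    (fmFacts (l.getD 1 0)).map (fun f => lowerFact 1 f) ++ tmFacts (l.getD 2 0)
  else if l = [6, l.getD 1 0, l.getD 2 0, l.getD 3 0, l.getD 4 0, l.getD 5 0, l.getD 6 0,
        l.getD 7 0] ∧
      l.getD 5 0 ∉ (Denumerable.ofNat (List ℕ) (l.getD 6 0)).flatMap fmVars ∧
      l.getD 5 0 ∉ (Denumerable.ofNat (List ℕ) (l.getD 7 0)).flatMap fmVars ∧
      l.getD 5 0 ∉ fmVars (Nat.pair 8 (Nat.pair (l.getD 1 0) (Nat.pair (l.getD 2 0)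
        (l.getD 3 0)))) then
    (fmFacts (l.getD 1 0)).map (fun f => lowerFact 2 f) ++ tmFacts (l.getD 2 0) ++
      tmFacts (l.getD 3 0) ++ tmFacts (l.getD 4 0) ++
      (Denumerable.ofNat (List ℕ) (l.getD 6 0)).flatMap fmFacts ++
      (Denumerable.ofNat (List ℕ) (l.getD 7 0)).flatMap fmFacts
  else if l = [7, l.getD 1 0, l.getD 2 0, l.getD 3 0, l.getD 4 0, l.getD 5 0, l.getD 6 0,
      l.getD 7 0] ∧ l.getD 5 0 < 2 then
    tmFacts (l.getD 1 0) ++ tmFacts (l.getD 2 0) ++ fmFacts (l.getD 4 0) ++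
      (Denumerable.ofNat (List ℕ) (l.getD 6 0)).flatMap fmFacts ++
      (Denumerable.ofNat (List ℕ) (l.getD 7 0)).flatMap fmFacts
  else [Nat.pair 3 0]

theorem elemFacts_primrec : Primrec elemFacts := by
  unfold elemFacts
  fun_prop

/-- A decidable property may be checked on all members of a list; unlike `primrec_all`, this allows
properties that are not primitive recursive. -/
theorem all_computable {p : ℕ → Bool} (hp : Computable p) :
    Computable fun l : List ℕ => l.all p := by
  have hg : Computable fun q : List ℕ × ℕ => q.1.getD q.2 0 := Primrec.to_comp (by fun_prop)
  have hs : Computable₂ fun (l : List ℕ) (q : ℕ × Bool) => q.2 && p (l.getD q.1 0) :=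
    Primrec.and.to_comp.comp (Computable.snd.comp Computable.snd)
      (hp.comp (hg.comp (Computable.fst.pair (Computable.fst.comp Computable.snd))))
  refine (Computable.nat_rec Computable.list_length (Computable.const true) hs).of_eq fun l => ?_
  have (k : ℕ) (hk : k ≤ l.length) : Nat.rec (motive := fun _ => Bool) true
      (fun y IH => IH && p (l.getD y 0)) k = (l.take k).all p := by
    induction k with
    | zero => simp
    | succ k ih =>
      rw [List.take_succ_eq_append_getElem hk, List.all_append, ← ih (Nat.le_of_succ_le hk)]
      simp [List.getElem?_eq_getElem hk]
  rw [this _ le_rfl, List.take_length]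

section Codes

variable [∀ n, Encodable (L.Functions n)] [∀ n, Encodable (L.Relations n)]

theorem Elem.code_eq_iff (e : Elem L) (c : ℕ) :
    e.code = c ↔ e.params = Denumerable.ofNat (List ℕ) c :=
  (Denumerable.eqv (List ℕ)).symm.injective.eq_iff.symm

theorem Elem.encode_params (e : Elem L) : Encodable.encode e.params = e.code := by
  rw [params, Denumerable.encode_ofNat]

theorem Elem.params_eq (e : Elem L) : e.params = match e with
  | .neg φ => [0, φ.code]
  | .and φ ψ => [1, φ.code, ψ.code]
  | .or φ ψ => [2, φ.code, ψ.code]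
  | .imp φ ψ => [3, φ.code, ψ.code]
  | .all φ t => [4, φ.code, tmCode t]
  | .ex φ t => [5, φ.code, tmCode t]
  | .rtc φ s t r z Γ Δ _ => [6, φ.code, tmCode s, tmCode t, tmCode r, z, listCode Γ, listCode Δ]
  | .eq s t x φ n Γ Δ =>
      [7, tmCode s, tmCode t, x, φ.code, Encodable.encode n, listCode Γ, listCode Δ] := by
  rw [params]
  cases e <;> exact Denumerable.ofNat_encode _

theorem listCode_injective : Function.Injective (listCode : List (Formula₀ L) → ℕ) :=
  Encodable.encode_injective.comp (List.map_injective_iff.2 Fml.code_injective)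

theorem Elem.code_injective : Function.Injective (Elem.code : Elem L → ℕ) := by
  intro e e' h
  have h := congrArg (Denumerable.ofNat (List ℕ)) h
  rw [← params, ← params, params_eq, params_eq] at h
  cases e <;> cases e' <;> simp [Fml.code_injective.eq_iff, tmCode_injective.eq_iff,
    listCode_injective.eq_iff, Encodable.encode_inj] at h <;> simp [h]

theorem factsHold_formulas {l : List ℕ} :
    FactsHold L 0 (l.flatMap fmFacts) ↔ ∃ Γ : List (Formula₀ L), Γ.map Fml.code = l := by
  simp only [factsHold_flatMap, factsHold_fmFacts]
  constructor
  · intro h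
    induction l with
    | nil => exact ⟨[], rfl⟩
    | cons c l ih =>
      obtain ⟨φ, rfl⟩ := h c (by simp)
      obtain ⟨Γ, rfl⟩ := ih fun x hx => h x (by simp [hx])
      exact ⟨φ :: Γ, rfl⟩
  · rintro ⟨Γ, rfl⟩ x hx
    obtain ⟨φ, -, rfl⟩ := List.mem_map.1 hx
    exact ⟨φ, rfl⟩

theorem not_mem_flatMap_fmVars {z : ℕ} {Γ : List (Formula₀ L)} :
    z ∉ (Γ.map Fml.code).flatMap fmVars ↔ ∀ ψ ∈ Γ, z ∉ ψ.fv := by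
  simp [List.mem_flatMap, mem_fmVars]

theorem exists_elem_of_factsHold {l : List ℕ} (h : FactsHold L 0 (elemFacts l)) :
    ∃ e : Elem L, e.params = l := by
  unfold elemFacts at h
  split_ifs at h with h₀ h₁ h₄ h₆ h₇
  · obtain ⟨φ, hφ⟩ := factsHold_fmFacts.1 h
    exact ⟨.neg φ, by rw [Elem.params_eq]; simp only [hφ]; exact h₀.symm⟩
  · rw [factsHold_append, factsHold_fmFacts, factsHold_fmFacts] at h
    obtain ⟨⟨φ, hφ⟩, ψ, hψ⟩ := h
    rcases h₁ with h₁ | h₁ | h₁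
    · exact ⟨.and φ ψ, by rw [Elem.params_eq]; simp only [hφ, hψ]; exact h₁.symm⟩
    · exact ⟨.or φ ψ, by rw [Elem.params_eq]; simp only [hφ, hψ]; exact h₁.symm⟩
    · exact ⟨.imp φ ψ, by rw [Elem.params_eq]; simp only [hφ, hψ]; exact h₁.symm⟩
  · rw [factsHold_append, factsHold_lower, factsHold_fmFacts, factsHold_tmFacts] at h
    obtain ⟨⟨φ, hφ⟩, t, ht⟩ := h
    rcases h₄ with h₄ | h₄
    · exact ⟨.all φ t, by rw [Elem.params_eq]; simp only [hφ, ht]; exact h₄.symm⟩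
    · exact ⟨.ex φ t, by rw [Elem.params_eq]; simp only [hφ, ht]; exact h₄.symm⟩
  · simp only [factsHold_append, factsHold_lower, factsHold_fmFacts, factsHold_tmFacts,
      factsHold_formulas] at h
    obtain ⟨⟨⟨⟨⟨⟨φ, hφ⟩, s, hs⟩, t, ht⟩, r, hr⟩, Γ, hΓ⟩, Δ, hΔ⟩ := h
    obtain ⟨h₆, hzΓ, hzΔ, hz⟩ := h₆
    rw [← hΓ, not_mem_flatMap_fmVars] at hzΓ
    rw [← hΔ, not_mem_flatMap_fmVars] at hzΔ
    rw [← hφ, ← hs, ← ht] at hz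
    refine ⟨.rtc φ s t r (l.getD 5 0) Γ Δ ⟨hzΓ, hzΔ, fun hm => hz ?_⟩, ?_⟩
    · exact (mem_fmVars (Fml.rtc φ s t)).2 hm
    · rw [Elem.params_eq]
      simp only [listCode, hφ, hs, ht, hr, hΓ, hΔ, Denumerable.encode_ofNat]
      exact h₆.symm
  · simp only [factsHold_append, factsHold_fmFacts, factsHold_tmFacts, factsHold_formulas] at h
    obtain ⟨⟨⟨⟨⟨s, hs⟩, t, ht⟩, φ, hφ⟩, Γ, hΓ⟩, Δ, hΔ⟩ := h
    obtain ⟨h₇, hn⟩ := h₇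
    obtain ⟨n, hn⟩ : ∃ n : Bool, Encodable.encode n = l.getD 5 0 := by
      rcases (by omega : l.getD 5 0 = 0 ∨ l.getD 5 0 = 1) with h | h
      exacts [⟨false, h.symm⟩, ⟨true, h.symm⟩]
    refine ⟨.eq s t (l.getD 3 0) φ n Γ Δ, ?_⟩
    rw [Elem.params_eq]
    simp only [listCode, hφ, hs, ht, hn, hΓ, hΔ, Denumerable.encode_ofNat]
    exact h₇.symm
  · simp at h

theorem factsHold_elemFacts_params (e : Elem L) : FactsHold L 0 (elemFacts e.params) := by
  rw [Elem.params_eq]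
  cases e with
  | rtc φ s t r z Γ Δ h =>
    have h₁ := not_mem_flatMap_fmVars.2 h.1
    have h₂ := not_mem_flatMap_fmVars.2 h.2.1
    have h₃ : z ∉ fmVars (Nat.pair 8 (Nat.pair φ.code (Nat.pair (tmCode s) (tmCode t)))) :=
      fun hm => h.2.2 ((mem_fmVars (Fml.rtc φ s t)).1 hm)
    simp only [elemFacts, List.getD_cons_zero, List.getD_cons_succ, listCode,
      Denumerable.ofNat_encode, h₁, h₂, h₃, not_false_eq_true, and_true]
    simp [factsHold_fmFacts, factsHold_tmFacts, factsHold_formulas]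
  | eq s t x φ n Γ Δ =>
    have : Encodable.encode n < 2 := by cases n <;> simp
    simp only [elemFacts, List.getD_cons_zero, List.getD_cons_succ, listCode,
      Denumerable.ofNat_encode, this, and_true]
    simp [factsHold_fmFacts, factsHold_tmFacts, factsHold_formulas]
  | _ => simp [elemFacts, factsHold_fmFacts, factsHold_tmFacts]

/-- Being the code of a schedule element comes down to finitely many facts about the numbers of
symbols. -/
theorem factsHold_elemFacts {c : ℕ} :
    FactsHold L 0 (elemFacts (Denumerable.ofNat (List ℕ) c)) ↔ ∃ e : Elem L, e.code = c := by
  simp only [Elem.code_eq_iff]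
  exact ⟨exists_elem_of_factsHold, fun ⟨e, he⟩ => he ▸ factsHold_elemFacts_params e⟩

/-- If the signature is recursive, it is decidable which numbers are codes of schedule elements. -/
theorem exists_computable_check (h : RecursiveSignature L) :
    ∃ check : ℕ → Bool, Computable check ∧ ∀ c, check c = true ↔ ∃ e : Elem L, e.code = c := by
  obtain ⟨⟨_, hF⟩, ⟨_, hR⟩⟩ := h
  have hdec : Computable fun f : ℕ =>
      bif decide (f.unpair.1 = 0) then
        decide (∃ g : L.Functions f.unpair.2.unpair.1, Encodable.encode g = f.unpair.2.unpair.2)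
      else bif decide (f.unpair.1 = 1) then
        decide (∃ R : L.Relations f.unpair.2.unpair.1, Encodable.encode R = f.unpair.2.unpair.2)
      else decide (f.unpair.1 = 2 ∧ f.unpair.2 = 0) := by
    have hp : Computable fun f : ℕ => (f.unpair.2.unpair.1, f.unpair.2.unpair.2) :=
      Primrec.to_comp (by fun_prop)
    refine Computable.cond (Primrec.to_comp (by fun_prop)) (hF.comp hp) ?_
    refine Computable.cond (Primrec.to_comp (by fun_prop)) (hR.comp hp) ?_
    exact Primrec.to_comp (by fun_prop)
  have hl : Computable (lowerFact 0) := Primrec.to_comp (by fun_prop)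
  have he : Computable fun c => elemFacts (Denumerable.ofNat (List ℕ) c) :=
    Primrec.to_comp (elemFacts_primrec.comp (by fun_prop))
  refine ⟨_, (all_computable (hdec.comp hl)).comp he, fun c => ?_⟩
  rw [← factsHold_elemFacts, List.all_eq_true, FactsHold]
  refine forall₂_congr fun f _ => ?_
  generalize lowerFact 0 f = f
  rw [FactHolds, FunctionNumber, RelationNumber]
  by_cases h₀ : f.unpair.1 = 0
  · simp [h₀]
  · by_cases h₁ : f.unpair.1 = 1
    · simp [h₁]
    · simp [h₀, h₁]

end Codes
end RTC

namespace RTC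
variable {L : FirstOrder.Language.{u, v}}

/-! ### The fair schedule on codes -/

/-- The codes of the formulas on one side (picked by `f`) of the open nodes. -/
def openSide (f : SeqCode → List ℕ) (T : Table) : List ℕ :=
  T.flatMap fun e => if e.2.unpair.1 = 0 then f (openSeq e.2) else []

/-- `stageOf`, on codes. -/
def stageTable (h : List ℕ) (s : SeqCode) : Table :=
  h.foldl (fun T c => growTable (fun d => developTable (Denumerable.ofNat (List ℕ) c) d) T)
    [([], openCode s)]

/-- A variable that occurs neither in the formulas of the lists nor in `(RTC_{x,y} φ)(s, t)`. -/
def wideVar (φ s t : ℕ) (g d : List ℕ) : ℕ :=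
  freshVar (Nat.pair 8 (Nat.pair φ (Nat.pair s t)) :: (g ++ d))

/-- `Elem.widen`, on parameters. -/
def widenParams (l g d : List ℕ) : List ℕ :=
  if l.getD 0 0 = 6 then
    [6, l.getD 1 0, l.getD 2 0, l.getD 3 0, l.getD 4 0,
      wideVar (l.getD 1 0) (l.getD 2 0) (l.getD 3 0) g d, Encodable.encode g, Encodable.encode d]
  else if l.getD 0 0 = 7 then
    [7, l.getD 1 0, l.getD 2 0, l.getD 3 0, l.getD 4 0, l.getD 5 0, Encodable.encode g,
      Encodable.encode d]
  else l

/-- The sequent whose sides are the lists with the given codes. -/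
def contextCodes (g d : ℕ) : SeqCode :=
  ((Denumerable.ofNat (List ℕ) g).foldr ins [], (Denumerable.ofNat (List ℕ) d).foldr ins [])

/-- `nextElem`, on codes; `b₁` and `b₂` tell whether the two components of the task are codes of
schedule elements.  If the first is not, the value is the code of `¬ x₀ = x₀`. -/
def nextCode (b₁ b₂ : Bool) (h : List ℕ) : ℕ :=
  if b₁ = true then
    if b₂ = true ∧
        (Denumerable.ofNat (List ℕ) h.length.unpair.1.unpair.2).getD 0 0 = 7 then
      Encodable.encode (widenParams (Denumerable.ofNat (List ℕ) h.length.unpair.1.unpair.1)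
        (openSide Prod.fst (stageTable h (contextCodes
          ((Denumerable.ofNat (List ℕ) h.length.unpair.1.unpair.2).getD 6 0)
          ((Denumerable.ofNat (List ℕ) h.length.unpair.1.unpair.2).getD 7 0))))
        (openSide Prod.snd (stageTable h (contextCodes
          ((Denumerable.ofNat (List ℕ) h.length.unpair.1.unpair.2).getD 6 0)
          ((Denumerable.ofNat (List ℕ) h.length.unpair.1.unpair.2).getD 7 0)))))
    else h.length.unpair.1.unpair.1
  else Encodable.encode [0, Nat.pair 0 (Nat.pair (Nat.pair 0 0) (Nat.pair 0 0))]

section Primrec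

variable {α : Type*} [Primcodable α]

@[fun_prop] theorem openSide_primrec {f : SeqCode → List ℕ} {T : α → Table} (hf : Primrec f)
    (hT : Primrec T) : Primrec fun a => openSide f (T a) := by
  unfold openSide
  fun_prop

@[fun_prop] theorem stageTable_primrec {h : α → List ℕ} {s : α → SeqCode} (hh : Primrec h)
    (hs : Primrec s) : Primrec fun a => stageTable (h a) (s a) := by
  unfold stageTable
  fun_prop

@[fun_prop] theorem wideVar_primrec {φ s t : α → ℕ} {g d : α → List ℕ} (hφ : Primrec φ)
    (hs : Primrec s) (ht : Primrec t) (hg : Primrec g) (hd : Primrec d) :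
    Primrec fun a => wideVar (φ a) (s a) (t a) (g a) (d a) := by
  unfold wideVar
  fun_prop

@[fun_prop] theorem widenParams_primrec {l g d : α → List ℕ} (hl : Primrec l)
    (hg : Primrec g) (hd : Primrec d) : Primrec fun a => widenParams (l a) (g a) (d a) := by
  unfold widenParams
  fun_prop

@[fun_prop] theorem contextCodes_primrec {g d : α → ℕ} (hg : Primrec g) (hd : Primrec d) :
    Primrec fun a => contextCodes (g a) (d a) := by
  unfold contextCodes
  fun_prop

theorem nextCode_primrec :
    Primrec fun q : (Bool × Bool) × List ℕ => nextCode q.1.1 q.1.2 q.2 := by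
  unfold nextCode
  fun_prop

end Primrec

/-! ### The fair schedule -/

/-- The stage of the search for a proof of `S` after the schedule elements of the list. -/
noncomputable def stageOf [∀ n, Encodable (L.Functions n)] [∀ n, Encodable (L.Relations n)]
    (h : List (Elem L)) (S : Sequent L) : FinTree L :=
  h.foldl (fun t e => t.grow (develop e)) (.opn S)

section Codes

variable [∀ n, Encodable (L.Functions n)] [∀ n, Encodable (L.Relations n)]

theorem stageOf_eq_stage (E : ℕ → Elem L) (S : Sequent L) (i : ℕ) :
    stageOf ((List.range i).map E) S = stage E S i := by
  induction i with
  | zero => rfl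
  | succ i ih =>
    rw [List.range_succ, List.map_append, stageOf, List.foldl_append, ← stageOf, ih]
    rfl

theorem wideVar_fresh (φ : Fml L 2) (s t : Term₀ L) (Γ Δ : List (Formula₀ L)) :
    let z := wideVar φ.code (tmCode s) (tmCode t) (Γ.map Fml.code) (Δ.map Fml.code)
    (∀ ψ ∈ Γ, z ∉ ψ.fv) ∧ (∀ ψ ∈ Δ, z ∉ ψ.fv) ∧ z ∉ (Fml.rtc φ s t).fv := by
  intro z
  have h (ψ : Formula₀ L)
      (hψ : ψ.code ∈ (Fml.rtc φ s t).code :: (Γ.map Fml.code ++ Δ.map Fml.code)) :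
      z ∉ ψ.fv := fun hz => absurd
    (le_foldr_max (List.mem_flatMap.2 ⟨_, hψ, (mem_fmVars ψ).2 hz⟩)) (Nat.not_succ_le_self _)
  refine ⟨fun ψ hψ => h ψ ?_, fun ψ hψ => h ψ ?_, h _ (by simp)⟩
  · exact List.mem_cons_of_mem _ (List.mem_append_left _ (List.mem_map_of_mem hψ))
  · exact List.mem_cons_of_mem _ (List.mem_append_right _ (List.mem_map_of_mem hψ))

/-- The schedule element with the contexts `Γ` and `Δ` in place of its own, if it has any, and with
a suitable choice of the fresh variable. -/
def Elem.widen : Elem L → List (Formula₀ L) → List (Formula₀ L) → Elem L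
  | .rtc φ s t r _ _ _ _, Γ, Δ => .rtc φ s t r _ Γ Δ (wideVar_fresh φ s t Γ Δ)
  | .eq s t x φ n _ _, Γ, Δ => .eq s t x φ n Γ Δ
  | e, _, _ => e

/-- The contexts of an equality element, as a sequent. -/
def Elem.context : Elem L → Option (Sequent L)
  | .eq _ _ _ _ _ Γ Δ => some ⟨Γ.toFinset, Δ.toFinset⟩
  | _ => none

open Classical in
/-- The schedule element with a given code. -/
noncomputable def decodeElem (c : ℕ) : Option (Elem L) :=
  if h : ∃ e : Elem L, e.code = c then some h.choose else none

theorem decodeElem_code (e : Elem L) : decodeElem e.code = some e := by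
  have h : ∃ e' : Elem L, e'.code = e.code := ⟨e, rfl⟩
  rw [decodeElem, dif_pos h, Elem.code_injective h.choose_spec]

theorem decodeElem_eq_none {c : ℕ} (h : ¬ ∃ e : Elem L, e.code = c) :
    (decodeElem c : Option (Elem L)) = none := dif_neg h

/-- All formulas on the left-hand sides of the open nodes. -/
def FinTree.leftContext (t : FinTree L) : List (Formula₀ L) :=
  t.openNodes.flatMap fun S => S.left.sort

/-- All formulas on the right-hand sides of the open nodes. -/
def FinTree.rightContext (t : FinTree L) : List (Formula₀ L) :=
  t.openNodes.flatMap fun S => S.right.sort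

theorem FinTree.within_contexts (t : FinTree L) : t.Within t.leftContext t.rightContext := by
  intro S hS
  constructor
  · intro φ hφ
    exact List.mem_toFinset.2 (List.mem_flatMap.2 ⟨S, hS, (Finset.mem_sort _).2 hφ⟩)
  · intro φ hφ
    exact List.mem_toFinset.2 (List.mem_flatMap.2 ⟨S, hS, (Finset.mem_sort _).2 hφ⟩)

/-- The schedule element that follows those of `h`.  The task at position `i` is the number
`i.unpair.1`, so that every task occurs infinitely often.  A task is a pair of codes of schedule
elements: the first is to be scheduled, and the second, if it is an equality element, names a
sequent whose search tree the contexts have to cover. -/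
noncomputable def nextElem (h : List (Elem L)) : Elem L :=
  match decodeElem h.length.unpair.1.unpair.1 with
  | none => .neg (.eq (fvar 0) (fvar 0))
  | some e =>
    match (decodeElem h.length.unpair.1.unpair.2).bind Elem.context with
    | none => e
    | some S => e.widen (stageOf h S).leftContext (stageOf h S).rightContext

/-- The first `i` elements of the fair schedule. -/
noncomputable def history : ℕ → List (Elem L)
  | 0 => []
  | i + 1 => history i ++ [nextElem (history i)]

variable (L) in
/-- A fair schedule. -/
noncomputable def fairSchedule (i : ℕ) : Elem L := nextElem (history i)

theorem history_eq (i : ℕ) : history i = (List.range i).map (fairSchedule L) := by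
  induction i with
  | zero => rfl
  | succ i ih =>
    rw [List.range_succ, List.map_append, ← ih]
    rfl

theorem frequently_task (c : ℕ) : ∃ᶠ i : ℕ in atTop, i.unpair.1 = c :=
  frequently_atTop.2 fun a => ⟨Nat.pair c a, Nat.right_le_pair _ _, by simp⟩

theorem fairSchedule_eq {e : Elem L} {S : Sequent L} {e' : Elem L} {i : ℕ}
    (hi : i.unpair.1 = Nat.pair e.code e'.code) (he' : e'.context = some S) :
    fairSchedule L i = e.widen (stage (fairSchedule L) S i).leftContext
      (stage (fairSchedule L) S i).rightContext := by
  have hl : (history i : List (Elem L)).length = i := by rw [history_eq]; simp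
  rw [fairSchedule, nextElem, hl, hi]
  simp only [Nat.unpair_pair, decodeElem_code, Option.bind_some, he']
  rw [history_eq, stageOf_eq_stage]

theorem fairSchedule_eq_of_context_eq_none {e : Elem L} {e' : Elem L} {i : ℕ}
    (hi : i.unpair.1 = Nat.pair e.code e'.code) (he' : e'.context = none) :
    fairSchedule L i = e := by
  have hl : (history i : List (Elem L)).length = i := by rw [history_eq]; simp
  rw [fairSchedule, nextElem, hl, hi]
  simp only [Nat.unpair_pair, decodeElem_code, Option.bind_some, he']

theorem exists_context (S : Sequent L) : ∃ e : Elem L, e.context = some S :=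
  ⟨.eq (fvar 0) (fvar 0) 0 (.eq (fvar 0) (fvar 0)) false S.left.sort S.right.sort,
    by simp [Elem.context]⟩

/-- At the stage `i`, the contexts of the `i`-th element are those of the open nodes, as they depend
on the earlier elements only. -/
theorem fairSchedule_isFair : IsFair (fairSchedule L) where
  recurs e := (frequently_task _).mono fun i hi =>
    fairSchedule_eq_of_context_eq_none (e' := .neg (.eq (fvar 0) (fvar 0))) hi rfl
  rtc S φ s t r := by
    obtain ⟨e', he'⟩ := exists_context S
    refine (frequently_task (Nat.pair (Elem.rtc φ s t r _ [] []
      (wideVar_fresh φ s t [] [])).code e'.code)).mono fun i hi => ?_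
    rw [fairSchedule_eq hi he']
    exact ⟨_, _, _, _, rfl, FinTree.within_contexts _⟩
  eq S s t x φ n := by
    obtain ⟨e', he'⟩ := exists_context S
    refine (frequently_task (Nat.pair (Elem.eq s t x φ n [] []).code e'.code)).mono fun i hi => ?_
    rw [fairSchedule_eq hi he']
    exact ⟨_, _, rfl, FinTree.within_contexts _⟩

/-! ### The fair schedule is recursive -/

theorem openSide_table {f : SeqCode → List ℕ} {g : Sequent L → List (Formula₀ L)}
    (h : ∀ S : Sequent L, f S.codes = (g S).map Fml.code) (t : FinTree L) :
    openSide f t.table = (t.openNodes.flatMap g).map Fml.code := by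
  have hu (k : ℕ) (T : Table) : openSide f (T.map (under k)) = openSide f T := by
    rw [openSide, List.flatMap_map]
    rfl
  induction t with
  | opn S =>
    simp only [openSide, FinTree.table, List.flatMap_singleton, openSeq_code, h]
    simp [Label.code, FinTree.openNodes]
  | nul I => simp [openSide, FinTree.table, Label.code, FinTree.openNodes]
  | one I t ih =>
    rw [FinTree.table, openSide, List.flatMap_cons, ← openSide, hu, ih]
    simp [Label.code, FinTree.openNodes]
  | two I t₀ t₁ ih₀ ih₁ =>
    rw [FinTree.table, openSide, List.flatMap_cons, List.flatMap_append, ← openSide, ← openSide,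
      hu, hu, ih₀, ih₁]
    simp [Label.code, FinTree.openNodes]

theorem openSide_fst_table (t : FinTree L) :
    openSide Prod.fst t.table = t.leftContext.map Fml.code := openSide_table (fun _ => rfl) t

theorem openSide_snd_table (t : FinTree L) :
    openSide Prod.snd t.table = t.rightContext.map Fml.code := openSide_table (fun _ => rfl) t

theorem stageTable_code (h : List (Elem L)) (S : Sequent L) :
    stageTable (h.map Elem.code) S.codes = (stageOf h S).table := by
  induction h using List.reverseRecOn with
  | nil => rfl
  | append_singleton h e ih =>
    rw [List.map_append, stageTable, List.foldl_append, ← stageTable, ih]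
    unfold stageOf
    rw [List.foldl_append]
    exact (table_grow (developTable_code e) _).symm

theorem contextCodes_code (Γ Δ : List (Formula₀ L)) :
    contextCodes (listCode Γ) (listCode Δ) = (⟨Γ.toFinset, Δ.toFinset⟩ : Sequent L).codes := by
  have h (Γ : List (Formula₀ L)) : (Γ.map Fml.code).foldr ins [] = setList Γ.toFinset := by
    induction Γ with
    | nil => simp
    | cons φ Γ ih => simp [ih]
  simp [contextCodes, listCode, h, Sequent.codes]

theorem widenParams_params (e : Elem L) (Γ Δ : List (Formula₀ L)) :
    Encodable.encode (widenParams e.params (Γ.map Fml.code) (Δ.map Fml.code)) =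
      (e.widen Γ Δ).code := by
  rw [← Elem.encode_params (e.widen Γ Δ)]
  congr 1
  rw [Elem.params_eq, Elem.params_eq]
  cases e <;> rfl

theorem nextCode_eq {check : ℕ → Bool} (hc : ∀ c, check c = true ↔ ∃ e : Elem L, e.code = c)
    (h : List (Elem L)) :
    nextCode (check h.length.unpair.1.unpair.1) (check h.length.unpair.1.unpair.2)
      (h.map Elem.code) = (nextElem h).code := by
  rw [nextCode, nextElem, List.length_map]
  by_cases h₁ : ∃ e : Elem L, e.code = h.length.unpair.1.unpair.1
  · rw [if_pos ((hc _).2 h₁)]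
    obtain ⟨e, he⟩ := h₁
    rw [← he, decodeElem_code]
    by_cases h₂ : ∃ e : Elem L, e.code = h.length.unpair.1.unpair.2
    · obtain ⟨e', he'⟩ := h₂
      have hc' : check e'.code = true := (hc _).2 ⟨e', rfl⟩
      simp only [← he', hc', decodeElem_code, Option.bind_some, true_and, Elem.ofNat_code]
      cases e' with
      | eq s t x φ n Γ Δ =>
        rw [Elem.params_eq (Elem.eq s t x φ n Γ Δ)]
        simp only [List.getD_cons_zero, List.getD_cons_succ, if_true, Elem.context]
        rw [contextCodes_code, stageTable_code, openSide_fst_table, openSide_snd_table,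
          widenParams_params]
      | _ =>
        rw [Elem.params_eq]
        rfl
    · rw [decodeElem_eq_none h₂, if_neg fun hh => h₂ ((hc _).1 hh.1)]
      rfl
  · rw [if_neg fun hh => h₁ ((hc _).1 hh), decodeElem_eq_none h₁]
    rfl

/-- The codes of the elements of the history are computed by recursion on its length. -/
theorem fairSchedule_recursive (hL : RecursiveSignature L) :
    RecursiveSchedule (fairSchedule L) := by
  obtain ⟨check, hcheck, hc⟩ := exists_computable_check hL
  have hn : Computable fun h : List ℕ => nextCode (check h.length.unpair.1.unpair.1)
      (check h.length.unpair.1.unpair.2) h := by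
    have h₁ : Computable fun h : List ℕ => h.length.unpair.1.unpair.1 :=
      Primrec.to_comp (by fun_prop)
    have h₂ : Computable fun h : List ℕ => h.length.unpair.1.unpair.2 :=
      Primrec.to_comp (by fun_prop)
    exact nextCode_primrec.to_comp.comp
      (((hcheck.comp h₁).pair (hcheck.comp h₂)).pair Computable.id)
  obtain ⟨N, hN, hNe⟩ : ∃ N : List ℕ → ℕ, Computable N ∧
      ∀ h : List (Elem L), N (h.map Elem.code) = (nextElem h).code :=
    ⟨_, hn, fun h => by rw [List.length_map]; exact nextCode_eq hc h⟩
  have hs : Computable₂ fun (_ : ℕ) (q : ℕ × List ℕ) => q.2 ++ [N q.2] :=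
    Computable.list_concat.comp (Computable.snd.comp Computable.snd)
      (hN.comp (Computable.snd.comp Computable.snd))
  have hh : Computable fun i => (history i : List (Elem L)).map Elem.code := by
    refine (Computable.nat_rec Computable.id (Computable.const []) hs).of_eq fun i => ?_
    induction i with
    | zero => rfl
    | succ i ih =>
      rw [history, List.map_append, ← ih, List.map_singleton, ← hNe, ← ih]
      rfl
  exact (hN.comp hh).of_eq fun i => hNe _

end Codes
end RTC

theorem mainTheorem2 (L : FirstOrder.Language.{u, v})
    [∀ n, Encodable (L.Functions n)] [∀ n, Encodable (L.Relations n)] :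
    -- completeness
    (∀ S : RTC.Sequent L, S.Valid →
      ∃ T : RTC.Tree L, RTC.IsProof T S ∧ RTC.CutFree T ∧
        (RTC.RecursiveSignature L → RTC.RecursiveTree T)) ∧
    -- fair schedules exist
    (∃ E : ℕ → RTC.Elem L, RTC.IsFair E ∧
      (RTC.RecursiveSignature L → RTC.RecursiveSchedule E)) ∧
    -- the search tree for a fair schedule is a proof, or else has limit sequents, each of which
    -- yields a counter-model
    ∀ E : ℕ → RTC.Elem L, RTC.IsFair E → ∀ S : RTC.Sequent L,
      (S.Valid →
        RTC.IsProof (RTC.searchTree E S) S ∧ RTC.CutFree (RTC.searchTree E S) ∧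
          (RTC.RecursiveSchedule E → RTC.RecursiveTree (RTC.searchTree E S))) ∧
      (¬ RTC.IsProof (RTC.searchTree E S) S →
        (∃ G D, RTC.IsLimitSequent (RTC.searchTree E S) G D) ∧
        ∀ G D, RTC.IsLimitSequent (RTC.searchTree E S) G D →
          (∀ φ ∈ S.left, φ ∈ G) ∧ (∀ ψ ∈ S.right, ψ ∈ D) ∧
          (∀ φ ∈ G, φ.Holds (RTC.Herbrand.val G)) ∧
          (∀ ψ ∈ D, ¬ ψ.Holds (RTC.Herbrand.val G))) := by
  obtain ⟨E, hE, hrec⟩ : ∃ E : ℕ → RTC.Elem L, RTC.IsFair E ∧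
      (RTC.RecursiveSignature L → RTC.RecursiveSchedule E) :=
    ⟨_, RTC.fairSchedule_isFair, RTC.fairSchedule_recursive⟩
  refine ⟨fun S hS => ?_, ⟨E, hE, hrec⟩, fun E' hE' S => ⟨fun hS => ?_, fun hS => ?_⟩⟩
  · have hp := RTC.isProof_of_valid hE hS
    exact ⟨_, hp, RTC.searchTree_cutFree _ _,
      fun hL => RTC.searchTree_recursive (hrec hL) hp.1.2⟩
  · have hp := RTC.isProof_of_valid hE' hS
    exact ⟨hp, RTC.searchTree_cutFree _ _, fun h => RTC.searchTree_recursive h hp.1.2⟩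
  · refine ⟨RTC.exists_isLimitSequent hS, fun G D hlim => ?_⟩
    obtain ⟨hl, hr, H⟩ := RTC.isLimitSequent_hintikka hE' hlim
    exact ⟨hl, hr, fun φ hφ => (H.truth _ φ rfl).1 hφ, fun ψ hψ => (H.truth _ ψ rfl).2 hψ⟩
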